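/- **Setting.** Let $\Lambda=\mathbb Z^d\cap[-L,L]^d$ with the nearest-neighbour graph structure and $\mathcal H_\Lambda=\bigotimes_{x\in\Lambda}\mathbb C^q$. An extensive local operator is a sum $A=\sum_S A_S$ over nonempty connected $S\subseteq\Lambda$, where $A_S$ acts as the identity outside $S$; it is self-adjoint if every $A_S$ is. Its local norm is $$\|A\|_\kappa=\sup_{x\in\Lambda}\sum_{S\ni x}\|A_S\|_{\rm op}\,e^{\kappa|S|},$$ and it belongs to $\mathcal O_\kappa$ if this is finite. Write $\langle x\rangle=\sqrt{1+x^2}$. **Theorem.** Let $d\ge 0$ and $\kappa>0$. There are constants $C_{LR}(s)=C_{LR}(s,d,\kappa)>0$, $s\in\mathbb N$, such that the following holds for all $L,q$. Let $H=N+\varepsilon P$, where $P$ is a self-adjoint extensive local operator and $N=\sum_{x\in\Lambda}N_x$ is a sum of self-adjoint on-site operators with $\sigma(N)\subset\mathbb Z$ (for instance, $\sigma(N_x)\subset\mathbb Z$ for all $x$). Let $0<\varepsilon<\varepsilon_0$ with $$\varepsilon_0\le\frac{e-1}{64\pi\,(3(e-1)+e^2)\,\|P\|_\kappa}$$ (no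 condition if $P=0$). Then there are self-adjoint extensive local operators $\mathcal N,\mathcal Z\in\mathcal O_{\kappa/2}$ such that: 1. (i) $\sigma(\mathcal N)\subset\mathbb Z$; 2. (ii) $|\Lambda|^{-1}\|\mathcal N-N\|_{\rm op}\le \mathsf C_1\,\varepsilon\,\|N\|_\kappa$; 3. (iii) for all $t\in\mathbb R$, $|\Lambda|^{-1}\|e^{iHt}\mathcal Ne^{-iHt}-\mathcal N\|_{\rm op}\le\mathsf C_2\|N\|_{3\kappa/4}\,|t|\,\varepsilon\, e^{-\varepsilon_0/\varepsilon}$ and $|\Lambda|^{-1}\|e^{iHt}\mathcal Ze^{-iHt}-\mathcal Z\|_{\rm op}\le\mathsf C_3\,|t|\,\varepsilon^2 e^{-\varepsilon_0/\varepsilon}$; 4. (iv) $[\mathcal N,\mathcal Z]=0$; 5. (v) for every operator $O$ acting as the identity outside a connected set $S$, and all $|t|\le e^{\varepsilon_0/((d+1)\varepsilon)}$, $$\|e^{iHt}Oe^{-iHt}-e^{i(\mathcal N+\mathcal Z)t}Oe^{-i(\mathcal N+\mathcal Z)t}\|_{\rm op}\le\mathsf C_4\,\varepsilon\,\|O\|_{\rm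 op};$$ where $$\mathsf C_1=256\pi\frac{e}{e-1}\frac{e^{-\kappa/4}}{\kappa}\|P\|_\kappa,\qquad \mathsf C_2=\frac{16}{3\kappa}\|P\|_\kappa,\qquad \mathsf C_3=\frac{16}{3\kappa}\frac e{e-1}\|P\|_\kappa^2,$$ $$\mathsf C_4=8\pi\frac e{e-1}\|P\|_\kappa|S|+2^{d+1}C_{LR}(|S|)\Big\langle\|N\|_\kappa+\varepsilon\frac e{e-1}\|P\|_\kappa\Big\rangle^d e\,\|P\|_\kappa .$$ None of these constants depends on $|\Lambda|$. If moreover $\varepsilon_0\le\kappa\,\frac{e-1}{64\pi(3(e-1)+e^2)\|P\|_\kappa}$ (automatic for $\kappa\ge1$), then the same $\mathcal N,\mathcal Z$ are local uniformly in $|\Lambda|$ and $\varepsilon$: $$\|\mathcal N\|_{\kappa/2}\le4\|N\|_\kappa,\qquad \|\mathcal Z\|_{\kappa/2}\le\frac{4e}{e-1}\,\varepsilon\,\|P\|_\kappa .$$ -/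

import Mathlib

open scoped Matrix.Norms.L2Operator

noncomputable section

namespace Lattice

/-- The box `ℤ^d ∩ [-L, L]^d`. -/
abbrev Site (d L : ℕ) : Type := Fin d → Set.Icc (-(L : ℤ)) (L : ℤ)

/-- Nearest-neighbour graph of the box: two sites are adjacent when their `ℓ¹` distance is one. -/
def graph (d L : ℕ) : SimpleGraph (Site d L) where
  Adj x y := ∑ i, |(x i : ℤ) - (y i : ℤ)| = 1
  symm := ⟨fun x y h => by simpa only [abs_sub_comm] using h⟩
  loopless := ⟨fun x h => by simp at h⟩

/-- `S` is a (nonempty) connected subset of the box. -/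
def IsConn {d L : ℕ} (S : Finset (Site d L)) : Prop :=
  ((graph d L).induce (S : Set (Site d L))).Connected

/-- Operators on `⨂_{x ∈ Λ} ℂ^q`, as matrices in the product basis, which is indexed by the
configurations `Λ → Fin q`. The norm is the operator norm for the Hilbert space norm, and the star
is the adjoint. -/
abbrev Op (d L q : ℕ) : Type := Matrix (Site d L → Fin q) (Site d L → Fin q) ℂ

/-- `A = a ⊗ 1` with `a` acting on the sites of `S` and the identity acting on the others. -/
def SupportedOn {d L q : ℕ} (S : Finset (Site d L)) (A : Op d L q) : Prop :=
  ∃ a : Matrix (S → Fin q) (S → Fin q) ℂ, ∀ σ τ : Site d L → Fin q,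
    ((∀ x, x ∉ S → σ x = τ x) → A σ τ = a (fun x => σ x) (fun x => τ x)) ∧
    ((∃ x, x ∉ S ∧ σ x ≠ τ x) → A σ τ = 0)

/-- An extensive local operator, given by its local terms `A_S`, `S` connected. (The terms are
indexed by all finite sets, those of sets that are not connected being zero.) -/
structure ExtOp (d L q : ℕ) where
  term : Finset (Site d L) → Op d L q
  supported : ∀ S, SupportedOn S (term S)
  term_eq_zero : ∀ S, ¬ IsConn S → term S = 0

namespace ExtOp

variable {d L q : ℕ}

/-- The operator `∑_S A_S`. -/
def op (A : ExtOp d L q) : Op d L q := ∑ S, A.term S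

/-- Every local term is self-adjoint. -/
def SelfAdj (A : ExtOp d L q) : Prop := ∀ S, IsSelfAdjoint (A.term S)

/-- A sum of on-site terms: only the sets with one element contribute. -/
def OnSite (A : ExtOp d L q) : Prop := ∀ S, S.card ≠ 1 → A.term S = 0

/-- `‖A‖_κ = sup_x ∑_{S ∋ x} ‖A_S‖ e^{κ |S|}` -/
def norm (κ : ℝ) (A : ExtOp d L q) : ℝ :=
  ⨆ x : Site d L, ∑ S : Finset (Site d L) with x ∈ S, ‖A.term S‖ * Real.exp (κ * S.card)

end ExtOp

/-- The spectrum of `A` consists of integers. -/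
def IntSpectrum {d L q : ℕ} (A : Op d L q) : Prop :=
  ∀ z ∈ spectrum ℂ A, ∃ n : ℤ, z = n

/-- Heisenberg evolution `e^{i H t} A e^{-i H t}`. -/
def evol {d L q : ℕ} (H : Op d L q) (t : ℝ) (A : Op d L q) : Op d L q :=
  NormedSpace.exp ((Complex.I * t) • H) * A * NormedSpace.exp (-(Complex.I * t) • H)

/-- `⟨x⟩ = (1 + x²)^{1/2}` -/
def bracket (x : ℝ) : ℝ := Real.sqrt (1 + x ^ 2)

end Lattice

end

/-! Since `N` has integer spectrum, its Heisenberg flow is 2π-periodic. Averaging a local term over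
a period gives an operator commuting with `N`; weighting the average by `s - π` solves `i[N, G] = V
- ⟨V⟩`. Because `N` is on-site, neither operation enlarges supports. Conjugating `N + Z + V` by
`e^{iG}` therefore replaces `V` by `⟨V⟩`, which joins `Z`, up to a remainder of second order
(`adI_genF`, `NormalForm.step`).

Each conjugation costs a loss `δ` in the weight of the local norm. By `nrm_br_le` and `k^k ≤ e^k
k!`, the `k`-th term of the exponential series is at most `(4‖G‖/δ)^k` times the norm. The
first-order term on `N` is `⟨V⟩ - V`, so the remainder estimate never sees `‖N‖`. With `n = ⌊ε₀/ε⌋`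
steps of size `δ = κ/(4n)`, smallness of `ε₀‖P‖` relative to `κ` makes `V` shrink by 8 at every
step, hence below `e^{-ε₀/ε}`. Pulling `N`, `Z`, `V` back to the original frame gives `H = 𝒩 + 𝒵 +
W` exactly, with `W` the image of `V`. The spectrum and the commutation are inherited by unitary
conjugation, and slow drift follows because only `V` contributes to the commutators with `H`
(`exists_local_splitting`).

For local observables, Duhamel compares `H` with `H - W = 𝒩 + 𝒵`. A Lieb–Robinson bound limits the
commutator of `W` with an evolved observable to a light cone, so the error grows like
`|t|(1+|t|)^d`; this is beaten by `e^{-ε₀/ε}` up to the stated time (`exists_norm_heis_sub_heis_le`,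
`time_growth_le`).

When `ε₀‖P‖` is not small relative to `κ`, no locality bound is claimed, and a spectral construction
serves: `𝒩` is the rounding of `H` to integer spectrum and `𝒵 = H - 𝒩`, both as single terms on the
whole box. Everything then commutes with `H`, and only the distance to `N` needs an argument
(`exists_spectral_splitting`). -/

noncomputable section

namespace Lattice

/-! ### Heisenberg evolution in a C⋆-algebra and Duhamel comparison. -/

section Heisenberg

open Complex

variable {𝔸 : Type*} [CStarAlgebra 𝔸]

/-- `e^{iHt} A e^{-iHt}` in a C⋆-algebra. -/
def heis (H : 𝔸) (t : ℝ) (A : 𝔸) : 𝔸 :=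
  NormedSpace.exp ((I * t) • H) * A * NormedSpace.exp (-(I * t) • H)

theorem exp_mem_unitary {H : 𝔸} (hH : IsSelfAdjoint H) (t : ℝ) :
    NormedSpace.exp ((I * t) • H) ∈ unitary 𝔸 := by
  let _ : NormedAlgebra ℚ 𝔸 := NormedAlgebra.restrictScalars ℚ ℂ 𝔸
  apply NormedSpace.exp_mem_unitary_of_mem_skewAdjoint
  rw [skewAdjoint.mem_iff, star_smul, hH.star_eq]
  simp

theorem star_exp_smul {H : 𝔸} (hH : IsSelfAdjoint H) (t : ℝ) :
    star (NormedSpace.exp ((I * t) • H)) = NormedSpace.exp (-(I * t) • H) := by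
  let _ : NormedAlgebra ℚ 𝔸 := NormedAlgebra.restrictScalars ℚ ℂ 𝔸
  rw [NormedSpace.star_exp, star_smul, hH.star_eq]
  simp

theorem exp_neg_mem_unitary {H : 𝔸} (hH : IsSelfAdjoint H) (t : ℝ) :
    NormedSpace.exp (-(I * t) • H) ∈ unitary 𝔸 := by
  have h := exp_mem_unitary hH (-t)
  simpa using h

theorem exp_mul_exp_neg (H : 𝔸) (t : ℝ) :
    NormedSpace.exp ((I * t) • H) * NormedSpace.exp (-(I * t) • H) = 1 := by
  let _ : NormedAlgebra ℚ 𝔸 := NormedAlgebra.restrictScalars ℚ ℂ 𝔸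
  rw [← NormedSpace.exp_add_of_commute, ← add_smul]
  · simp
  · exact ((Commute.refl H).smul_left _).smul_right _

theorem exp_neg_mul_exp (H : 𝔸) (t : ℝ) :
    NormedSpace.exp (-(I * t) • H) * NormedSpace.exp ((I * t) • H) = 1 := by
  have h := exp_mul_exp_neg H (-t)
  simpa using h

theorem norm_heis {H : 𝔸} (hH : IsSelfAdjoint H) (t : ℝ) (A : 𝔸) : ‖heis H t A‖ = ‖A‖ := by
  rw [heis, CStarRing.norm_mul_mem_unitary _ (exp_neg_mem_unitary hH t),
    CStarRing.norm_mem_unitary_mul _ (exp_mem_unitary hH t)]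

@[simp] theorem heis_zero_time (H A : 𝔸) : heis H 0 A = A := by simp [heis]

theorem heis_sub (H : 𝔸) (t : ℝ) (A B : 𝔸) : heis H t (A - B) = heis H t A - heis H t B := by
  simp only [heis, mul_sub, sub_mul]

theorem heis_mul (H : 𝔸) (t : ℝ) (A B : 𝔸) : heis H t (A * B) = heis H t A * heis H t B := by
  simp only [heis]
  calc _ = NormedSpace.exp ((I * t) • H) * A * 1 * B * NormedSpace.exp (-(I * t) • H) := by
        simp only [mul_one, mul_assoc]
    _ = _ := by rw [← exp_neg_mul_exp H t]; simp only [mul_assoc]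

theorem star_heis {H : 𝔸} (hH : IsSelfAdjoint H) (t : ℝ) (A : 𝔸) :
    star (heis H t A) = heis H t (star A) := by
  have h1 := star_exp_smul hH t
  have h2 : star (NormedSpace.exp (-(I * t) • H)) = NormedSpace.exp ((I * t) • H) := by
    rw [← h1, star_star]
  rw [heis, heis, star_mul, star_mul, h1, h2, mul_assoc]

theorem heis_neg (H : 𝔸) (t : ℝ) (A : 𝔸) : heis (-H) t A = heis H (-t) A := by
  simp [heis]

theorem heis_heis_neg (H : 𝔸) (t : ℝ) (A : 𝔸) : heis H t (heis H (-t) A) = A := by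
  have h1 := exp_mul_exp_neg H t
  simp only [heis, ofReal_neg, mul_neg, neg_neg]
  calc _ = (NormedSpace.exp ((I * t) • H) * NormedSpace.exp (-(I * t) • H)) * A *
        (NormedSpace.exp ((I * t) • H) * NormedSpace.exp (-(I * t) • H)) := by
        simp only [mul_assoc]
    _ = A := by rw [h1]; simp

theorem heis_neg_heis (H : 𝔸) (t : ℝ) (A : 𝔸) : heis H (-t) (heis H t A) = A := by
  have := heis_heis_neg H (-t) A
  simpa using this

theorem commute_exp_smul {H A : 𝔸} (h : Commute H A) (c : ℂ) :
    Commute (NormedSpace.exp (c • H)) A := by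
  let _ : NormedAlgebra ℚ 𝔸 := NormedAlgebra.restrictScalars ℚ ℂ 𝔸
  exact (h.smul_left c).exp_left

theorem heis_of_commute {H A : 𝔸} (h : Commute H A) (t : ℝ) : heis H t A = A := by
  rw [heis, (commute_exp_smul h _).eq, mul_assoc, exp_mul_exp_neg, mul_one]

theorem I_mul_ofReal_smul (s : ℝ) (H : 𝔸) : (I * s) • H = s • (I • H) := by
  rw [← Complex.coe_smul, smul_smul, mul_comm]

theorem hasDerivAt_exp_I_smul (H : 𝔸) (s : ℝ) :
    HasDerivAt (fun s : ℝ => NormedSpace.exp ((I * s) • H))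
      (NormedSpace.exp ((I * s) • H) * (I • H)) s := by
  simpa only [I_mul_ofReal_smul] using hasDerivAt_exp_smul_const (𝕂 := ℝ) (I • H) s

theorem hasDerivAt_exp_neg_I_smul (H : 𝔸) (s : ℝ) :
    HasDerivAt (fun s : ℝ => NormedSpace.exp (-(I * s) • H))
      (-((I • H) * NormedSpace.exp (-(I * s) • H))) s := by
  simpa only [neg_smul, I_mul_ofReal_smul, smul_neg, neg_mul] using
    hasDerivAt_exp_smul_const' (𝕂 := ℝ) (-(I • H)) s

/-- Product rule in a rotating frame. Used with generator `-K`, where the commutator cancels the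
part of `g'` generated by `K`; all interaction-picture arguments below rest on it. -/
theorem hasDerivAt_heis (H : 𝔸) {g : ℝ → 𝔸} {g' : 𝔸} {s : ℝ} (hg : HasDerivAt g g' s) :
    HasDerivAt (fun s => heis H s (g s)) (heis H s (I • (H * g s - g s * H) + g')) s := by
  have h := ((hasDerivAt_exp_I_smul H s).mul hg).mul (hasDerivAt_exp_neg_I_smul H s)
  refine h.congr_deriv ?_
  simp only [heis, Pi.mul_apply, smul_sub, mul_add, add_mul, mul_sub, sub_mul, mul_assoc, smul_mul_assoc,
    mul_smul_comm, mul_neg]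
  abel

theorem hasDerivAt_heis_const (H A : 𝔸) (s : ℝ) :
    HasDerivAt (fun s => heis H s A) (heis H s (I • (H * A - A * H))) s := by
  simpa using hasDerivAt_heis H (hasDerivAt_const s A)

theorem heis_self_commutator (H A : 𝔸) (s : ℝ) :
    heis H s (H * A - A * H) = H * heis H s A - heis H s A * H := by
  rw [heis_sub, heis_mul, heis_mul, heis_of_commute (Commute.refl H)]

theorem heis_smul (H : 𝔸) (t : ℝ) (c : ℂ) (A : 𝔸) : heis H t (c • A) = c • heis H t A := by
  simp [heis]

theorem hasDerivAt_heis_const' (H A : 𝔸) (s : ℝ) :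
    HasDerivAt (fun s => heis H s A) (I • (H * heis H s A - heis H s A * H)) s := by
  rw [← heis_self_commutator, ← heis_smul]
  exact hasDerivAt_heis_const H A s

theorem continuous_heis (H A : 𝔸) : Continuous fun s => heis H s A :=
  continuous_iff_continuousAt.2 fun s => (hasDerivAt_heis_const H A s).continuousAt

theorem norm_heis_sub_le {H : 𝔸} (hH : IsSelfAdjoint H) (t : ℝ) (A : 𝔸) :
    ‖heis H t A - A‖ ≤ |t| * ‖H * A - A * H‖ := by
  have h := Convex.norm_image_sub_le_of_norm_hasDerivWithin_le (𝕜 := ℝ) (s := Set.univ)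
    (f := fun s => heis H s A) (x := 0) (y := t) (C := ‖H * A - A * H‖)
    (fun s _ => (hasDerivAt_heis_const H A s).hasDerivWithinAt)
    (fun s _ => by rw [norm_heis hH, norm_smul]; simp) convex_univ trivial trivial
  simpa [mul_comm] using h

/-- Comparison of two evolutions (Duhamel). -/
theorem norm_heis_sub_heis_le {H W : 𝔸} (hH : IsSelfAdjoint H) (hW : IsSelfAdjoint W) {t c : ℝ}
    (ht : 0 ≤ t) (O : 𝔸)
    (hc : ∀ s, 0 ≤ s → s ≤ t → ‖W * heis H s O - heis H s O * W‖ ≤ c) :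
    ‖heis H t O - heis (H - W) t O‖ ≤ c * t := by
  set K := H - W with hK
  have hKs : IsSelfAdjoint K := hH.sub hW
  -- Forward with `H`, backward with `K = H - W`: the `K` parts cancel and only the commutator with
  -- `W` drives the interpolation.
  have hd : ∀ s, HasDerivAt (fun s => heis (-K) s (heis H s O))
      (heis (-K) s (I • (W * heis H s O - heis H s O * W))) s := by
    intro s
    refine (hasDerivAt_heis (-K) (hasDerivAt_heis_const' H O s)).congr_deriv ?_
    congr 1
    rw [← smul_add, hK]
    congr 1
    noncomm_ring
  have h := Convex.norm_image_sub_le_of_norm_hasDerivWithin_le (𝕜 := ℝ) (s := Set.Icc 0 t)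
    (x := 0) (y := t) (C := c)
    (fun s _ => (hd s).hasDerivWithinAt)
    (fun s hs => by rw [norm_heis hKs.neg, norm_smul]; simpa using hc s hs.1 hs.2)
    (convex_Icc 0 t) ⟨le_rfl, ht⟩ ⟨ht, le_rfl⟩
  have e : heis H t O - heis K t O = heis K t (heis (-K) t (heis H t O) - O) := by
    rw [heis_sub, heis_neg, heis_heis_neg]
  rw [e, norm_heis hKs]
  simpa [abs_of_nonneg ht] using h

end Heisenberg

/-! ### Supports of operators as commutation with matrix units. -/

section Support

variable {d L q : ℕ}

/-- The matrix unit `|i⟩⟨j|` acting at the site `x`. -/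
def siteUnit (x : Site d L) (i j : Fin q) : Op d L q :=
  Matrix.of fun σ τ => if σ x = i ∧ τ = Function.update σ x j then 1 else 0

theorem siteUnit_mul_apply (x : Site d L) (i j : Fin q) (A : Op d L q) (σ τ) :
    (siteUnit x i j * A) σ τ = if σ x = i then A (Function.update σ x j) τ else 0 := by
  rw [Matrix.mul_apply, Finset.sum_eq_single (Function.update σ x j)]
  · simp [siteUnit]
  · intro ρ _ h
    simp [siteUnit, h]
  · simp

theorem mul_siteUnit_apply (x : Site d L) (i j : Fin q) (A : Op d L q) (σ τ) :
    (A * siteUnit x i j) σ τ = if τ x = j then A σ (Function.update τ x i) else 0 := by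
  rw [Matrix.mul_apply, Finset.sum_eq_single (Function.update τ x i)]
  · simp only [siteUnit, Matrix.of_apply, Function.update_self, Function.update_idem, true_and]
    by_cases h : τ x = j
    · subst h; simp
    · have : τ ≠ Function.update τ x j := fun h' => h (by rw [h']; simp)
      simp [h, this]
  · intro ρ _ h
    simp only [siteUnit, Matrix.of_apply]
    rw [if_neg, mul_zero]
    rintro ⟨h1, rfl⟩
    apply h
    subst h1
    simp
  · simp

theorem SupportedOn.commute_siteUnit {S : Finset (Site d L)} {A : Op d L q}
    (hA : SupportedOn S A) {x : Site d L} (hx : x ∉ S) (i j : Fin q) :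
    Commute A (siteUnit x i j) := by
  obtain ⟨a, ha⟩ := hA
  ext σ τ
  rw [mul_siteUnit_apply, siteUnit_mul_apply]
  have hne : ∀ y : S, (y : Site d L) ≠ x := fun y h => hx (h ▸ y.2)
  by_cases hτ : τ x = j <;> by_cases hσ : σ x = i
  · rw [if_pos hτ, if_pos hσ]
    by_cases hag : ∀ y, y ∉ S → y ≠ x → σ y = τ y
    · rw [(ha _ _).1, (ha _ _).1]
      · simp [hne]
      · intro y hy
        by_cases hyx : y = x
        · subst hyx; simp [hτ]
        · simp [hyx, hag y hy hyx]
      · intro y hy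
        by_cases hyx : y = x
        · subst hyx; simp [hσ]
        · simp [hyx, hag y hy hyx]
    · push Not at hag
      obtain ⟨y, hy, hyx, hst⟩ := hag
      rw [(ha _ _).2 ⟨y, hy, by simpa [hyx] using hst⟩, (ha _ _).2 ⟨y, hy, by simpa [hyx] using hst⟩]
  · rw [if_pos hτ, if_neg hσ]
    exact (ha _ _).2 ⟨x, hx, by simpa using hσ⟩
  · rw [if_neg hτ, if_pos hσ]
    exact ((ha _ _).2 ⟨x, hx, by simpa using fun h => hτ h.symm⟩).symm
  · rw [if_neg hτ, if_neg hσ]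

/-- Commuting with the diagonal units at `x` kills entries between configurations that differ at
`x`; commuting with the others makes entries independent of the common value at `x`. Resetting all
sites outside `S` to a reference configuration `b` then defines the reduced matrix. -/
theorem supportedOn_of_commute_siteUnit {S : Finset (Site d L)} {A : Op d L q}
    (h : ∀ x ∉ S, ∀ i j, Commute A (siteUnit x i j)) : SupportedOn S A := by
  have f1 : ∀ x ∉ S, ∀ σ ρ, σ x ≠ ρ x → A σ ρ = 0 := by
    intro x hx σ ρ hne
    have e := congrFun (congrFun (h x hx (ρ x) (ρ x)).eq σ) ρ
    rw [mul_siteUnit_apply, siteUnit_mul_apply, if_pos rfl, if_neg hne] at e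
    simpa using e
  have f2 : ∀ x ∉ S, ∀ σ ρ, σ x = ρ x → ∀ j,
      A σ ρ = A (Function.update σ x j) (Function.update ρ x j) := by
    intro x hx σ ρ he j
    have e := congrFun (congrFun (h x hx (ρ x) j).eq σ) (Function.update ρ x j)
    rw [mul_siteUnit_apply, siteUnit_mul_apply, if_pos (by simp), if_pos he] at e
    simpa using e
  rcases isEmpty_or_nonempty (Site d L → Fin q) with he | ⟨⟨b⟩⟩
  · exact ⟨0, fun σ => he.elim σ⟩
  have f3 : ∀ R : Finset (Site d L), (∀ x ∈ R, x ∉ S) → ∀ σ τ, (∀ x, x ∉ S → σ x = τ x) →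
      A σ τ = A (R.piecewise b σ) (R.piecewise b τ) := by
    intro R
    induction R using Finset.induction_on with
    | empty => intro _ σ τ _; simp
    | insert x R hxR ih =>
      intro hR σ τ hst
      rw [ih (fun y hy => hR y (Finset.mem_insert_of_mem hy)) σ τ hst,
        Finset.piecewise_insert, Finset.piecewise_insert]
      apply f2 x (hR x (Finset.mem_insert_self _ _))
      simp [hxR, hst x (hR x (Finset.mem_insert_self _ _))]
  refine ⟨fun s t => A (fun x => if hx : x ∈ S then s ⟨x, hx⟩ else b x)
    (fun x => if hx : x ∈ S then t ⟨x, hx⟩ else b x), fun σ τ => ⟨fun hst => ?_, ?_⟩⟩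
  · rw [f3 Sᶜ (by simp) σ τ hst]
    congr 1 <;> ext x <;> by_cases hx : x ∈ S <;> simp [Finset.piecewise, hx]
  · rintro ⟨x, hx, hne⟩
    exact f1 x hx σ τ hne

/-- Being supported on `S` is membership in a commutant, hence stable under sums, products,
exponentials and integrals. -/
theorem supportedOn_iff {S : Finset (Site d L)} {A : Op d L q} :
    SupportedOn S A ↔ ∀ x ∉ S, ∀ i j, Commute A (siteUnit x i j) :=
  ⟨fun h _ hx i j => h.commute_siteUnit hx i j, supportedOn_of_commute_siteUnit⟩

theorem supportedOn_siteUnit (x : Site d L) (i j : Fin q) :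
    SupportedOn {x} (siteUnit x i j) := by
  refine ⟨fun s t => if s ⟨x, by simp⟩ = i ∧ t ⟨x, by simp⟩ = j then 1 else 0,
    fun σ τ => ⟨fun h => ?_, ?_⟩⟩
  · have : τ = Function.update σ x j ↔ τ x = j := by
      constructor
      · intro h'; rw [h']; simp
      · intro h'
        ext1 y
        by_cases hy : y = x
        · subst hy; simpa using h'
        · simp [hy, h y (by simpa using hy)]
    simp [siteUnit, this]
  · rintro ⟨y, hy, hne⟩
    have : τ ≠ Function.update σ x j := fun h' => hne (by
      rw [h', Function.update_of_ne (by simpa using hy)])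
    simp [siteUnit, this]

theorem supportedOn_zero (S : Finset (Site d L)) : SupportedOn S (0 : Op d L q) :=
  supportedOn_iff.2 fun _ _ _ _ => Commute.zero_left _

theorem SupportedOn.add {S : Finset (Site d L)} {A B : Op d L q} (hA : SupportedOn S A)
    (hB : SupportedOn S B) : SupportedOn S (A + B) :=
  supportedOn_iff.2 fun _ hx i j => (hA.commute_siteUnit hx i j).add_left (hB.commute_siteUnit hx i j)

theorem SupportedOn.sub {S : Finset (Site d L)} {A B : Op d L q} (hA : SupportedOn S A)
    (hB : SupportedOn S B) : SupportedOn S (A - B) :=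
  supportedOn_iff.2 fun _ hx i j => (hA.commute_siteUnit hx i j).sub_left (hB.commute_siteUnit hx i j)

theorem SupportedOn.mul {S : Finset (Site d L)} {A B : Op d L q} (hA : SupportedOn S A)
    (hB : SupportedOn S B) : SupportedOn S (A * B) :=
  supportedOn_iff.2 fun _ hx i j => (hA.commute_siteUnit hx i j).mul_left (hB.commute_siteUnit hx i j)

theorem SupportedOn.smul {S : Finset (Site d L)} {A : Op d L q} (hA : SupportedOn S A) (c : ℂ) :
    SupportedOn S (c • A) :=
  supportedOn_iff.2 fun _ hx i j => (hA.commute_siteUnit hx i j).smul_left c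

theorem SupportedOn.mono {S T : Finset (Site d L)} {A : Op d L q} (hA : SupportedOn S A)
    (h : S ⊆ T) : SupportedOn T A :=
  supportedOn_iff.2 fun _ hx i j => hA.commute_siteUnit (fun h' => hx (h h')) i j

theorem SupportedOn.sum {ι : Type*} {S : Finset (Site d L)} {s : Finset ι} {A : ι → Op d L q}
    (hA : ∀ i ∈ s, SupportedOn S (A i)) : SupportedOn S (∑ i ∈ s, A i) :=
  supportedOn_iff.2 fun _ hx i j =>
    Commute.sum_left _ _ _ fun k hk => (hA k hk).commute_siteUnit hx i j

theorem supportedOn_univ (A : Op d L q) : SupportedOn Finset.univ A :=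
  supportedOn_iff.2 fun x hx => absurd (Finset.mem_univ x) hx

/-- Operators with disjoint supports commute. -/
theorem SupportedOn.commute {S T : Finset (Site d L)} {A B : Op d L q} (hA : SupportedOn S A)
    (hB : SupportedOn T B) (h : Disjoint S T) : Commute A B := by
  obtain ⟨a, ha⟩ := hA
  obtain ⟨b, hb⟩ := hB
  have hST : ∀ x, x ∈ S → x ∉ T := fun x hx hx' => Finset.disjoint_left.1 h hx hx'
  ext σ τ
  -- A single intermediate configuration contributes to each product: for `A * B` it must equal `σ`
  -- off `S` and `τ` off `T`, hence on `S`; for `B * A` the roles are exchanged.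
  rw [Matrix.mul_apply, Matrix.mul_apply, Finset.sum_eq_single (S.piecewise τ σ),
    Finset.sum_eq_single (S.piecewise σ τ)]
  · by_cases hst : ∀ x, x ∉ S → x ∉ T → σ x = τ x
    · rw [(ha σ _).1 fun x hx => by simp [hx], (hb _ τ).1, (hb σ _).1,
        (ha _ τ).1 fun x hx => by simp [hx], mul_comm]
      · have hTS : ∀ x : T, (x : Site d L) ∉ S := fun x hx => hST x hx x.2
        congr 2 <;> ext x <;> simp [Finset.piecewise, hTS]
      · intro x hx
        by_cases hxS : x ∈ S
        · simp [hxS]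
        · simp [hxS, hst x hxS hx]
      · intro x hx
        by_cases hxS : x ∈ S
        · simp [hxS]
        · simp [hxS, hst x hxS hx]
    · push Not at hst
      obtain ⟨x, hxS, hxT, hne⟩ := hst
      rw [(hb _ τ).2 ⟨x, hxT, by simpa [hxS] using hne⟩,
        (hb σ _).2 ⟨x, hxT, by simpa [hxS] using hne⟩]
      simp
  · intro ρ _ hρ
    by_contra hne
    obtain ⟨hB0, hA0⟩ := mul_ne_zero_iff.1 hne
    apply hρ
    ext1 x
    by_cases hx : x ∈ S
    · have : σ x = ρ x := by
        by_contra h'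
        exact hB0 ((hb _ _).2 ⟨x, hST x hx, h'⟩)
      simp [hx, this]
    · have : ρ x = τ x := by
        by_contra h'
        exact hA0 ((ha _ _).2 ⟨x, hx, h'⟩)
      simp [hx, this]
  · simp
  · intro ρ _ hρ
    by_contra hne
    obtain ⟨hA0, hB0⟩ := mul_ne_zero_iff.1 hne
    apply hρ
    ext1 x
    by_cases hx : x ∈ S
    · have : ρ x = τ x := by
        by_contra h'
        exact hB0 ((hb _ _).2 ⟨x, hST x hx, h'⟩)
      simp [hx, this]
    · have : σ x = ρ x := by
        by_contra h'
        exact hA0 ((ha _ _).2 ⟨x, hx, h'⟩)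
      simp [hx, this]
  · simp

theorem SupportedOn.exp_smul {S : Finset (Site d L)} {A : Op d L q} (hA : SupportedOn S A) (c : ℂ) :
    SupportedOn S (NormedSpace.exp (c • A)) :=
  supportedOn_iff.2 fun _ hx i j => commute_exp_smul (hA.commute_siteUnit hx i j) c

theorem SupportedOn.heis {S : Finset (Site d L)} {H A : Op d L q} (hH : SupportedOn S H)
    (hA : SupportedOn S A) (t : ℝ) : SupportedOn S (heis H t A) :=
  ((hH.exp_smul _).mul hA).mul (hH.exp_smul _)

end Support

/-! ### Connected sets of sites and the sup distance. -/

section Connected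

variable {d L : ℕ}

theorem IsConn.nonempty {S : Finset (Site d L)} (h : IsConn S) : S.Nonempty := by
  obtain ⟨x⟩ := SimpleGraph.Connected.nonempty h
  exact ⟨x, x.2⟩

theorem IsConn.union {S T : Finset (Site d L)} (hS : IsConn S) (hT : IsConn T)
    (h : ¬ Disjoint S T) : IsConn (S ∪ T) := by
  obtain ⟨x, hx, hx'⟩ := Finset.not_disjoint_iff.1 h
  have := SimpleGraph.induce_union_connected hS.preconnected hT.preconnected
    ⟨x, by exact_mod_cast hx, by exact_mod_cast hx'⟩
  rw [IsConn, Finset.coe_union]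
  exact this

theorem dist_le_one_of_adj {x y : Site d L} (h : (graph d L).Adj x y) : dist x y ≤ 1 := by
  refine (dist_pi_le_iff zero_le_one).2 fun i => ?_
  have h' : ∑ i, |(x i : ℤ) - (y i : ℤ)| = 1 := h
  have h1 : |(x i : ℤ) - (y i : ℤ)| ≤ 1 := by
    rw [← h']
    exact Finset.single_le_sum (f := fun i => |(x i : ℤ) - (y i : ℤ)|)
      (fun i _ => abs_nonneg _) (Finset.mem_univ i)
  rw [Subtype.dist_eq, Int.dist_eq]
  exact_mod_cast h1

/-- A path inside `S` has fewer than `|S|` edges, and each moves by at most 1 in the sup metric.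
This turns weights `e^{κ|S|}` into spatial decay. -/
theorem IsConn.dist_le {S : Finset (Site d L)} (hS : IsConn S) {x y : Site d L} (hx : x ∈ S)
    (hy : y ∈ S) : dist x y ≤ S.card := by
  classical
  obtain ⟨p, hp⟩ := hS.exists_isPath ⟨x, hx⟩ ⟨y, hy⟩
  have key : ∀ (u v : (S : Set (Site d L)))
      (p : ((graph d L).induce (S : Set (Site d L))).Walk u v),
      dist (u : Site d L) v ≤ p.length := by
    intro u v p
    induction p with
    | nil => simp
    | cons h p ih =>
      rename_i u v w
      have h1 : dist (u : Site d L) v ≤ 1 := dist_le_one_of_adj h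
      have := dist_triangle (u : Site d L) v w
      rw [SimpleGraph.Walk.length_cons]
      push_cast
      linarith
  have h1 := key _ _ p
  have h2 := hp.length_lt
  have h3 : (p.length : ℝ) ≤ S.card := by
    have : Fintype.card (S : Set (Site d L)) = S.card := by simp
    rw [this] at h2
    exact_mod_cast h2.le
  exact h1.trans h3

/-- Induction on the `ℓ¹` distance: moving a differing coordinate one unit towards its target stays
in the box. -/
theorem graph_reachable (n : ℕ) : ∀ x y : Site d L, ∑ i, |(x i : ℤ) - (y i : ℤ)| = n →
    (graph d L).Reachable x y := by
  induction n with
  | zero =>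
    intro x y h
    have h0 := (Finset.sum_eq_zero_iff_of_nonneg fun i _ => abs_nonneg ((x i : ℤ) - y i)).1 h
    have : x = y := by
      ext i
      have := h0 i (Finset.mem_univ i)
      rw [abs_eq_zero] at this
      omega
    rw [this]
  | succ n ih =>
    intro x y h
    have hex : ∃ i, (x i : ℤ) ≠ y i := by
      by_contra! h'
      have h0 : ∑ i, |(x i : ℤ) - (y i : ℤ)| = 0 := Finset.sum_eq_zero fun i _ => by simp [h' i]
      rw [h0] at h
      push_cast at h
      omega
    obtain ⟨i, hi⟩ := hex
    have hxi := (x i).2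
    have hyi := (y i).2
    rw [Set.mem_Icc] at hxi hyi
    obtain ⟨m, hm, hm1, hm2⟩ : ∃ m : ℤ, m ∈ Set.Icc (-(L : ℤ)) L ∧ |(x i : ℤ) - m| = 1 ∧
        |m - y i| + 1 = |(x i : ℤ) - y i| := by
      rcases lt_or_gt_of_ne hi with h1 | h1
      · refine ⟨x i + 1, ⟨by omega, by omega⟩, by simp, ?_⟩
        rw [abs_of_nonpos (by omega), abs_of_nonpos (by omega)]
        omega
      · refine ⟨x i - 1, ⟨by omega, by omega⟩, by simp, ?_⟩
        rw [abs_of_nonneg (by omega), abs_of_nonneg (by omega)]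
        omega
    have hadj : (graph d L).Adj x (Function.update x i ⟨m, hm⟩) := by
      change ∑ j, |(x j : ℤ) - (Function.update x i ⟨m, hm⟩ j : Set.Icc (-(L : ℤ)) (L : ℤ))| = 1
      rw [Finset.sum_eq_single i]
      · simpa using hm1
      · intro j _ hj
        simp [hj]
      · simp
    refine hadj.reachable.trans (ih _ y ?_)
    rw [← Finset.add_sum_erase _ _ (Finset.mem_univ i)] at h ⊢
    have e : ∑ j ∈ Finset.univ.erase i,
        |((Function.update x i ⟨m, hm⟩ j : Set.Icc (-(L : ℤ)) (L : ℤ)) : ℤ) - y j| =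
        ∑ j ∈ Finset.univ.erase i, |(x j : ℤ) - y j| :=
      Finset.sum_congr rfl fun j hj => by simp [Finset.ne_of_mem_erase hj]
    rw [e]
    simp only [Function.update_self]
    push_cast at h
    linarith

/-- The whole box is connected. -/
theorem isConn_univ : IsConn (Finset.univ : Finset (Site d L)) := by
  rw [IsConn, Finset.coe_univ]
  refine (SimpleGraph.induceUnivIso (graph d L)).connected_iff.2 ?_
  have : Nonempty (Site d L) := ⟨fun _ => ⟨0, by simp⟩⟩
  refine ⟨fun x y => graph_reachable (∑ i, |(x i : ℤ) - (y i : ℤ)|).toNat x y ?_⟩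
  rw [Int.toNat_of_nonneg (Finset.sum_nonneg fun i _ => abs_nonneg _)]

end Connected

/-! ### Families of local terms: weighted norms and commutators. -/

section Family

variable {d L q : ℕ}

instance : Nonempty (Site d L) := ⟨fun _ => ⟨0, by simp⟩⟩

/-- The families of local terms of extensive local operators, as a subspace. -/
def locFamSubmodule (d L q : ℕ) : Submodule ℂ (Finset (Site d L) → Op d L q) where
  carrier := {A | ∀ S, SupportedOn S (A S) ∧ (¬ IsConn S → A S = 0)}
  add_mem' {A B} hA hB S :=
    ⟨(hA S).1.add (hB S).1, fun h => by simp [(hA S).2 h, (hB S).2 h]⟩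
  zero_mem' S := ⟨supportedOn_zero S, fun _ => rfl⟩
  smul_mem' c A hA S := ⟨(hA S).1.smul c, fun h => by simp [(hA S).2 h]⟩

/-- The families of local terms of extensive local operators. -/
def LocFam (d L q : ℕ) : Type := locFamSubmodule d L q

namespace LocFam

/-- The inherited sup norm only supplies a finite-dimensional topology in which exponential series
converge; all quantitative estimates use `nrm`. -/
instance : NormedAddCommGroup (LocFam d L q) :=
  inferInstanceAs (NormedAddCommGroup (locFamSubmodule d L q))

instance : NormedSpace ℂ (LocFam d L q) :=
  inferInstanceAs (NormedSpace ℂ (locFamSubmodule d L q))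

instance : FiniteDimensional ℂ (LocFam d L q) :=
  inferInstanceAs (FiniteDimensional ℂ (locFamSubmodule d L q))

instance : CompleteSpace (LocFam d L q) := FiniteDimensional.complete ℂ _

/-- The family with given local terms. -/
def mk (A : Finset (Site d L) → Op d L q)
    (hA : ∀ S, SupportedOn S (A S) ∧ (¬ IsConn S → A S = 0)) : LocFam d L q :=
  (⟨A, hA⟩ : locFamSubmodule d L q)

/-- The local term on `S`. -/
def term (A : LocFam d L q) (S : Finset (Site d L)) : Op d L q :=
  (Subtype.val (p := (· ∈ locFamSubmodule d L q)) A) S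

theorem term_mem (A : LocFam d L q) (S : Finset (Site d L)) :
    SupportedOn S (A.term S) ∧ (¬ IsConn S → A.term S = 0) :=
  (Subtype.property (p := (· ∈ locFamSubmodule d L q)) A) S

theorem supported (A : LocFam d L q) (S : Finset (Site d L)) : SupportedOn S (A.term S) :=
  (A.term_mem S).1

theorem term_eq_zero (A : LocFam d L q) {S : Finset (Site d L)} (h : ¬ IsConn S) : A.term S = 0 :=
  (A.term_mem S).2 h

@[ext] theorem ext {A B : LocFam d L q} (h : ∀ S, A.term S = B.term S) : A = B :=
  Subtype.ext (funext h)

@[simp] theorem term_add (A B : LocFam d L q) (S) : (A + B).term S = A.term S + B.term S := rfl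
@[simp] theorem term_sub (A B : LocFam d L q) (S) : (A - B).term S = A.term S - B.term S := rfl
@[simp] theorem term_neg (A : LocFam d L q) (S) : (-A).term S = -A.term S := rfl
@[simp] theorem term_smul (c : ℂ) (A : LocFam d L q) (S) : (c • A).term S = c • A.term S := rfl
@[simp] theorem term_zero (S) : (0 : LocFam d L q).term S = 0 := rfl

theorem continuous_term (S : Finset (Site d L)) : Continuous fun A : LocFam d L q => A.term S :=
  (continuous_apply S).comp continuous_subtype_val

/-- The operator `∑_S A_S`. -/
def op : LocFam d L q →ₗ[ℂ] Op d L q where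
  toFun A := ∑ S, A.term S
  map_add' A B := by simp [Finset.sum_add_distrib]
  map_smul' c A := by simp [Finset.smul_sum]

theorem op_apply (A : LocFam d L q) : op A = ∑ S, A.term S := rfl

/-- All the local terms are self-adjoint. -/
def SelfAdj (A : LocFam d L q) : Prop := ∀ S, IsSelfAdjoint (A.term S)

theorem SelfAdj.op {A : LocFam d L q} (h : A.SelfAdj) : IsSelfAdjoint (op A) := by
  rw [op_apply, isSelfAdjoint_iff, star_sum]
  exact Finset.sum_congr rfl fun S _ => (h S).star_eq

theorem SelfAdj.add {A B : LocFam d L q} (hA : A.SelfAdj) (hB : B.SelfAdj) : (A + B).SelfAdj :=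
  fun S => (hA S).add (hB S)

theorem SelfAdj.sub {A B : LocFam d L q} (hA : A.SelfAdj) (hB : B.SelfAdj) : (A - B).SelfAdj :=
  fun S => (hA S).sub (hB S)

theorem SelfAdj.neg {A : LocFam d L q} (hA : A.SelfAdj) : (-A).SelfAdj :=
  fun S => (hA S).neg

theorem SelfAdj.ofReal_smul {A : LocFam d L q} (hA : A.SelfAdj) (r : ℝ) :
    ((r : ℂ) • A).SelfAdj := fun S => by
  rw [isSelfAdjoint_iff, term_smul, star_smul, (hA S).star_eq]
  simp

/-- `∑_{S ∋ x} ‖A_S‖ e^{μ |S|}` -/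
def siteNorm (μ : ℝ) (A : LocFam d L q) (x : Site d L) : ℝ :=
  ∑ S : Finset (Site d L) with x ∈ S, ‖A.term S‖ * Real.exp (μ * S.card)

/-- `‖A‖_μ = sup_x ∑_{S ∋ x} ‖A_S‖ e^{μ |S|}` -/
def nrm (μ : ℝ) (A : LocFam d L q) : ℝ := ⨆ x : Site d L, siteNorm μ A x

theorem siteNorm_le_nrm (μ : ℝ) (A : LocFam d L q) (x : Site d L) : siteNorm μ A x ≤ nrm μ A :=
  le_ciSup (f := fun x => siteNorm μ A x) (Set.finite_range _).bddAbove x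

theorem nrm_le {μ : ℝ} {A : LocFam d L q} {C : ℝ} (h : ∀ x, siteNorm μ A x ≤ C) : nrm μ A ≤ C :=
  ciSup_le h

theorem siteNorm_nonneg (μ : ℝ) (A : LocFam d L q) (x : Site d L) : 0 ≤ siteNorm μ A x :=
  Finset.sum_nonneg fun _ _ => by positivity

theorem nrm_nonneg (μ : ℝ) (A : LocFam d L q) : 0 ≤ nrm μ A :=
  (siteNorm_nonneg μ A (Classical.arbitrary _)).trans (siteNorm_le_nrm μ A _)

theorem nrm_le_of_norm_le {μ ν : ℝ} {A B : LocFam d L q} {c : ℝ} (hc : 0 ≤ c)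
    (h : ∀ S, ‖A.term S‖ * Real.exp (μ * S.card) ≤ c * (‖B.term S‖ * Real.exp (ν * S.card))) :
    nrm μ A ≤ c * nrm ν B :=
  nrm_le fun x => calc
    siteNorm μ A x ≤ c * siteNorm ν B x := by
      rw [siteNorm, siteNorm, Finset.mul_sum]
      exact Finset.sum_le_sum fun S _ => h S
    _ ≤ c * nrm ν B := by gcongr; exact siteNorm_le_nrm ν B x

theorem nrm_mono {μ ν : ℝ} (h : μ ≤ ν) (A : LocFam d L q) : nrm μ A ≤ nrm ν A := by
  have := nrm_le_of_norm_le (μ := μ) (ν := ν) (A := A) (B := A) zero_le_one fun S => by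
    rw [one_mul]; gcongr
  simpa using this

theorem nrm_add_le (μ : ℝ) (A B : LocFam d L q) : nrm μ (A + B) ≤ nrm μ A + nrm μ B :=
  nrm_le fun x => calc
    siteNorm μ (A + B) x ≤ siteNorm μ A x + siteNorm μ B x := by
      rw [siteNorm, siteNorm, siteNorm, ← Finset.sum_add_distrib]
      refine Finset.sum_le_sum fun S _ => ?_
      rw [← add_mul, term_add]
      gcongr
      exact norm_add_le _ _
    _ ≤ _ := add_le_add (siteNorm_le_nrm _ _ _) (siteNorm_le_nrm _ _ _)

theorem nrm_smul_le (μ : ℝ) (c : ℂ) (A : LocFam d L q) : nrm μ (c • A) ≤ ‖c‖ * nrm μ A :=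
  nrm_le_of_norm_le (norm_nonneg c) fun S => by
    rw [term_smul, norm_smul, mul_assoc]

theorem nrm_neg (μ : ℝ) (A : LocFam d L q) : nrm μ (-A) = nrm μ A := by
  simp [nrm, siteNorm]

theorem nrm_sub_le (μ : ℝ) (A B : LocFam d L q) : nrm μ (A - B) ≤ nrm μ A + nrm μ B := by
  rw [sub_eq_add_neg, ← nrm_neg μ B]
  exact nrm_add_le _ _ _

@[simp] theorem nrm_zero (μ : ℝ) : nrm μ (0 : LocFam d L q) = 0 := by
  simp [nrm, siteNorm]

theorem isClosed_nrm_le (μ C : ℝ) : IsClosed {A : LocFam d L q | nrm μ A ≤ C} := by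
  have : {A : LocFam d L q | nrm μ A ≤ C} = ⋂ x, {A | siteNorm μ A x ≤ C} := by
    ext A
    simp only [Set.mem_iInter, Set.mem_ofPred_eq]
    exact ⟨fun h x => (siteNorm_le_nrm μ A x).trans h, nrm_le⟩
  rw [this]
  refine isClosed_iInter fun x => isClosed_le ?_ continuous_const
  exact continuous_finsetSum _ fun S _ => (continuous_term S).norm.mul continuous_const

theorem isClosed_selfAdj : IsClosed {A : LocFam d L q | A.SelfAdj} := by
  simp only [SelfAdj, Set.ofPred_forall]
  exact isClosed_iInter fun S => isClosed_eq (continuous_star.comp (continuous_term S))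
    (continuous_term S)

/-- Balls of `nrm μ` are closed in the finite-dimensional topology, so bounds on partial sums pass
to the limit. -/
theorem nrm_hasSum_le {μ C : ℝ} {f : ℕ → LocFam d L q} {A : LocFam d L q} (hf : HasSum f A)
    {c : ℕ → ℝ} (hc : HasSum c C) (h : ∀ k, nrm μ (f k) ≤ c k) : nrm μ A ≤ C := by
  have h0 : ∀ k, 0 ≤ c k := fun k => (nrm_nonneg _ _).trans (h k)
  refine (isClosed_nrm_le μ C).mem_of_tendsto hf (Filter.Eventually.of_forall fun s => ?_)
  have h1 : nrm μ (∑ k ∈ s, f k) ≤ ∑ k ∈ s, c k := by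
    induction s using Finset.induction_on with
    | empty => simp
    | insert a s ha ih =>
      rw [Finset.sum_insert ha, Finset.sum_insert ha]
      exact (nrm_add_le _ _ _).trans (add_le_add (h a) ih)
  exact h1.trans (sum_le_hasSum s (fun k _ => h0 k) hc)

/-- The number of terms meeting a set is controlled site by site. -/
theorem sum_not_disjoint_le (S : Finset (Site d L)) {b : Finset (Site d L) → ℝ} (hb : ∀ T, 0 ≤ b T) :
    ∑ T, (if Disjoint S T then 0 else b T) ≤ ∑ y ∈ S, ∑ T with y ∈ T, b T := by
  simp_rw [Finset.sum_filter]
  rw [Finset.sum_comm]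
  refine Finset.sum_le_sum fun T _ => ?_
  have h0 : ∀ y ∈ S, 0 ≤ (if y ∈ T then b T else 0) := fun y _ => by
    split_ifs
    exacts [hb T, le_rfl]
  split_ifs with h
  · exact Finset.sum_nonneg h0
  · obtain ⟨y, hy, hy'⟩ := Finset.not_disjoint_iff.1 h
    refine le_trans ?_ (Finset.single_le_sum h0 hy)
    simp [hy']

/-- Count each `S` once per site it contains; each site contributes at most `nrm μ A`, and `|S| ≥ 1`
saves a factor `e^{-μ}`. -/
theorem sum_card_mul_norm_le {μ : ℝ} (hμ : 0 ≤ μ) (A : LocFam d L q) :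
    ∑ S, (S.card : ℝ) * ‖A.term S‖ ≤ Fintype.card (Site d L) * (Real.exp (-μ) * nrm μ A) := by
  have e : ∑ S, (S.card : ℝ) * ‖A.term S‖ =
      ∑ x : Site d L, ∑ S : Finset (Site d L) with x ∈ S, ‖A.term S‖ := by
    simp_rw [Finset.sum_filter]
    rw [Finset.sum_comm]
    refine Finset.sum_congr rfl fun S _ => ?_
    rw [← Finset.sum_filter, Finset.sum_const, nsmul_eq_mul]
    simp
  rw [e, ← nsmul_eq_mul, ← Finset.card_univ, ← Finset.sum_const]
  refine Finset.sum_le_sum fun x _ => ?_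
  calc _ ≤ Real.exp (-μ) * siteNorm μ A x := by
        rw [siteNorm, Finset.mul_sum]
        refine Finset.sum_le_sum fun S hS => ?_
        have h1 : (1 : ℝ) ≤ S.card := by
          exact_mod_cast Finset.card_pos.2 ⟨x, (Finset.mem_filter.1 hS).2⟩
        have h2 : 1 ≤ Real.exp (-μ) * Real.exp (μ * S.card) := by
          rw [← Real.exp_add, Real.one_le_exp_iff]
          nlinarith
        calc ‖A.term S‖ = 1 * ‖A.term S‖ := (one_mul _).symm
          _ ≤ (Real.exp (-μ) * Real.exp (μ * S.card)) * ‖A.term S‖ := by gcongr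
          _ = _ := by ring
    _ ≤ _ := by gcongr; exact siteNorm_le_nrm μ A x

theorem norm_le_card_mul_norm (A : LocFam d L q) (S : Finset (Site d L)) :
    ‖A.term S‖ ≤ S.card * ‖A.term S‖ := by
  by_cases h : IsConn S
  · have h1 : (1 : ℝ) ≤ S.card := by exact_mod_cast Finset.card_pos.2 h.nonempty
    nlinarith [norm_nonneg (A.term S)]
  · simp [A.term_eq_zero h]

theorem norm_op_le {μ : ℝ} (hμ : 0 ≤ μ) (A : LocFam d L q) :
    ‖op A‖ ≤ Fintype.card (Site d L) * (Real.exp (-μ) * nrm μ A) :=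
  calc ‖op A‖ ≤ ∑ S, ‖A.term S‖ := norm_sum_le _ _
    _ ≤ ∑ S, (S.card : ℝ) * ‖A.term S‖ := Finset.sum_le_sum fun S _ => norm_le_card_mul_norm A S
    _ ≤ _ := sum_card_mul_norm_le hμ A

theorem sum_filter_norm_le {μ : ℝ} (hμ : 0 ≤ μ) (A : LocFam d L q) (x : Site d L) :
    ∑ S : Finset (Site d L) with x ∈ S, ‖A.term S‖ ≤ Real.exp (-μ) * nrm μ A := by
  refine le_trans ?_ (mul_le_mul_of_nonneg_left (siteNorm_le_nrm μ A x) (Real.exp_pos _).le)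
  rw [siteNorm, Finset.mul_sum]
  refine Finset.sum_le_sum fun S hS => ?_
  have h1 : (1 : ℝ) ≤ S.card := by
    exact_mod_cast Finset.card_pos.2 ⟨x, (Finset.mem_filter.1 hS).2⟩
  have h2 : 1 ≤ Real.exp (-μ) * Real.exp (μ * S.card) := by
    rw [← Real.exp_add, Real.one_le_exp_iff]
    nlinarith
  calc ‖A.term S‖ = 1 * ‖A.term S‖ := (one_mul _).symm
    _ ≤ (Real.exp (-μ) * Real.exp (μ * S.card)) * ‖A.term S‖ := by gcongr
    _ = _ := by ring

theorem norm_commutator_le {𝔸 : Type*} [NormedRing 𝔸] (a b : 𝔸) :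
    ‖a * b - b * a‖ ≤ 2 * (‖a‖ * ‖b‖) := by
  have h1 := norm_sub_le (a * b) (b * a)
  have h2 := norm_mul_le a b
  have h3 := norm_mul_le b a
  nlinarith

/-- The operator norm of a commutator of two extensive local operators is extensive. -/
theorem norm_op_commutator_le {μ ν : ℝ} (hμ : 0 ≤ μ) (hν : 0 ≤ ν) (A B : LocFam d L q) :
    ‖op A * op B - op B * op A‖ ≤
      Fintype.card (Site d L) *
        (2 * (Real.exp (-μ) * nrm μ A) * (Real.exp (-ν) * nrm ν B)) := by
  have e : op A * op B - op B * op A =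
      ∑ S, ∑ T, (A.term S * B.term T - B.term T * A.term S) := by
    rw [op_apply, op_apply, Finset.sum_mul_sum, Finset.sum_mul_sum, Finset.sum_comm (s := Finset.univ)
      (t := Finset.univ) (f := fun S T => B.term S * A.term T)]
    simp_rw [← Finset.sum_sub_distrib]
  set b := Real.exp (-ν) * nrm ν B with hb
  have hb0 : 0 ≤ b := mul_nonneg (Real.exp_pos _).le (nrm_nonneg _ _)
  calc ‖op A * op B - op B * op A‖
      ≤ ∑ S, ‖∑ T, (A.term S * B.term T - B.term T * A.term S)‖ := by
        rw [e]; exact norm_sum_le _ _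
    -- Only the `T` that meet `S` fail to commute, at the price of one factor `|S|`; the sum of `|S|
    -- ‖A_S‖` remains extensive.
    _ ≤ ∑ S, (2 * b) * (S.card * ‖A.term S‖) := by
        refine Finset.sum_le_sum fun S _ => ?_
        calc _ ≤ ∑ T, ‖A.term S * B.term T - B.term T * A.term S‖ := norm_sum_le _ _
          _ ≤ ∑ T, (2 * ‖A.term S‖) * (if Disjoint S T then 0 else ‖B.term T‖) := by
              refine Finset.sum_le_sum fun T _ => ?_
              split_ifs with h
              · rw [((A.supported S).commute (B.supported T) h).eq]; simp
              · exact (norm_commutator_le _ _).trans (by rw [mul_assoc])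
          _ ≤ (2 * ‖A.term S‖) * ∑ y ∈ S, ∑ T with y ∈ T, ‖B.term T‖ := by
              rw [← Finset.mul_sum]
              gcongr
              exact sum_not_disjoint_le S fun T => norm_nonneg _
          _ ≤ (2 * ‖A.term S‖) * (S.card * b) := by
              gcongr
              rw [← nsmul_eq_mul, ← Finset.sum_const]
              exact Finset.sum_le_sum fun y _ => sum_filter_norm_le hν B y
          _ = _ := by ring
    _ = (2 * b) * ∑ S, (S.card : ℝ) * ‖A.term S‖ := by rw [Finset.mul_sum]
    _ ≤ (2 * b) * (Fintype.card (Site d L) * (Real.exp (-μ) * nrm μ A)) := by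
        gcongr
        exact sum_card_mul_norm_le hμ A
    _ = _ := by ring

/-- The local terms of the commutator of two extensive local operators. -/
def brTerm (A B : LocFam d L q) (S : Finset (Site d L)) : Op d L q :=
  ∑ S₁, ∑ S₂, if S₁ ∪ S₂ = S ∧ ¬ Disjoint S₁ S₂ then
    A.term S₁ * B.term S₂ - B.term S₂ * A.term S₁ else 0

theorem brTerm_mem (A B : LocFam d L q) :
    ∀ S, SupportedOn S (brTerm A B S) ∧ (¬ IsConn S → brTerm A B S = 0) := by
  intro S
  constructor
  · refine SupportedOn.sum fun S₁ _ => SupportedOn.sum fun S₂ _ => ?_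
    split_ifs with h
    · obtain ⟨rfl, -⟩ := h
      have h1 := (A.supported S₁).mono (Finset.subset_union_left (s₂ := S₂))
      have h2 := (B.supported S₂).mono (Finset.subset_union_right (s₁ := S₁))
      exact (h1.mul h2).sub (h2.mul h1)
    · exact supportedOn_zero S
  · intro hS
    refine Finset.sum_eq_zero fun S₁ _ => Finset.sum_eq_zero fun S₂ _ => ?_
    split_ifs with h
    · obtain ⟨rfl, h⟩ := h
      by_cases h1 : IsConn S₁
      · by_cases h2 : IsConn S₂
        · exact absurd (h1.union h2 h) hS
        · simp [B.term_eq_zero h2]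
      · simp [A.term_eq_zero h1]
    · rfl

/-- The commutator with `A`, as an endomorphism of the space of extensive local operators. -/
def br (A : LocFam d L q) : LocFam d L q →ₗ[ℂ] LocFam d L q where
  toFun B := mk (brTerm A B) (brTerm_mem A B)
  map_add' B C := by
    apply ext
    intro S
    change brTerm A (B + C) S = brTerm A B S + brTerm A C S
    simp only [brTerm, ← Finset.sum_add_distrib]
    refine Finset.sum_congr rfl fun S₁ _ => Finset.sum_congr rfl fun S₂ _ => ?_
    split_ifs
    · rw [term_add]; noncomm_ring
    · simp
  map_smul' c B := by
    apply ext
    intro S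
    change brTerm A (c • B) S = c • brTerm A B S
    simp only [brTerm, Finset.smul_sum]
    refine Finset.sum_congr rfl fun S₁ _ => Finset.sum_congr rfl fun S₂ _ => ?_
    split_ifs
    · rw [term_smul, smul_sub]; simp
    · simp

theorem br_term (A B : LocFam d L q) (S : Finset (Site d L)) :
    (br A B).term S = ∑ S₁, ∑ S₂, if S₁ ∪ S₂ = S ∧ ¬ Disjoint S₁ S₂ then
      A.term S₁ * B.term S₂ - B.term S₂ * A.term S₁ else 0 := rfl

theorem op_br (A B : LocFam d L q) : op (br A B) = op A * op B - op B * op A := by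
  rw [op_apply (br A B), op_apply, op_apply, Finset.sum_mul_sum, Finset.sum_mul_sum,
    Finset.sum_comm (s := Finset.univ) (t := Finset.univ) (f := fun S T => B.term S * A.term T),
    ← Finset.sum_sub_distrib]
  simp_rw [br_term]
  rw [Finset.sum_comm]
  refine Finset.sum_congr rfl fun S₁ _ => ?_
  rw [Finset.sum_comm, ← Finset.sum_sub_distrib]
  refine Finset.sum_congr rfl fun S₂ _ => ?_
  simp_rw [ite_and]
  rw [Finset.sum_ite_eq, if_pos (Finset.mem_univ _)]
  by_cases h : Disjoint S₁ S₂
  · rw [if_neg (not_not.2 h), ((A.supported S₁).commute (B.supported S₂) h).eq, sub_self]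
  · rw [if_pos h]

/-- A site that meets `S` lies in `S`, so bracketing with on-site terms produces no larger sets and
acts term by term. -/
theorem br_onSite_term {N : LocFam d L q} (hN : ∀ S, S.card ≠ 1 → N.term S = 0) (A : LocFam d L q)
    (S : Finset (Site d L)) : (br A N).term S = A.term S * op N - op N * A.term S := by
  rw [br_term, op_apply, Finset.mul_sum, Finset.sum_mul, ← Finset.sum_sub_distrib,
    Finset.sum_eq_single S]
  · refine Finset.sum_congr rfl fun T _ => ?_
    by_cases hT : T.card = 1
    · obtain ⟨x, rfl⟩ := Finset.card_eq_one.1 hT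
      by_cases hx : x ∈ S
      · simp [hx]
      · rw [if_neg (by simp [hx]),
          ((A.supported S).commute (N.supported {x}) (by simpa using hx)).eq, sub_self]
    · simp [hN T hT]
  · intro S₁ _ hne
    refine Finset.sum_eq_zero fun T _ => ?_
    by_cases hT : T.card = 1
    · obtain ⟨x, rfl⟩ := Finset.card_eq_one.1 hT
      refine if_neg fun h => hne ?_
      obtain ⟨h1, h2⟩ := h
      have hx : x ∈ S₁ := by simpa using h2
      rw [← h1, Finset.union_eq_left.2 (by simpa using hx)]
    · simp [hN T hT]
  · simp

theorem SelfAdj.I_smul_br {A B : LocFam d L q} (hA : A.SelfAdj) (hB : B.SelfAdj) :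
    (Complex.I • br A B).SelfAdj := by
  intro S
  rw [isSelfAdjoint_iff, term_smul, br_term, star_smul, star_sum, Finset.smul_sum, Finset.smul_sum]
  refine Finset.sum_congr rfl fun S₁ _ => ?_
  rw [star_sum, Finset.smul_sum, Finset.smul_sum]
  refine Finset.sum_congr rfl fun S₂ _ => ?_
  split_ifs
  · rw [star_sub, star_mul, star_mul, (hA S₁).star_eq, (hB S₂).star_eq,
      Complex.star_def, Complex.conj_I, neg_smul, ← smul_neg, neg_sub]
  · simp

/-- From `u ≤ e^{u-1}` with `u = ηs`: a loss `η` of weight pays for one factor of cardinality. The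
constant `1/(eη)` originates here. -/
theorem card_mul_exp_le {η : ℝ} (hη : 0 < η) (ν s : ℝ) :
    s * Real.exp ((ν - η) * s) ≤ (1 / (Real.exp 1 * η)) * Real.exp (ν * s) := by
  have h1 : η * s ≤ Real.exp (η * s) / Real.exp 1 := by
    rw [← Real.exp_sub]
    have := Real.add_one_le_exp (η * s - 1)
    linarith
  have h2 : Real.exp (ν * s) = Real.exp ((ν - η) * s) * Real.exp (η * s) := by
    rw [← Real.exp_add]; ring_nf
  have h3 : s ≤ (1 / (Real.exp 1 * η)) * Real.exp (η * s) := by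
    have := Real.exp_pos 1
    rw [one_div, inv_mul_eq_div, le_div_iff₀ (by positivity)]
    rw [le_div_iff₀ this] at h1
    linarith
  rw [h2]
  calc _ ≤ ((1 / (Real.exp 1 * η)) * Real.exp (η * s)) * Real.exp ((ν - η) * s) := by gcongr
    _ = _ := by ring

/-- `∑_{S ∋ x} |S| ‖A_S‖ e^{(ν - η) |S|}` is bounded by the norm with the larger weight. -/
theorem sum_card_mul_siteNorm_le {ν η : ℝ} (hη : 0 < η) (A : LocFam d L q) (x : Site d L) :
    ∑ S : Finset (Site d L) with x ∈ S, (S.card : ℝ) * (‖A.term S‖ * Real.exp ((ν - η) * S.card)) ≤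
      (1 / (Real.exp 1 * η)) * nrm ν A := by
  refine le_trans ?_ (mul_le_mul_of_nonneg_left (siteNorm_le_nrm ν A x) (by positivity))
  rw [siteNorm, Finset.mul_sum]
  refine Finset.sum_le_sum fun S _ => ?_
  have := mul_le_mul_of_nonneg_left (card_mul_exp_le hη ν S.card) (norm_nonneg (A.term S))
  linarith

/-- Pairs of intersecting sets, the first of which contains `x`. -/
theorem sum_pairs_le {ν η : ℝ} (hη : 0 < η) (A B : LocFam d L q) (x : Site d L) :
    ∑ S₁, ∑ S₂, (if x ∈ S₁ ∧ ¬ Disjoint S₁ S₂ then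
      (‖A.term S₁‖ * Real.exp ((ν - η) * S₁.card)) * (‖B.term S₂‖ * Real.exp ((ν - η) * S₂.card))
      else 0) ≤ (1 / (Real.exp 1 * η)) * nrm ν A * nrm ν B := by
  have hB : nrm (ν - η) B ≤ nrm ν B := nrm_mono (by linarith) B
  calc _ ≤ ∑ S₁ : Finset (Site d L) with x ∈ S₁,
        (S₁.card : ℝ) * (‖A.term S₁‖ * Real.exp ((ν - η) * S₁.card)) * nrm ν B := by
        rw [Finset.sum_filter]
        refine Finset.sum_le_sum fun S₁ _ => ?_
        by_cases hx : x ∈ S₁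
        · simp only [hx, true_and, if_true]
          calc _ = (‖A.term S₁‖ * Real.exp ((ν - η) * S₁.card)) * ∑ S₂, (if Disjoint S₁ S₂ then 0 else
                (‖B.term S₂‖ * Real.exp ((ν - η) * S₂.card))) := by
                rw [Finset.mul_sum]
                refine Finset.sum_congr rfl fun S₂ _ => ?_
                by_cases h : Disjoint S₁ S₂ <;> simp [h]
            _ ≤ (‖A.term S₁‖ * Real.exp ((ν - η) * S₁.card)) * ∑ y ∈ S₁, nrm ν B := by
                gcongr
                refine (sum_not_disjoint_le S₁ fun T => by positivity).trans ?_
                exact Finset.sum_le_sum fun y _ => (siteNorm_le_nrm (ν - η) B y).trans hB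
            _ = _ := by rw [Finset.sum_const, nsmul_eq_mul]; ring
        · simp [hx]
    _ ≤ _ := by
        rw [← Finset.sum_mul]
        exact mul_le_mul_of_nonneg_right (sum_card_mul_siteNorm_le hη A x) (nrm_nonneg _ _)

/-- The weight splits because `|S₁ ∪ S₂| ≤ |S₁| + |S₂|`. A site of the union lies in one of the two
sets, the other set meets that one, and the resulting cardinality is absorbed by the loss `η`. The 4
is 2 for the commutator times 2 for the choice of set. -/
theorem nrm_br_le {ν η : ℝ} (hη : 0 < η) (hν : η ≤ ν) (A B : LocFam d L q) :
    nrm (ν - η) (br A B) ≤ 4 / (Real.exp 1 * η) * nrm ν A * nrm ν B := by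
  refine nrm_le fun x => ?_
  set a : Finset (Site d L) → ℝ := fun S => ‖A.term S‖ * Real.exp ((ν - η) * S.card) with ha
  set b : Finset (Site d L) → ℝ := fun S => ‖B.term S‖ * Real.exp ((ν - η) * S.card) with hb
  have ha0 : ∀ S, 0 ≤ a S := fun S => by positivity
  have hb0 : ∀ S, 0 ≤ b S := fun S => by positivity
  have hAB := sum_pairs_le (ν := ν) hη A B x
  have hBA := sum_pairs_le (ν := ν) hη B A x
  rw [Finset.sum_comm] at hBA
  have key : siteNorm (ν - η) (br A B) x ≤
      ∑ S₁, ∑ S₂, (2 * (if x ∈ S₁ ∧ ¬ Disjoint S₁ S₂ then a S₁ * b S₂ else 0) +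
        2 * (if x ∈ S₂ ∧ ¬ Disjoint S₂ S₁ then b S₂ * a S₁ else 0)) := by
    calc siteNorm (ν - η) (br A B) x ≤ ∑ S, ∑ S₁, ∑ S₂, (if S₁ ∪ S₂ = S then
          (if x ∈ S ∧ ¬ Disjoint S₁ S₂ then 2 * (a S₁ * b S₂) else 0) else 0) := by
          rw [siteNorm, Finset.sum_filter]
          refine Finset.sum_le_sum fun S _ => ?_
          by_cases hx : x ∈ S
          · rw [if_pos hx, br_term]
            calc _ ≤ (∑ S₁, ∑ S₂, if S₁ ∪ S₂ = S ∧ ¬ Disjoint S₁ S₂ then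
                  2 * (‖A.term S₁‖ * ‖B.term S₂‖) else 0) * Real.exp ((ν - η) * S.card) := by
                  gcongr
                  refine (norm_sum_le _ _).trans (Finset.sum_le_sum fun S₁ _ => ?_)
                  refine (norm_sum_le _ _).trans (Finset.sum_le_sum fun S₂ _ => ?_)
                  split_ifs
                  · exact norm_commutator_le _ _
                  · simp
              _ ≤ _ := by
                  rw [Finset.sum_mul]
                  refine Finset.sum_le_sum fun S₁ _ => ?_
                  rw [Finset.sum_mul]
                  refine Finset.sum_le_sum fun S₂ _ => ?_
                  by_cases h1 : S₁ ∪ S₂ = S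
                  · by_cases h2 : Disjoint S₁ S₂
                    · simp [h2]
                    · rw [if_pos ⟨h1, h2⟩, if_pos h1, if_pos ⟨hx, h2⟩]
                      have hcard : (S.card : ℝ) ≤ S₁.card + S₂.card := by
                        rw [← h1]; exact_mod_cast Finset.card_union_le S₁ S₂
                      have hexp : Real.exp ((ν - η) * S.card) ≤
                          Real.exp ((ν - η) * S₁.card) * Real.exp ((ν - η) * S₂.card) := by
                        rw [← Real.exp_add, Real.exp_le_exp]
                        nlinarith
                      calc _ ≤ 2 * (‖A.term S₁‖ * ‖B.term S₂‖) *
                            (Real.exp ((ν - η) * S₁.card) * Real.exp ((ν - η) * S₂.card)) := by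
                            gcongr
                        _ = _ := by simp only [ha, hb]; ring
                  · simp [h1]
          · rw [if_neg hx]
            refine Finset.sum_nonneg fun S₁ _ => Finset.sum_nonneg fun S₂ _ => ?_
            simp [hx]
      _ = ∑ S₁, ∑ S₂, (if x ∈ S₁ ∪ S₂ ∧ ¬ Disjoint S₁ S₂ then 2 * (a S₁ * b S₂) else 0) := by
          rw [Finset.sum_comm]
          refine Finset.sum_congr rfl fun S₁ _ => ?_
          rw [Finset.sum_comm]
          refine Finset.sum_congr rfl fun S₂ _ => ?_
          rw [Finset.sum_ite_eq, if_pos (Finset.mem_univ _)]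
      _ ≤ _ := by
          refine Finset.sum_le_sum fun S₁ _ => Finset.sum_le_sum fun S₂ _ => ?_
          have h0 := mul_nonneg (ha0 S₁) (hb0 S₂)
          by_cases h2 : Disjoint S₁ S₂
          · simp [h2, h2.symm]
          · have h2' : ¬ Disjoint S₂ S₁ := fun h => h2 h.symm
            by_cases hx1 : x ∈ S₁ <;> by_cases hx2 : x ∈ S₂ <;>
              simp [h2, h2', hx1, hx2] <;> nlinarith
  simp_rw [Finset.sum_add_distrib, ← Finset.mul_sum] at key
  have e : 4 / (Real.exp 1 * η) * nrm ν A * nrm ν B =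
      2 * ((1 / (Real.exp 1 * η)) * nrm ν A * nrm ν B) +
        2 * ((1 / (Real.exp 1 * η)) * nrm ν B * nrm ν A) := by ring
  rw [e]
  linarith

end LocFam

/-- The family of local terms of an extensive local operator. -/
def ExtOp.toLocFam (A : ExtOp d L q) : LocFam d L q :=
  LocFam.mk A.term fun S => ⟨A.supported S, A.term_eq_zero S⟩

/-- The extensive local operator with the given family of local terms. -/
def LocFam.toExtOp (A : LocFam d L q) : ExtOp d L q where
  term := A.term
  supported := A.supported
  term_eq_zero _ h := A.term_eq_zero h

theorem LocFam.norm_toExtOp (κ : ℝ) (A : LocFam d L q) : A.toExtOp.norm κ = LocFam.nrm κ A := rfl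

theorem ExtOp.nrm_toLocFam (κ : ℝ) (A : ExtOp d L q) : LocFam.nrm κ A.toLocFam = A.norm κ := rfl

attribute [irreducible] LocFam.nrm

end Family

/-! ### The flow of a bracket on families and its convergence in weighted norms. -/

section Flow

variable {d L q : ℕ}

theorem hasDerivAt_exp_smul_apply {E F : Type*} [NormedAddCommGroup E] [NormedSpace ℂ E]
    [CompleteSpace E] [NormedAddCommGroup F] [NormedSpace ℂ F] (Φ : E →L[ℂ] F) (T : E →L[ℂ] E)
    (B : E) (s : ℝ) :
    HasDerivAt (fun s : ℝ => Φ ((NormedSpace.exp (s • T)) B))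
      (Φ (T ((NormedSpace.exp (s • T)) B))) s :=
  ((Φ.comp (ContinuousLinearMap.apply ℂ E B)).restrictScalars ℝ).hasFDerivAt.comp_hasDerivAt s
    (hasDerivAt_exp_smul_const' (𝕂 := ℝ) T s)

theorem hasSum_exp_apply {E : Type*} [NormedAddCommGroup E] [NormedSpace ℂ E]
    [CompleteSpace E] (T : E →L[ℂ] E) (B : E) :
    HasSum (fun k : ℕ => ((k.factorial : ℂ)⁻¹) • (T ^ k) B) (NormedSpace.exp T B) :=
  (NormedSpace.exp_series_hasSum_exp' (𝕂 := ℂ) T).mapL (ContinuousLinearMap.apply ℂ E B)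

namespace LocFam

/-- `B ↦ i [G, B]` -/
def adI (G : LocFam d L q) : LocFam d L q →L[ℂ] LocFam d L q :=
  LinearMap.toContinuousLinearMap (Complex.I • br G)

theorem adI_apply (G B : LocFam d L q) : adI G B = Complex.I • br G B := rfl

theorem op_adI (G B : LocFam d L q) :
    op (adI G B) = Complex.I • (op G * op B - op B * op G) := by
  rw [adI_apply, map_smul, op_br]

theorem SelfAdj.adI {G B : LocFam d L q} (hG : G.SelfAdj) (hB : B.SelfAdj) : (adI G B).SelfAdj :=
  hG.I_smul_br hB

/-- `e^{i [G, ·]}` acting on families of local terms. -/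
def flow (G : LocFam d L q) : LocFam d L q →L[ℂ] LocFam d L q := NormedSpace.exp (adI G)

theorem hasSum_flow (G B : LocFam d L q) :
    HasSum (fun k : ℕ => ((k.factorial : ℂ)⁻¹) • (adI G ^ k) B) (flow G B) :=
  hasSum_exp_apply (adI G) B

/-- Rotating the family flow back by `-op G` gives an operator with zero derivative, so the formal
series realises unitary conjugation. -/
theorem op_flow (G B : LocFam d L q) : op (flow G B) = heis (op G) 1 (op B) := by
  set T := adI G with hT
  have hg : ∀ s : ℝ, HasDerivAt (fun s : ℝ => op ((NormedSpace.exp (s • T)) B))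
      (op (T ((NormedSpace.exp (s • T)) B))) s := fun s =>
    hasDerivAt_exp_smul_apply (LinearMap.toContinuousLinearMap op) T B s
  have hf : ∀ s : ℝ, HasDerivAt (fun s => heis (-op G) s (op ((NormedSpace.exp (s • T)) B))) 0 s := by
    intro s
    refine (hasDerivAt_heis (-op G) (hg s)).congr_deriv ?_
    have e : ∀ g : Op d L q, Complex.I • (-op G * g - g * -op G) +
        Complex.I • (op G * g - g * op G) = 0 := fun g => by
      rw [← smul_add]
      simp
    rw [hT, op_adI, e]
    simp [heis]
  have hc := is_const_of_deriv_eq_zero (fun s => (hf s).differentiableAt)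
    (fun s => (hf s).deriv) 1 0
  simp only [one_smul, zero_smul, NormedSpace.exp_zero, heis_zero_time] at hc
  have hc' : heis (-op G) 1 (op (flow G B)) = op B := hc
  rw [← hc', heis_neg, heis_heis_neg]

theorem SelfAdj.adI_pow {G B : LocFam d L q} (hG : G.SelfAdj) (hB : B.SelfAdj) (k : ℕ) :
    ((LocFam.adI G ^ k) B).SelfAdj := by
  induction k with
  | zero => simpa using hB
  | succ k ih =>
    rw [pow_succ', mul_apply_eq_comp]
    exact SelfAdj.adI hG ih

theorem selfAdj_zero : (0 : LocFam d L q).SelfAdj := fun _ => IsSelfAdjoint.zero _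

theorem SelfAdj.flow {G B : LocFam d L q} (hG : G.SelfAdj) (hB : B.SelfAdj) :
    (flow G B).SelfAdj := by
  refine isClosed_selfAdj.mem_of_tendsto (hasSum_flow G B) (Filter.Eventually.of_forall fun s => ?_)
  change (∑ k ∈ s, ((k.factorial : ℂ)⁻¹) • (LocFam.adI G ^ k) B).SelfAdj
  induction s using Finset.induction_on with
  | empty => simpa using selfAdj_zero
  | insert a s ha ih =>
    rw [Finset.sum_insert ha]
    refine SelfAdj.add ?_ ih
    have := (hG.adI_pow hB a).ofReal_smul ((a.factorial : ℝ)⁻¹)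
    rwa [Complex.ofReal_inv, Complex.ofReal_natCast] at this

theorem nrm_adI_le {ν η : ℝ} (hη : 0 < η) (hν : η ≤ ν) (G B : LocFam d L q) :
    nrm (ν - η) (adI G B) ≤ 4 / (Real.exp 1 * η) * nrm ν G * nrm ν B := by
  refine (nrm_smul_le _ _ _).trans ?_
  simpa using nrm_br_le hη hν G B

theorem nrm_adI_pow_le {μ η a : ℝ} (hη : 0 < η) {G : LocFam d L q} (hG : nrm μ G ≤ a)
    (B : LocFam d L q) (j : ℕ) (hj : j * η ≤ μ) :
    nrm (μ - j * η) ((adI G ^ j) B) ≤ (4 * a / (Real.exp 1 * η)) ^ j * nrm μ B := by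
  induction j with
  | zero => simp
  | succ j ih =>
    rw [Nat.cast_succ] at hj ⊢
    have h1 := ih (by nlinarith)
    have h2 := nrm_adI_le hη (ν := μ - j * η) (by linarith) G ((adI G ^ j) B)
    have h3 : nrm (μ - j * η) G ≤ a :=
      (nrm_mono (sub_le_self _ (by positivity)) G).trans hG
    have ha : 0 ≤ a := (nrm_nonneg _ _).trans hG
    rw [pow_succ', pow_succ', show μ - (j + 1) * η = μ - j * η - η by ring]
    calc _ ≤ 4 / (Real.exp 1 * η) * nrm (μ - j * η) G * nrm (μ - j * η) ((adI G ^ j) B) := h2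
      _ ≤ 4 / (Real.exp 1 * η) * a * ((4 * a / (Real.exp 1 * η)) ^ j * nrm μ B) := by
          gcongr
          exact nrm_nonneg _ _
      _ = _ := by ring

/-- The loss `δ` is shared equally among the `k` brackets. This yields `(4a/δ)^k · k^k/(e^k k!)`,
and the last factor is at most 1. -/
theorem nrm_flow_term_le {μ δ a : ℝ} (hδ : 0 < δ) (hμ : δ ≤ μ) {G : LocFam d L q}
    (hG : nrm μ G ≤ a) (B : LocFam d L q) (k : ℕ) :
    nrm (μ - δ) (((k.factorial : ℂ)⁻¹) • (adI G ^ k) B) ≤ (4 * a / δ) ^ k * nrm μ B := by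
  have ha : 0 ≤ a := (nrm_nonneg _ _).trans hG
  rcases Nat.eq_zero_or_pos k with rfl | hk
  · simpa using nrm_mono (sub_le_self μ hδ.le) B
  have hk' : (0 : ℝ) < k := by exact_mod_cast hk
  have h := nrm_adI_pow_le (η := δ / k) (by positivity) hG B k (by rw [mul_div_cancel₀ _ hk'.ne']; exact hμ)
  rw [mul_div_cancel₀ _ hk'.ne'] at h
  refine (nrm_smul_le _ _ _).trans ?_
  rw [norm_inv, Complex.norm_natCast]
  have hfac : (0 : ℝ) < k.factorial := by exact_mod_cast k.factorial_pos
  have hst := Real.pow_div_factorial_le_exp (k : ℝ) hk'.le k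
  have he : Real.exp k = Real.exp 1 ^ k := by rw [← Real.exp_nat_mul, mul_one]
  rw [he, div_le_iff₀ hfac] at hst
  have hB := nrm_nonneg μ B
  calc _ ≤ (k.factorial : ℝ)⁻¹ * ((4 * a / (Real.exp 1 * (δ / k))) ^ k * nrm μ B) := by gcongr
    _ = (4 * a / δ) ^ k * ((k : ℝ) ^ k / (Real.exp 1 ^ k * k.factorial)) * nrm μ B := by
        rw [show 4 * a / (Real.exp 1 * (δ / k)) = (4 * a / δ) * (k / Real.exp 1) by field_simp,
          mul_pow, div_pow (k : ℝ)]
        field_simp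
    _ ≤ (4 * a / δ) ^ k * 1 * nrm μ B := by
        gcongr
        rw [div_le_one (by positivity)]
        linarith
    _ = _ := by ring

theorem hasSum_flow_sub (G B : LocFam d L q) :
    HasSum (fun k : ℕ => (((k + 1).factorial : ℂ)⁻¹) • (adI G ^ (k + 1)) B) (flow G B - B) := by
  have h := (hasSum_nat_add_iff' 1).2 (hasSum_flow G B)
  simpa using h

theorem nrm_flow_le {μ δ a : ℝ} (hδ : 0 < δ) (hμ : δ ≤ μ) {G : LocFam d L q}
    (hG : nrm μ G ≤ a) (hθ : 4 * a / δ < 1) (B : LocFam d L q) :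
    nrm (μ - δ) (flow G B) ≤ (1 - 4 * a / δ)⁻¹ * nrm μ B := by
  have ha : 0 ≤ a := (nrm_nonneg _ _).trans hG
  exact nrm_hasSum_le (hasSum_flow G B)
    ((hasSum_geometric_of_lt_one (by positivity) hθ).mul_right _) (nrm_flow_term_le hδ hμ hG B)

theorem nrm_flow_sub_le {μ δ a : ℝ} (hδ : 0 < δ) (hμ : δ ≤ μ) {G : LocFam d L q}
    (hG : nrm μ G ≤ a) (hθ : 4 * a / δ < 1) (B : LocFam d L q) :
    nrm (μ - δ) (flow G B - B) ≤ (4 * a / δ) * (1 - 4 * a / δ)⁻¹ * nrm μ B := by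
  have ha : 0 ≤ a := (nrm_nonneg _ _).trans hG
  refine nrm_hasSum_le (hasSum_flow_sub G B)
    (((hasSum_geometric_of_lt_one (by positivity) hθ).mul_left (4 * a / δ)).mul_right (nrm μ B))
    fun k => ?_
  rw [← pow_succ']
  exact nrm_flow_term_le hδ hμ hG B (k + 1)

/-- The series is read as one acting on `adI G B`, discarding the factor `1/(k+2)`. Having `adI G B`
rather than `B` on the right keeps the size of `N` out of the iteration. -/
theorem nrm_flow_sub_sub_le {μ δ a : ℝ} (hδ : 0 < δ) (hμ : δ ≤ μ) {G : LocFam d L q}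
    (hG : nrm μ G ≤ a) (hθ : 4 * a / δ < 1) (B : LocFam d L q) :
    nrm (μ - δ) (flow G B - B - adI G B) ≤
      (4 * a / δ) * (1 - 4 * a / δ)⁻¹ * nrm μ (adI G B) := by
  have ha : 0 ≤ a := (nrm_nonneg _ _).trans hG
  have hs : HasSum (fun k : ℕ => (((k + 2).factorial : ℂ)⁻¹) • (adI G ^ (k + 2)) B)
      (flow G B - B - adI G B) := by
    have h := (hasSum_nat_add_iff' 1).2 (hasSum_flow_sub G B)
    simpa [add_assoc] using h
  refine nrm_hasSum_le hs (((hasSum_geometric_of_lt_one (by positivity) hθ).mul_left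
    (4 * a / δ)).mul_right (nrm μ (adI G B))) fun k => ?_
  rw [← pow_succ']
  refine le_trans ?_ (nrm_flow_term_le hδ hμ hG (adI G B) (k + 1))
  have e : (((k + 2).factorial : ℂ)⁻¹) • (adI G ^ (k + 2)) B =
      ((k + 2 : ℂ)⁻¹) • ((((k + 1).factorial : ℂ)⁻¹) • (adI G ^ (k + 1)) (adI G B)) := by
    rw [pow_succ (adI G) (k + 1), smul_smul, Nat.factorial_succ (k + 1)]
    push_cast
    rw [mul_inv, show (k : ℂ) + 1 + 1 = k + 2 by ring]
    rfl
  rw [e]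
  refine (nrm_smul_le _ _ _).trans (mul_le_of_le_one_left (nrm_nonneg _ _) ?_)
  rw [norm_inv]
  apply inv_le_one_of_one_le₀
  rw [show (k : ℂ) + 2 = ((k + 2 : ℕ) : ℂ) by push_cast; ring, Complex.norm_natCast]
  exact_mod_cast (by omega : 1 ≤ k + 2)

end LocFam

end Flow

/-! ### Averaging over a periodic flow and the homological equation. -/

section Average

open Complex intervalIntegral

variable {𝔸 : Type*} [CStarAlgebra 𝔸]

theorem evol_eq_heis {d L q : ℕ} (H : Op d L q) (t : ℝ) (A : Op d L q) :
    evol H t A = heis H t A := rfl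

theorem exp_two_pi_smul_eq_one {N : 𝔸} (hN : IsSelfAdjoint N)
    (h : ∀ z ∈ spectrum ℂ N, ∃ n : ℤ, z = n) :
    NormedSpace.exp ((I * (2 * Real.pi : ℝ)) • N) = 1 := by
  have hn : IsStarNormal N := hN.isStarNormal
  have hn' : IsStarNormal ((I * (2 * Real.pi : ℝ)) • N) := inferInstance
  rw [← CFC.complex_exp_eq_normedSpace_exp (p := IsStarNormal), ← cfc_comp_smul _ _ N]
  rw [cfc_congr (g := fun _ => 1), cfc_const_one ℂ N]
  intro z hz
  obtain ⟨n, rfl⟩ := h z hz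
  simp only [smul_eq_mul]
  rw [← Complex.exp_int_mul_two_pi_mul_I n]
  congr 1
  push_cast
  ring

theorem heis_two_pi {N : 𝔸} (hN : IsSelfAdjoint N)
    (h : ∀ z ∈ spectrum ℂ N, ∃ n : ℤ, z = n) (A : 𝔸) : heis N (2 * Real.pi) A = A := by
  have h1 := exp_two_pi_smul_eq_one hN h
  have h2 := exp_mul_exp_neg N (2 * Real.pi)
  rw [h1, one_mul] at h2
  rw [heis, h1, h2, one_mul, mul_one]

/-- The average of `A` over the flow of `N`. -/
def avg (N A : 𝔸) : 𝔸 :=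
  ((2 * Real.pi : ℝ) : ℂ)⁻¹ • ∫ s in (0 : ℝ)..(2 * Real.pi), heis N s A

/-- The solution `G` of the equation `i [N, G] = A - ⟨A⟩`. -/
def gen (N A : 𝔸) : 𝔸 :=
  ((2 * Real.pi : ℝ) : ℂ)⁻¹ •
    ∫ s in (0 : ℝ)..(2 * Real.pi), ((s - Real.pi : ℝ) : ℂ) • heis N s A

theorem continuous_gen_integrand (N A : 𝔸) :
    Continuous fun s : ℝ => ((s - Real.pi : ℝ) : ℂ) • heis N s A :=
  (continuous_ofReal.comp (continuous_id.sub continuous_const)).smul (continuous_heis N A)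

/-- `X ↦ [N, X]` as a continuous linear map. -/
def commL (N : 𝔸) : 𝔸 →L[ℂ] 𝔸 :=
  ContinuousLinearMap.mul ℂ 𝔸 N - (ContinuousLinearMap.mul ℂ 𝔸).flip N

theorem commL_apply (N X : 𝔸) : commL N X = N * X - X * N := rfl

theorem commL_avg_eq (N A : 𝔸) : commL N (avg N A) =
    ((2 * Real.pi : ℝ) : ℂ)⁻¹ • ∫ s in (0 : ℝ)..(2 * Real.pi), commL N (heis N s A) := by
  rw [avg, map_smul, (commL N).intervalIntegral_comp_comm
    ((continuous_heis N A).intervalIntegrable _ _)]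

theorem commL_gen_eq (N A : 𝔸) : commL N (gen N A) = ((2 * Real.pi : ℝ) : ℂ)⁻¹ •
    ∫ s in (0 : ℝ)..(2 * Real.pi), commL N (((s - Real.pi : ℝ) : ℂ) • heis N s A) := by
  rw [gen, map_smul, (commL N).intervalIntegral_comp_comm
    ((continuous_gen_integrand N A).intervalIntegrable _ _)]

theorem two_pi_ne_zero' : ((2 * Real.pi : ℝ) : ℂ) ≠ 0 := by
  exact_mod_cast (by positivity : (2 * Real.pi : ℝ) ≠ 0)

/-- The commutator with the average is, up to a constant, the integral of the derivative of `heis N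
s A` over a full period. -/
theorem commute_avg {N A : 𝔸} (hper : heis N (2 * Real.pi) A = A) :
    N * avg N A - avg N A * N = 0 := by
  have h := integral_eq_sub_of_hasDerivAt (a := 0) (b := 2 * Real.pi)
    (fun s _ => hasDerivAt_heis_const' N A s)
    (((((commL N).continuous.comp (continuous_heis N A)).const_smul I)).intervalIntegrable _ _)
  rw [hper, heis_zero_time, sub_self, integral_smul, smul_eq_zero] at h
  rw [← commL_apply, commL_avg_eq]
  rcases h with h | h
  · exact absurd h I_ne_zero
  · simp only [commL_apply]
    rw [h, smul_zero]

/-- Integrate the derivative of `(s - π) • heis N s A` over a period: the boundary gives `2πA`, the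
slope of the weight gives the average. Any weight of slope 1 would do; centring at `π` bounds it by
`π` in `norm_gen_le`. -/
theorem I_smul_commutator_gen {N A : 𝔸} (hper : heis N (2 * Real.pi) A = A) :
    I • (N * gen N A - gen N A * N) = A - avg N A := by
  have hd : ∀ s : ℝ, HasDerivAt (fun s : ℝ => ((s - Real.pi : ℝ) : ℂ) • heis N s A)
      (heis N s A + I • commL N (((s - Real.pi : ℝ) : ℂ) • heis N s A)) s := by
    intro s
    have h1 : HasDerivAt (fun s : ℝ => ((s - Real.pi : ℝ) : ℂ)) 1 s :=
      ((hasDerivAt_id s).sub_const Real.pi).ofReal_comp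
    refine (h1.smul (hasDerivAt_heis_const' N A s)).congr_deriv ?_
    rw [one_smul, map_smul, smul_comm, ← commL_apply, add_comm]
  have hc : Continuous fun s : ℝ => I • commL N (((s - Real.pi : ℝ) : ℂ) • heis N s A) :=
    ((commL N).continuous.comp (continuous_gen_integrand N A)).const_smul I
  have h := integral_eq_sub_of_hasDerivAt (a := 0) (b := 2 * Real.pi) (fun s _ => hd s)
    (((continuous_heis N A).add hc).intervalIntegrable _ _)
  rw [hper, heis_zero_time, integral_add ((continuous_heis N A).intervalIntegrable _ _)
    (hc.intervalIntegrable _ _), integral_smul, ← sub_smul] at h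
  have e : (((2 * Real.pi - Real.pi : ℝ) : ℂ) - ((0 - Real.pi : ℝ) : ℂ)) =
      ((2 * Real.pi : ℝ) : ℂ) := by push_cast; ring
  rw [e] at h
  rw [← commL_apply, commL_gen_eq, smul_comm, eq_sub_of_add_eq' h, smul_sub, smul_smul,
    inv_mul_cancel₀ two_pi_ne_zero', one_smul, avg]

theorem norm_two_pi_inv : ‖((2 * Real.pi : ℝ) : ℂ)⁻¹‖ = (2 * Real.pi)⁻¹ := by
  rw [norm_inv, norm_real, Real.norm_of_nonneg (by positivity)]

theorem norm_avg_le {N : 𝔸} (hN : IsSelfAdjoint N) (A : 𝔸) : ‖avg N A‖ ≤ ‖A‖ := by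
  rw [avg, norm_smul, norm_two_pi_inv]
  have h := norm_integral_le_of_norm_le_const (a := 0) (b := 2 * Real.pi) (C := ‖A‖)
    (f := fun s => heis N s A) (fun s _ => (norm_heis hN s A).le)
  rw [sub_zero, abs_of_nonneg (by positivity)] at h
  calc _ ≤ (2 * Real.pi)⁻¹ * (‖A‖ * (2 * Real.pi)) := by gcongr
    _ = ‖A‖ := by field_simp

theorem norm_gen_le {N : 𝔸} (hN : IsSelfAdjoint N) (A : 𝔸) : ‖gen N A‖ ≤ Real.pi * ‖A‖ := by
  rw [gen, norm_smul, norm_two_pi_inv]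
  have h := norm_integral_le_of_norm_le_const (a := 0) (b := 2 * Real.pi) (C := Real.pi * ‖A‖)
    (f := fun s : ℝ => ((s - Real.pi : ℝ) : ℂ) • heis N s A) (fun s hs => by
      rw [Set.uIoc_of_le (by positivity)] at hs
      rw [norm_smul, norm_heis hN, norm_real, Real.norm_eq_abs]
      gcongr
      rw [abs_le]
      constructor <;> linarith [hs.1, hs.2])
  rw [sub_zero, abs_of_nonneg (a := 2 * Real.pi) (by positivity)] at h
  calc _ ≤ (2 * Real.pi)⁻¹ * (Real.pi * ‖A‖ * (2 * Real.pi)) := by gcongr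
    _ = Real.pi * ‖A‖ := by field_simp

theorem star_intervalIntegral {f : ℝ → 𝔸} (hf : Continuous f) (a b : ℝ) :
    star (∫ s in a..b, f s) = ∫ s in a..b, star (f s) :=
  ((starL' ℝ : 𝔸 ≃L[ℝ] 𝔸).toContinuousLinearMap.intervalIntegral_comp_comm
    (hf.intervalIntegrable a b)).symm

theorem isSelfAdjoint_avg {N A : 𝔸} (hN : IsSelfAdjoint N) (hA : IsSelfAdjoint A) :
    IsSelfAdjoint (avg N A) := by
  rw [isSelfAdjoint_iff, avg, star_smul, star_intervalIntegral (continuous_heis N A)]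
  simp only [star_heis hN, hA.star_eq]
  simp

theorem isSelfAdjoint_gen {N A : 𝔸} (hN : IsSelfAdjoint N) (hA : IsSelfAdjoint A) :
    IsSelfAdjoint (gen N A) := by
  rw [isSelfAdjoint_iff, gen, star_smul, star_intervalIntegral (continuous_gen_integrand N A)]
  simp only [star_smul, star_heis hN, hA.star_eq]
  simp

theorem commute_intervalIntegral {f : ℝ → 𝔸} (hf : Continuous f) (a b : ℝ) {E : 𝔸}
    (h : ∀ s, Commute (f s) E) : Commute (∫ s in a..b, f s) E := by
  have h1 := (commL E).intervalIntegral_comp_comm (hf.intervalIntegrable (μ := MeasureTheory.volume) a b)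
  have h2 : ∀ s, commL E (f s) = 0 := fun s => by rw [commL_apply, (h s).eq, sub_self]
  simp only [h2, integral_zero, commL_apply] at h1
  exact (sub_eq_zero.1 h1.symm).symm

theorem commute_avg_of_commute {N A E : 𝔸} (h : ∀ s, Commute (heis N s A) E) :
    Commute (avg N A) E :=
  (commute_intervalIntegral (continuous_heis N A) _ _ h).smul_left _

theorem commute_gen_of_commute {N A E : 𝔸} (h : ∀ s, Commute (heis N s A) E) :
    Commute (gen N A) E :=
  (commute_intervalIntegral (continuous_gen_integrand N A) _ _ fun s => (h s).smul_left _).smul_left _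

theorem heis_zero_op (H : 𝔸) (t : ℝ) : heis H t 0 = 0 := by simp [heis]

theorem avg_zero (N : 𝔸) : avg N 0 = 0 := by simp [avg, heis_zero_op]

theorem gen_zero (N : 𝔸) : gen N 0 = 0 := by simp [gen, heis_zero_op]

theorem heis_add_of_commute {H K A : 𝔸} (hHK : Commute H K) (hKA : Commute K A) (t : ℝ) :
    heis (H + K) t A = heis H t A := by
  let _ : NormedAlgebra ℚ 𝔸 := NormedAlgebra.restrictScalars ℚ ℂ 𝔸
  have h1 : ∀ c : ℂ, NormedSpace.exp (c • (H + K)) =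
      NormedSpace.exp (c • H) * NormedSpace.exp (c • K) := fun c => by
    rw [smul_add, NormedSpace.exp_add_of_commute ((hHK.smul_left c).smul_right c)]
  have h2 : Commute (NormedSpace.exp ((I * t) • H)) (NormedSpace.exp (-(I * t) • K)) :=
    (commute_exp_smul (commute_exp_smul hHK.symm _).symm _)
  have h3 : NormedSpace.exp (-(I * t) • (H + K)) =
      NormedSpace.exp (-(I * t) • K) * NormedSpace.exp (-(I * t) • H) := by
    rw [h1]
    exact commute_exp_smul (commute_exp_smul hHK.symm _).symm _
  rw [heis, heis, h1, h3]
  have h4 := (commute_exp_smul hKA (I * t)).eq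
  have h5 := exp_mul_exp_neg K t
  calc _ = NormedSpace.exp ((I * t) • H) * (NormedSpace.exp ((I * t) • K) * A) *
        NormedSpace.exp (-(I * t) • K) * NormedSpace.exp (-(I * t) • H) := by
        simp only [mul_assoc]
    _ = NormedSpace.exp ((I * t) • H) * A * (NormedSpace.exp ((I * t) • K) *
        NormedSpace.exp (-(I * t) • K)) * NormedSpace.exp (-(I * t) • H) := by
        rw [h4]; simp only [mul_assoc]
    _ = _ := by rw [h5, mul_one]

end Average

/-! ### Averages and generators for families of local terms. -/

section AverageFamily

variable {d L q : ℕ}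

namespace LocFam

/-- Only the sets with one element contribute. -/
def OnSite (N : LocFam d L q) : Prop := ∀ S, S.card ≠ 1 → N.term S = 0

/-- The evolution generated by on-site terms does not enlarge supports. -/
theorem OnSite.supportedOn_heis {N : LocFam d L q} (hN : N.OnSite) {S : Finset (Site d L)}
    {A : Op d L q} (hA : SupportedOn S A) (t : ℝ) : SupportedOn S (heis (op N) t A) := by
  -- One-site terms never straddle the boundary of `S`, so `N` splits into a part inside `S` and a
  -- part outside that commutes with it and with `A`.
  have e : op N = (∑ T : Finset (Site d L) with T ⊆ S, N.term T) +
      ∑ T : Finset (Site d L) with ¬ T ⊆ S, N.term T := by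
    rw [Finset.sum_filter_add_sum_filter_not, op_apply]
  have h1 : SupportedOn S (∑ T : Finset (Site d L) with T ⊆ S, N.term T) :=
    SupportedOn.sum fun T hT => (N.supported T).mono (Finset.mem_filter.1 hT).2
  have h2 : SupportedOn Sᶜ (∑ T : Finset (Site d L) with ¬ T ⊆ S, N.term T) := by
    refine SupportedOn.sum fun T hT => ?_
    by_cases hc : T.card = 1
    · obtain ⟨x, rfl⟩ := Finset.card_eq_one.1 hc
      refine (N.supported {x}).mono ?_
      have := (Finset.mem_filter.1 hT).2
      simpa using this
    · rw [hN T hc]; exact supportedOn_zero _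
  rw [e, heis_add_of_commute (h1.commute h2 disjoint_compl_right)
    (h2.commute hA disjoint_compl_left)]
  exact h1.heis hA t

/-- The average of a family of local terms. -/
def avgF (N : LocFam d L q) (hN : N.OnSite) (V : LocFam d L q) : LocFam d L q :=
  mk (fun S => avg (op N) (V.term S)) fun S =>
    ⟨supportedOn_iff.2 fun _ hx i j => commute_avg_of_commute fun s =>
      (hN.supportedOn_heis (V.supported S) s).commute_siteUnit hx i j,
    fun h => by rw [V.term_eq_zero h, avg_zero]⟩

/-- The generator of the transformation that removes `V - ⟨V⟩` to first order. -/
def genF (N : LocFam d L q) (hN : N.OnSite) (V : LocFam d L q) : LocFam d L q :=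
  mk (fun S => gen (op N) (V.term S)) fun S =>
    ⟨supportedOn_iff.2 fun _ hx i j => commute_gen_of_commute fun s =>
      (hN.supportedOn_heis (V.supported S) s).commute_siteUnit hx i j,
    fun h => by rw [V.term_eq_zero h, gen_zero]⟩

variable {N V : LocFam d L q} (hN : N.OnSite)

theorem selfAdj_avgF (hsa : N.SelfAdj) (hV : V.SelfAdj) : (avgF N hN V).SelfAdj := fun S =>
  isSelfAdjoint_avg hsa.op (hV S)

theorem selfAdj_genF (hsa : N.SelfAdj) (hV : V.SelfAdj) : (genF N hN V).SelfAdj := fun S =>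
  isSelfAdjoint_gen hsa.op (hV S)

theorem nrm_avgF_le (hsa : N.SelfAdj) (μ : ℝ) : nrm μ (avgF N hN V) ≤ nrm μ V := by
  have := nrm_le_of_norm_le (μ := μ) (ν := μ) (A := avgF N hN V) (B := V) zero_le_one fun S => by
    rw [one_mul]
    gcongr
    exact norm_avg_le hsa.op _
  simpa using this

theorem nrm_genF_le (hsa : N.SelfAdj) (μ : ℝ) : nrm μ (genF N hN V) ≤ Real.pi * nrm μ V :=
  nrm_le_of_norm_le Real.pi_pos.le fun S => by
    rw [← mul_assoc]
    gcongr
    exact norm_gen_le hsa.op _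

theorem commute_op_avgF (hper : ∀ A, heis (op N) (2 * Real.pi) A = A) :
    op N * op (avgF N hN V) - op (avgF N hN V) * op N = 0 := by
  rw [op_apply (avgF N hN V), Finset.mul_sum, Finset.sum_mul, ← Finset.sum_sub_distrib]
  exact Finset.sum_eq_zero fun S _ => commute_avg (hper _)

/-- The homological equation for whole families; it can be solved term by term thanks to
`br_onSite_term`. -/
theorem adI_genF (hper : ∀ A, heis (op N) (2 * Real.pi) A = A) :
    adI (genF N hN V) N = avgF N hN V - V := by
  apply ext
  intro S
  have h := I_smul_commutator_gen (hper (V.term S))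
  rw [adI_apply, term_smul, br_onSite_term hN, term_sub]
  change Complex.I • (gen (op N) (V.term S) * op N - op N * gen (op N) (V.term S)) =
    avg (op N) (V.term S) - V.term S
  rw [← neg_sub (V.term S), ← h, ← smul_neg, neg_sub]

end LocFam

end AverageFamily

/-! ### The normal form iteration. -/

section NormalForm

variable {d L q : ℕ}

open LocFam

/-- The Hamiltonian `H` is unitarily conjugated to `N + Z + V`, where `Z` commutes with `N` and `V`
is small after `k` steps, each of which costs `δ` in the weight of the local norm. The map `back`
takes local terms in the rotated frame back to local terms in the original frame. -/
structure NormalForm (N : LocFam d L q) (H : Op d L q) (κ δ p : ℝ) (k : ℕ) where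
  Z : LocFam d L q
  V : LocFam d L q
  back : LocFam d L q →ₗ[ℂ] LocFam d L q
  U : Op d L q
  selfAdj_Z : Z.SelfAdj
  selfAdj_V : V.SelfAdj
  selfAdj_back : ∀ B : LocFam d L q, B.SelfAdj → (back B).SelfAdj
  unitary_U : U ∈ unitary (Op d L q)
  op_back : ∀ B, op (back B) = star U * op B * U
  op_back_add : op (back (N + Z + V)) = H
  commute_Z : op N * op Z - op Z * op N = 0
  -- The geometric sum of `(1/8)^j` over `j < k`: each step adds an average no larger than the
  -- current `V`.
  nrm_Z : nrm (κ - k * δ) Z ≤ p * (8 / 7 * (1 - (1 / 8) ^ k))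
  nrm_V : nrm (κ - k * δ) V ≤ p * (1 / 8) ^ k
  -- The factor `2 - (1/2)^k` bounds the product of the single-step losses. The cap `3κ/4` is a
  -- weight at which all generators are controlled.
  nrm_back : ∀ ν, k * δ ≤ ν → ν ≤ 3 * κ / 4 → ∀ B,
    nrm (ν - k * δ) (back B) ≤ (2 - (1 / 2) ^ k) * nrm ν B
  norm_back_sub : ‖op (back N) - op N‖ ≤ Fintype.card (Site d L) *
    ((8 / 7) * (2 * (Real.exp (-(3 * κ / 4)) * (Real.pi * p)) * (Real.exp (-κ) * nrm κ N)) *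
      (1 - (1 / 8) ^ k))

/-- The starting point of the iteration. -/
def NormalForm.zero (N P : LocFam d L q) (hP : P.SelfAdj) {κ δ p : ℝ} (hp : nrm κ P ≤ p) :
    NormalForm N (op N + op P) κ δ p 0 where
  Z := 0
  V := P
  back := LinearMap.id
  U := 1
  selfAdj_Z := selfAdj_zero
  selfAdj_V := hP
  selfAdj_back _ h := h
  unitary_U := one_mem _
  op_back B := by simp
  op_back_add := by simp
  commute_Z := by simp
  nrm_Z := by simp
  nrm_V := by simpa using hp
  nrm_back ν _ _ B := by norm_num
  norm_back_sub := by simp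

theorem conj_unitary_norm {U : Op d L q} (hU : U ∈ unitary (Op d L q)) (A : Op d L q) :
    ‖star U * A * U‖ = ‖A‖ := by
  rw [CStarRing.norm_mul_mem_unitary _ hU,
    CStarRing.norm_mem_unitary_mul _ (Unitary.star_mem hU)]

/-- Fixes the contraction rate: `x + y ≤ 3p` and `(r/25)(25/24)(3p) = pr/8`. Here `x` stands for the
norm of `Z + V` and `y` for that of `⟨V⟩ - V`. -/
theorem remainder_le {θ r p x y : ℝ} (hθ : θ ≤ r / 25) (hr0 : 0 ≤ r) (hr : r ≤ 1)
    (hp : 0 ≤ p) (hx0 : 0 ≤ x) (hy0 : 0 ≤ y) (hx : x ≤ p * (8 / 7 * (1 - r)) + p * r)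
    (hy : y ≤ 2 * (p * r)) :
    θ * (1 - θ)⁻¹ * x + θ * (1 - θ)⁻¹ * y ≤ p * (r / 8) := by
  have hinv : (1 - θ)⁻¹ ≤ 25 / 24 := by
    rw [inv_le_comm₀ (by linarith) (by norm_num)]
    linarith
  have hxy : x + y ≤ 3 * p := by
    nlinarith [mul_nonneg hp hr0, mul_nonneg hp (sub_nonneg.2 hr)]
  calc θ * (1 - θ)⁻¹ * x + θ * (1 - θ)⁻¹ * y = θ * (1 - θ)⁻¹ * (x + y) := by ring
    _ ≤ (r / 25) * (25 / 24) * (3 * p) := by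
        have : 0 ≤ (1 - θ)⁻¹ := inv_nonneg.2 (by linarith)
        gcongr
    _ = _ := by ring

theorem back_factor_le {θ c : ℝ} (hθ0 : 0 ≤ θ) (hθ : θ ≤ c / 25) (hc : c ≤ 1) :
    (2 - c) * (1 - θ)⁻¹ ≤ 2 - c / 2 := by
  rw [← div_eq_mul_inv, div_le_iff₀ (by linarith)]
  nlinarith

theorem deviation_le {M E m g p r x y : ℝ} (hM : 0 ≤ M) (hE : 0 ≤ E) (hm : 0 ≤ m)
    (hg : g ≤ Real.pi * p * r) (hx : x ≤ M * (2 * (E * g) * m))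
    (hy : y ≤ M * ((8 / 7) * (2 * (E * (Real.pi * p)) * m) * (1 - r))) :
    x + y ≤ M * ((8 / 7) * (2 * (E * (Real.pi * p)) * m) * (1 - r / 8)) := by
  have h : M * (2 * (E * g) * m) ≤ M * (2 * (E * (Real.pi * p * r)) * m) := by gcongr
  linarith


/-- One conjugation by the generator of `V`; the average of `V` moves into `Z`, and the new `V` is
the remainder of the rotated Hamiltonian. -/
theorem NormalForm.step {N : LocFam d L q} (hN : N.OnSite) (hsa : N.SelfAdj)
    (hper : ∀ A, heis (op N) (2 * Real.pi) A = A) {H : Op d L q} {κ δ p : ℝ} {k : ℕ}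
    (hκ : 0 < κ) (hδ : 0 < δ) (hp : 0 ≤ p) (hk : (k + 1) * δ ≤ κ / 4)
    (hsmall : 4 * Real.pi * p / δ ≤ 1 / 25) (F : NormalForm N H κ δ p k) :
    Nonempty (NormalForm N H κ δ p (k + 1)) := by
  obtain ⟨Z, V, back, U, hZ, hV, hback, hU, hopb, hH, hcom, hnZ, hnV, hnb, hnsub⟩ := F
  set r : ℝ := (1 / 8) ^ k with hr
  have hr0 : 0 < r := by positivity
  have hr1 : r ≤ 1 := pow_le_one₀ (by norm_num) (by norm_num)
  have hrs : (1 / 8 : ℝ) ^ (k + 1) = r / 8 := by rw [pow_succ]; ring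
  set G := genF N hN V with hGdef
  set Y := avgF N hN V with hYdef
  have hGsa : G.SelfAdj := selfAdj_genF hN hsa hV
  have hYsa : Y.SelfAdj := selfAdj_avgF hN hsa hV
  set μ := κ - k * δ with hμ
  set a := Real.pi * (p * r) with ha
  have ha0 : 0 ≤ a := by positivity
  have hG : nrm μ G ≤ a := (nrm_genF_le hN hsa μ).trans
    (mul_le_mul_of_nonneg_left hnV Real.pi_pos.le)
  set θ := 4 * a / δ with hθdef
  have hθ0 : 0 ≤ θ := by positivity
  have hθr : θ ≤ r / 25 := by
    have : θ = (4 * Real.pi * p / δ) * r := by rw [hθdef, ha]; ring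
    rw [this]
    calc _ ≤ 1 / 25 * r := by gcongr
      _ = _ := by ring
  have hθ1 : θ ≤ 1 / 25 := by linarith
  have hθlt : 4 * a / δ < 1 := by rw [← hθdef]; linarith
  have hkδ : 0 ≤ k * δ := by positivity
  have hδμ : δ ≤ μ := by rw [hμ]; linarith
  have hμδ : κ - ((k + 1 : ℕ) : ℝ) * δ = μ - δ := by rw [hμ]; push_cast; ring
  have h34 : 3 * κ / 4 ≤ μ := by rw [hμ]; linarith
  have hopneg : op (-G) = -op G := map_neg _ _
  -- The two flows are inverse to each other as operators, which is all that a normal form records.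
  have hflow : ∀ B, op (flow (-G) (flow G B)) = op B := fun B => by
    rw [op_flow, op_flow, hopneg, heis_neg, heis_neg_heis]
  set V' := flow G (N + Z + V) - N - (Z + Y) with hV'
  have hadI : adI G N = Y - V := adI_genF hN hper
  -- The first-order change of `N` is `Y - V`, which cancels `V` against `Y`; what remains is first
  -- order on `Z + V` and second order on `N`.
  have hV'eq : V' = (flow G (Z + V) - (Z + V)) + (flow G N - N - adI G N) := by
    rw [hadI, hV', add_assoc N Z V, map_add]
    abel
  have hZnn := nrm_nonneg μ Z
  have hVnn := nrm_nonneg μ V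
  have hnV' : nrm (μ - δ) V' ≤ p * (1 / 8) ^ (k + 1) := by
    rw [hV'eq]
    have h1 := nrm_flow_sub_le hδ hδμ hG hθlt (Z + V)
    have h2 := nrm_flow_sub_sub_le hδ hδμ hG hθlt N
    rw [hadI] at h2
    have h3 : nrm μ (Y - V) ≤ 2 * (p * r) := by
      have := nrm_sub_le μ Y V
      have := nrm_avgF_le hN (V := V) hsa μ
      linarith
    have h4 : nrm μ (Z + V) ≤ p * (8 / 7 * (1 - r)) + p * r :=
      (nrm_add_le _ _ _).trans (add_le_add hnZ hnV)
    rw [← hθdef] at h1 h2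
    rw [hadI]
    rw [hrs]
    exact ((nrm_add_le _ _ _).trans (add_le_add h1 h2)).trans
      (remainder_le hθr hr0.le hr1 hp (nrm_nonneg _ _) (nrm_nonneg _ _) h4 h3)
  have hZ' : (Z + Y).SelfAdj := hZ.add hYsa
  have hUG : NormedSpace.exp ((Complex.I * (1 : ℝ)) • op G) ∈ unitary (Op d L q) :=
    exp_mem_unitary hGsa.op 1
  set E : Op d L q := NormedSpace.exp ((Complex.I * (1 : ℝ)) • op G) with hE
  refine ⟨{
    Z := Z + Y
    V := V'
    back := back.comp (flow (-G)).toLinearMap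
    U := E * U
    selfAdj_Z := hZ'
    selfAdj_V := ?_
    selfAdj_back := ?_
    unitary_U := ?_
    op_back := ?_
    op_back_add := ?_
    commute_Z := ?_
    nrm_Z := ?_
    nrm_V := ?_
    nrm_back := ?_
    norm_back_sub := ?_ }⟩
  · exact (((hGsa.flow ((hsa.add hZ).add hV))).sub hsa).sub (hZ.add hYsa)
  · intro B hB
    exact hback _ (hGsa.neg.flow hB)
  · exact mul_mem hUG hU
  · intro B
    change op (back (flow (-G) B)) = _
    rw [hopb, op_flow, hopneg, heis_neg, star_mul, hE, star_exp_smul hGsa.op]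
    simp only [heis, Complex.ofReal_neg, mul_neg, neg_neg, mul_assoc]
  · change op (back (flow (-G) (N + (Z + Y) + V'))) = H
    have e : N + (Z + Y) + V' = flow G (N + Z + V) := by rw [hV']; abel
    rw [e, hopb, hflow, ← hopb, hH]
  · rw [map_add]
    have h1 := commute_op_avgF hN (V := V) hper
    rw [← hYdef] at h1
    calc _ = (op N * op Z - op Z * op N) + (op N * op Y - op Y * op N) := by noncomm_ring
      _ = 0 := by rw [hcom, h1, add_zero]
  · rw [hμδ]
    calc _ ≤ nrm μ (Z + Y) := nrm_mono (by linarith) _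
      _ ≤ p * (8 / 7 * (1 - r)) + p * r := (nrm_add_le _ _ _).trans
          (add_le_add hnZ ((nrm_avgF_le hN hsa μ).trans hnV))
      _ = _ := by rw [hrs]; ring
  · rw [hμδ]; exact hnV'
  · intro ν hν hν' B
    push_cast at hν ⊢
    have hGν : nrm ν (-G) ≤ a := by
      rw [nrm_neg]; exact (nrm_mono (hν'.trans h34) G).trans hG
    have h1 := nrm_flow_le hδ (by linarith) hGν hθlt B
    have h2 := hnb (ν - δ) (by linarith) (by linarith) (flow (-G) B)
    rw [← hθdef] at h1
    set c : ℝ := (1 / 2) ^ k with hc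
    have hc0 : 0 < c := by positivity
    have hc1 : c ≤ 1 := pow_le_one₀ (by norm_num) (by norm_num)
    have hrc : r ≤ c := pow_le_pow_left₀ (by norm_num) (by norm_num) k
    have hcs : (1 / 2 : ℝ) ^ (k + 1) = c / 2 := by rw [pow_succ]; ring
    have hB := nrm_nonneg ν B
    rw [show ν - (k + 1) * δ = ν - δ - k * δ by ring, hcs]
    calc _ ≤ (2 - c) * nrm (ν - δ) (flow (-G) B) := h2
      _ ≤ (2 - c) * ((1 - θ)⁻¹ * nrm ν B) := by
          have : 0 ≤ 2 - c := by linarith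
          gcongr
      _ = ((2 - c) * (1 - θ)⁻¹) * nrm ν B := by ring
      _ ≤ (2 - c / 2) * nrm ν B :=
          mul_le_mul_of_nonneg_right (back_factor_le hθ0 (by linarith) hc1) hB
  · change ‖op (back (flow (-G) N)) - op N‖ ≤ _
    -- The deviation telescopes, and `U` is unitary, so the steps contribute a geometric series.
    have e : op (back (flow (-G) N)) - op N =
        star U * (heis (-op G) 1 (op N) - op N) * U + (op (back N) - op N) := by
      rw [hopb, hopb, op_flow, hopneg]
      noncomm_ring
    have h1 := norm_heis_sub_le (hGsa.op.neg) 1 (op N)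
    have h2 := norm_op_commutator_le (μ := 3 * κ / 4) (ν := κ) (by positivity) hκ.le (-G) N
    rw [hopneg, nrm_neg] at h2
    have h3 : nrm (3 * κ / 4) G ≤ Real.pi * p * r := by
      have := (nrm_mono h34 G).trans hG
      rw [ha] at this
      linarith
    rw [abs_one, one_mul] at h1
    calc _ ≤ ‖heis (-op G) 1 (op N) - op N‖ + ‖op (back N) - op N‖ := by
          rw [e]
          refine (norm_add_le _ _).trans ?_
          rw [conj_unitary_norm hU]
      _ ≤ _ := by
          rw [hrs]
          exact deviation_le (Nat.cast_nonneg _) (Real.exp_pos _).le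
            (mul_nonneg (Real.exp_pos _).le (nrm_nonneg κ N)) h3 (h1.trans h2) hnsub

theorem NormalForm.exists {N P : LocFam d L q} (hN : N.OnSite) (hsa : N.SelfAdj) (hP : P.SelfAdj)
    (hper : ∀ A, heis (op N) (2 * Real.pi) A = A) {κ δ p : ℝ} (hκ : 0 < κ) (hδ : 0 < δ)
    (hp : nrm κ P ≤ p) (hsmall : 4 * Real.pi * p / δ ≤ 1 / 25) (n : ℕ) (hn : n * δ ≤ κ / 4) :
    Nonempty (NormalForm N (op N + op P) κ δ p n) := by
  induction n with
  | zero => exact ⟨NormalForm.zero N P hP hp⟩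
  | succ n ih =>
    push_cast at hn
    obtain ⟨F⟩ := ih (by linarith)
    exact F.step hN hsa hper hκ hδ ((nrm_nonneg _ _).trans hp) hn hsmall

end NormalForm

/-! ### Lieb–Robinson bound by bootstrapping. -/

section LiebRobinson

variable {d L q : ℕ}

open LocFam

/-- Exponentially decaying weight around `S`. -/
def decay (μ : ℝ) (S : Finset (Site d L)) (x : Site d L) : ℝ :=
  ∑ y ∈ S, Real.exp (-μ * dist x y)

theorem decay_pos {μ : ℝ} {S : Finset (Site d L)} (hS : S.Nonempty) (x : Site d L) :
    0 < decay μ S x := Finset.sum_pos (fun _ _ => Real.exp_pos _) hS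

theorem decay_nonneg (μ : ℝ) (S : Finset (Site d L)) (x : Site d L) : 0 ≤ decay μ S x :=
  Finset.sum_nonneg fun _ _ => (Real.exp_pos _).le

theorem one_le_decay {μ : ℝ} {S : Finset (Site d L)} {x : Site d L} (hx : x ∈ S) :
    1 ≤ decay μ S x := by
  refine le_trans ?_ (Finset.single_le_sum (f := fun y => Real.exp (-μ * dist x y))
    (fun _ _ => (Real.exp_pos _).le) hx)
  simp

/-- The triangle inequality with diameter at most `|X|`. At `μ = κ/2` the local norm absorbs the
exponential and keeps `κ/2` for a factor `|X|`. -/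
theorem decay_le_of_isConn {μ : ℝ} (hμ : 0 ≤ μ) (S : Finset (Site d L)) {X : Finset (Site d L)}
    (hX : IsConn X) {x y : Site d L} (hx : x ∈ X) (hy : y ∈ X) :
    decay μ S x ≤ Real.exp (μ * X.card) * decay μ S y := by
  rw [decay, decay, Finset.mul_sum]
  refine Finset.sum_le_sum fun z _ => ?_
  rw [← Real.exp_add, Real.exp_le_exp]
  have h1 := dist_triangle y x z
  have h2 := hX.dist_le hy hx
  nlinarith

/-- Sum over the terms that meet `Y`, in terms of the weights. -/
theorem sum_norm_mul_decay_le {κ J : ℝ} (hκ : 0 < κ) (S Y : Finset (Site d L)) {h : LocFam d L q}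
    (hJ : nrm κ h ≤ J) :
    ∑ X, (if Disjoint Y X then 0 else ‖h.term X‖ * ∑ x ∈ X, decay (κ / 2) S x) ≤
      J / κ * ∑ y ∈ Y, decay (κ / 2) S y := by
  have hJ0 : 0 ≤ J := (nrm_nonneg _ _).trans hJ
  refine (sum_not_disjoint_le Y fun X => mul_nonneg (norm_nonneg _)
    (Finset.sum_nonneg fun x _ => decay_nonneg _ _ _)).trans ?_
  rw [Finset.mul_sum]
  refine Finset.sum_le_sum fun y _ => ?_
  have hdy := decay_nonneg (κ / 2) S y
  calc _ ≤ ∑ X : Finset (Site d L) with y ∈ X,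
        (X.card * (‖h.term X‖ * Real.exp ((κ - κ / 2) * X.card))) * decay (κ / 2) S y := by
        refine Finset.sum_le_sum fun X hX => ?_
        have hyX := (Finset.mem_filter.1 hX).2
        by_cases hc : IsConn X
        · have : ∑ x ∈ X, decay (κ / 2) S x ≤
              X.card * (Real.exp (κ / 2 * X.card) * decay (κ / 2) S y) := by
            rw [← nsmul_eq_mul, ← Finset.sum_const]
            exact Finset.sum_le_sum fun x hx => decay_le_of_isConn (by positivity) S hc hx hyX
          calc _ ≤ ‖h.term X‖ * (X.card * (Real.exp (κ / 2 * X.card) * decay (κ / 2) S y)) := by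
                gcongr
            _ = _ := by rw [show κ - κ / 2 = κ / 2 by ring]; ring
        · simp [h.term_eq_zero hc]
    _ ≤ (1 / (Real.exp 1 * (κ / 2)) * nrm κ h) * decay (κ / 2) S y := by
        rw [← Finset.sum_mul]
        gcongr
        exact sum_card_mul_siteNorm_le (by positivity) h y
    _ ≤ J / κ * decay (κ / 2) S y := by
        have he : 2 ≤ Real.exp 1 := by
          have := Real.add_one_le_exp (1 : ℝ)
          linarith
        have hle : 1 / (Real.exp 1 * (κ / 2)) ≤ 1 / κ := by
          apply one_div_le_one_div_of_le hκ
          nlinarith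
        calc _ ≤ (1 / κ * J) * decay (κ / 2) S y := by
              have := nrm_nonneg κ h
              gcongr
          _ = _ := by ring

/-- The bound on commutators with local observables at nonnegative times, with constant `M`. -/
def CommutatorBound (κ lam : ℝ) (H O : Op d L q) (S : Finset (Site d L)) (M : ℝ) : Prop :=
  ∀ t : ℝ, 0 ≤ t → ∀ Y : Finset (Site d L), Y.Nonempty → ∀ B : Op d L q, SupportedOn Y B →
    ‖heis H t O * B - B * heis H t O‖ ≤
      M * (‖B‖ * Real.exp (lam * t) * ∑ y ∈ Y, decay (κ / 2) S y)

theorem CommutatorBound.mono {κ lam : ℝ} {H O : Op d L q} {S : Finset (Site d L)} {M M' : ℝ}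
    (hb : CommutatorBound κ lam H O S M) (h : M ≤ M') : CommutatorBound κ lam H O S M' :=
  fun t ht Y hY B hB => (hb t ht Y hY B hB).trans (mul_le_mul_of_nonneg_right h
    (mul_nonneg (mul_nonneg (norm_nonneg _) (Real.exp_pos _).le)
      (Finset.sum_nonneg fun _ _ => decay_nonneg _ _ _)))

theorem hasDerivAt_commutator {𝔸 : Type*} [CStarAlgebra 𝔸] {H O B R : 𝔸} (hRB : Commute (H - R) B)
    (s : ℝ) :
    HasDerivAt (fun s => heis (-(H - R)) s (heis H s O * B - B * heis H s O))
      (heis (-(H - R)) s (Complex.I • ((R * heis H s O - heis H s O * R) * B -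
        B * (R * heis H s O - heis H s O * R)))) s := by
  have h1 := hasDerivAt_heis_const' H O s
  have h2 := (h1.mul_const B).sub (h1.const_mul B)
  refine (hasDerivAt_heis (-(H - R)) h2).congr_deriv ?_
  congr 1
  have e : (H - R) * B = B * (H - R) := hRB
  simp only [Pi.sub_apply]
  generalize heis H s O = X at *
  rw [smul_mul_assoc, mul_smul_comm, ← smul_sub, ← smul_add]
  congr 1
  have e1 : X * ((H - R) * B) = X * (B * (H - R)) := by rw [e]
  have e2 : ((H - R) * B) * X = (B * (H - R)) * X := by rw [e]
  have e3 : H = (H - R) + R := by abel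
  generalize H - R = K at *
  subst e3
  have : -K * (X * B - B * X) - (X * B - B * X) * -K +
      (((K + R) * X - X * (K + R)) * B - B * ((K + R) * X - X * (K + R))) -
      ((R * X - X * R) * B - B * (R * X - X * R)) =
      (K * B) * X - (B * K) * X + X * (B * K) - X * (K * B) := by noncomm_ring
  rw [← sub_eq_zero, this, e1, e2]
  abel

/-- Let `R` collect the terms of `h` that meet `Y`, so that `h - R` commutes with `B`. In the frame
of `h - R` only `[[R, O(s)], B]` drives the commutator, and the assumed bound applies to each term
of `R`. The rate `4J/κ` is twice the resulting `2J/κ`, so integration halves `M`. Initially the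
commutator vanishes unless `S` meets `Y`, where the weight is at least 1; this gives `2‖O‖`. -/
theorem CommutatorBound.improve {κ J : ℝ} (hκ : 0 < κ) {h : LocFam d L q} (hsa : h.SelfAdj)
    (hJ : nrm κ h ≤ J) {O : Op d L q} {S : Finset (Site d L)} (hO : SupportedOn S O) {M : ℝ}
    (hM : 0 ≤ M) (hb : CommutatorBound κ (4 * J / κ) (op h) O S M) :
    CommutatorBound κ (4 * J / κ) (op h) O S (2 * ‖O‖ + M / 2) := by
  intro t ht Y hY B hB
  set w := ∑ y ∈ Y, decay (κ / 2) S y with hw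
  have hw0 : 0 ≤ w := Finset.sum_nonneg fun y _ => decay_nonneg _ _ _
  set lam := 4 * J / κ with hlam
  have hJ0 : 0 ≤ J := (nrm_nonneg _ _).trans hJ
  have hlam0 : 0 ≤ lam := by positivity
  set R : Op d L q := ∑ X, if Disjoint Y X then 0 else h.term X with hR
  have hKeq : op h - R = ∑ X, if Disjoint Y X then h.term X else 0 := by
    rw [hR, op_apply, ← Finset.sum_sub_distrib]
    refine Finset.sum_congr rfl fun X _ => ?_
    split_ifs <;> simp
  have hKB : Commute (op h - R) B := by
    rw [hKeq]
    refine Commute.sum_left _ _ _ fun X _ => ?_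
    split_ifs with hd
    · exact (h.supported X).commute hB hd.symm
    · exact Commute.zero_left _
  have hKsa : IsSelfAdjoint (-(op h - R)) := by
    refine IsSelfAdjoint.neg ?_
    rw [hKeq, isSelfAdjoint_iff, star_sum]
    refine Finset.sum_congr rfl fun X _ => ?_
    split_ifs
    · exact (hsa X).star_eq
    · simp
  have hRO : ∀ s, 0 ≤ s → ‖R * heis (op h) s O - heis (op h) s O * R‖ ≤
      M * Real.exp (lam * s) * (J / κ * w) := by
    intro s hs
    calc _ ≤ ∑ X, M * Real.exp (lam * s) *
          (if Disjoint Y X then 0 else ‖h.term X‖ * ∑ x ∈ X, decay (κ / 2) S x) := by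
          rw [hR, Finset.sum_mul, Finset.mul_sum, ← Finset.sum_sub_distrib]
          refine (norm_sum_le _ _).trans (Finset.sum_le_sum fun X _ => ?_)
          split_ifs with hd
          · simp
          · by_cases hc : IsConn X
            · rw [norm_sub_rev]
              exact (hb s hs X hc.nonempty _ (h.supported X)).trans_eq (by ring)
            · simp [h.term_eq_zero hc]
      _ ≤ _ := by
          rw [← Finset.mul_sum]
          gcongr
          exact sum_norm_mul_decay_le hκ S Y hJ
  have h0 : ‖heis (-(op h - R)) 0 (heis (op h) 0 O * B - B * heis (op h) 0 O)‖ ≤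
      ‖B‖ * w * (2 * ‖O‖ + M / 2 * Real.exp (lam * 0)) := by
    simp only [heis_zero_time, mul_zero, Real.exp_zero, mul_one]
    by_cases hd : Disjoint S Y
    · rw [(hO.commute hB hd).eq, sub_self, norm_zero]
      positivity
    · obtain ⟨y, hyS, hyY⟩ := Finset.not_disjoint_iff.1 hd
      have hw1 : 1 ≤ w := (one_le_decay (μ := κ / 2) hyS).trans
        (Finset.single_le_sum (f := fun y => decay (κ / 2) S y)
          (fun y _ => decay_nonneg _ _ _) hyY)
      calc _ ≤ 2 * (‖O‖ * ‖B‖) := norm_commutator_le _ _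
        _ = ‖B‖ * 1 * (2 * ‖O‖ + 0) := by ring
        _ ≤ _ := by gcongr; positivity
  have hβ : ∀ s : ℝ, HasDerivAt (fun s => ‖B‖ * w * (2 * ‖O‖ + M / 2 * Real.exp (lam * s)))
      (‖B‖ * w * (M / 2 * (Real.exp (lam * s) * lam))) s := by
    intro s
    have h1 : HasDerivAt (fun s => lam * s) lam s := by simpa using (hasDerivAt_id s).const_mul lam
    exact ((h1.exp.const_mul (M / 2)).const_add (2 * ‖O‖)).const_mul (‖B‖ * w)
  have key := image_norm_le_of_norm_deriv_right_le_deriv_boundary (a := 0) (b := t)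
    (f := fun s => heis (-(op h - R)) s (heis (op h) s O * B - B * heis (op h) s O))
    (fun s _ => (hasDerivAt_commutator hKB s).continuousAt.continuousWithinAt)
    (fun s _ => (hasDerivAt_commutator hKB s).hasDerivWithinAt) h0 hβ
    (fun s hs => by
      rw [norm_heis hKsa, norm_smul, Complex.norm_I, one_mul]
      calc _ ≤ 2 * (‖R * heis (op h) s O - heis (op h) s O * R‖ * ‖B‖) := norm_commutator_le _ _
        _ ≤ 2 * ((M * Real.exp (lam * s) * (J / κ * w)) * ‖B‖) := by
            gcongr
            exact hRO s hs.1
        _ = _ := by rw [hlam]; field_simp; ring)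
    ⟨ht, le_rfl⟩
  rw [norm_heis hKsa] at key
  refine key.trans ?_
  have hexp : 1 ≤ Real.exp (lam * t) := Real.one_le_exp (by positivity)
  have hO1 : 2 * ‖O‖ ≤ 2 * ‖O‖ * Real.exp (lam * t) := le_mul_of_one_le_right (by positivity) hexp
  calc ‖B‖ * w * (2 * ‖O‖ + M / 2 * Real.exp (lam * t))
      ≤ ‖B‖ * w * (2 * ‖O‖ * Real.exp (lam * t) + M / 2 * Real.exp (lam * t)) := by
        gcongr
    _ = _ := by ring

/-- Lieb–Robinson bound. -/
theorem lieb_robinson {κ J : ℝ} (hκ : 0 < κ) {h : LocFam d L q} (hsa : h.SelfAdj)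
    (hJ : nrm κ h ≤ J) {O : Op d L q} {S : Finset (Site d L)} (hO : SupportedOn S O)
    (hS : S.Nonempty) : CommutatorBound κ (4 * J / κ) (op h) O S (4 * ‖O‖) := by
  have hJ0 : 0 ≤ J := (nrm_nonneg _ _).trans hJ
  -- On a finite box the decay weight has a positive minimum, so the trivial bound provides a
  -- starting constant; its dependence on the box disappears in the limit.
  obtain ⟨m, hm0, hm⟩ : ∃ m > 0, ∀ y, m ≤ decay (κ / 2) S y := by
    obtain ⟨x₀, hx₀⟩ := Finite.exists_min (decay (κ / 2) S)
    exact ⟨_, decay_pos hS x₀, hx₀⟩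
  have hstart : CommutatorBound κ (4 * J / κ) (op h) O S (2 * ‖O‖ / m) := by
    intro t ht Y hY B hB
    obtain ⟨y, hy⟩ := hY
    have hw : m ≤ ∑ y ∈ Y, decay (κ / 2) S y := (hm y).trans
      (Finset.single_le_sum (f := fun y => decay (κ / 2) S y) (fun y _ => decay_nonneg _ _ _) hy)
    have hexp : 1 ≤ Real.exp (4 * J / κ * t) := Real.one_le_exp (by positivity)
    calc _ ≤ 2 * (‖heis (op h) t O‖ * ‖B‖) := norm_commutator_le _ _
      _ = 2 * ‖O‖ / m * (‖B‖ * 1 * m) := by rw [norm_heis hsa.op]; field_simp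
      _ ≤ _ := by gcongr
  -- The map `M ↦ 2‖O‖ + M/2` contracts to its fixed point `4‖O‖`.
  have hiter : ∀ k : ℕ, CommutatorBound κ (4 * J / κ) (op h) O S
      (4 * ‖O‖ + (1 / 2) ^ k * (2 * ‖O‖ / m)) := by
    intro k
    induction k with
    | zero => exact hstart.mono (by simp only [pow_zero, one_mul]; linarith [norm_nonneg O])
    | succ k ih =>
      have := ih.improve hκ hsa hJ hO (by positivity)
      convert this using 1
      rw [pow_succ]
      ring
  intro t ht Y hY B hB
  set c := ‖B‖ * Real.exp (4 * J / κ * t) * ∑ y ∈ Y, decay (κ / 2) S y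
  have hlim : Filter.Tendsto (fun k : ℕ => (4 * ‖O‖ + (1 / 2 : ℝ) ^ k * (2 * ‖O‖ / m)) * c)
      Filter.atTop (nhds ((4 * ‖O‖ + 0 * (2 * ‖O‖ / m)) * c)) :=
    (((tendsto_pow_atTop_nhds_zero_of_lt_one (by norm_num) (by norm_num)).mul_const _).const_add
      _).mul_const _
  rw [zero_mul, add_zero] at hlim
  exact ge_of_tendsto' hlim fun k => hiter k t ht Y hY B hB

theorem min_one_sum_le {ι : Type*} (s : Finset ι) {f : ι → ℝ} (hf : ∀ i ∈ s, 0 ≤ f i) :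
    min 1 (∑ i ∈ s, f i) ≤ ∑ i ∈ s, min 1 (f i) := by
  by_cases h : ∃ i ∈ s, 1 ≤ f i
  · obtain ⟨i, hi, h1⟩ := h
    calc min 1 (∑ i ∈ s, f i) ≤ 1 := min_le_left _ _
      _ = min 1 (f i) := (min_eq_left h1).symm
      _ ≤ _ := Finset.single_le_sum (f := fun i => min 1 (f i))
        (fun j hj => le_min zero_le_one (hf j hj)) hi
  · push Not at h
    refine (min_le_right _ _).trans (Finset.sum_le_sum fun i hi => ?_)
    rw [min_eq_right (h i hi).le]

/-- The commutator of an extensive local operator with an evolved local observable. -/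
theorem norm_commutator_heis_le {κ J μ : ℝ} (hκ : 0 < κ) (hμ : 0 ≤ μ) {h W : LocFam d L q}
    (hsa : h.SelfAdj) (hJ : nrm κ h ≤ J) {O : Op d L q} {S : Finset (Site d L)}
    (hO : SupportedOn S O) (hS : S.Nonempty) {t : ℝ} (ht : 0 ≤ t) :
    ‖op W * heis (op h) t O - heis (op h) t O * op W‖ ≤
      4 * ‖O‖ * nrm μ W * ∑ y ∈ S, ∑ x, min 1 (Real.exp (4 * J / κ * t - κ / 2 * dist x y)) := by
  set a := 4 * J / κ * t with ha
  -- The cut-off at 1 is the trivial bound inside the light cone; without it the estimate would grow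
  -- exponentially in time.
  set g : Site d L → ℝ := fun x => min 1 (Real.exp a * decay (κ / 2) S x) with hg
  have hg0 : ∀ x, 0 ≤ g x := fun x =>
    le_min zero_le_one (mul_nonneg (Real.exp_pos _).le (decay_nonneg _ _ _))
  have hterm : ∀ X, ‖W.term X * heis (op h) t O - heis (op h) t O * W.term X‖ ≤
      4 * ‖O‖ * (‖W.term X‖ * ∑ x ∈ X, g x) := by
    intro X
    by_cases hc : IsConn X
    · have h1 : ‖W.term X * heis (op h) t O - heis (op h) t O * W.term X‖ ≤
          4 * ‖O‖ * (‖W.term X‖ * ∑ x ∈ X, Real.exp a * decay (κ / 2) S x) := by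
        rw [norm_sub_rev]
        refine (lieb_robinson hκ hsa hJ hO hS t ht X hc.nonempty _ (W.supported X)).trans_eq ?_
        rw [← Finset.mul_sum]
        ring
      have h2 : ‖W.term X * heis (op h) t O - heis (op h) t O * W.term X‖ ≤
          4 * ‖O‖ * (‖W.term X‖ * 1) := by
        refine (norm_commutator_le _ _).trans ?_
        rw [norm_heis hsa.op]
        nlinarith [mul_nonneg (norm_nonneg O) (norm_nonneg (W.term X))]
      calc _ ≤ 4 * ‖O‖ * (‖W.term X‖ * min 1 (∑ x ∈ X, Real.exp a * decay (κ / 2) S x)) := by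
            rcases min_choice 1 (∑ x ∈ X, Real.exp a * decay (κ / 2) S x) with e | e <;> rw [e]
            exacts [h2, h1]
        _ ≤ _ := by
            gcongr
            exact min_one_sum_le X fun x _ =>
              mul_nonneg (Real.exp_pos _).le (decay_nonneg _ _ _)
    · simp [W.term_eq_zero hc]
  have hsum : ∑ x, g x ≤ ∑ y ∈ S, ∑ x, min 1 (Real.exp (a - κ / 2 * dist x y)) := by
    rw [Finset.sum_comm]
    refine Finset.sum_le_sum fun x _ => ?_
    simp only [hg, decay, Finset.mul_sum, ← Real.exp_add]
    refine (min_one_sum_le S fun y _ => (Real.exp_pos _).le).trans_eq ?_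
    refine Finset.sum_congr rfl fun y _ => ?_
    congr 2
    ring
  have hW := nrm_nonneg μ W
  calc _ ≤ ∑ X, 4 * ‖O‖ * (‖W.term X‖ * ∑ x ∈ X, g x) := by
        rw [op_apply, Finset.sum_mul, Finset.mul_sum, ← Finset.sum_sub_distrib]
        exact (norm_sum_le _ _).trans (Finset.sum_le_sum fun X _ => hterm X)
    _ = 4 * ‖O‖ * ∑ x, g x * ∑ X : Finset (Site d L) with x ∈ X, ‖W.term X‖ := by
        rw [← Finset.mul_sum]
        congr 1
        simp_rw [Finset.mul_sum, Finset.sum_filter]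
        rw [Finset.sum_comm (s := Finset.univ (α := Site d L))]
        refine Finset.sum_congr rfl fun X _ => ?_
        rw [← Finset.sum_filter, Finset.filter_mem_eq_inter, Finset.univ_inter]
        exact Finset.sum_congr rfl fun x _ => mul_comm _ _
    _ ≤ 4 * ‖O‖ * ∑ x, g x * nrm μ W := by
        gcongr with x
        · exact hg0 x
        · refine (sum_filter_norm_le hμ W x).trans (mul_le_of_le_one_left hW ?_)
          simpa using hμ
    _ = 4 * ‖O‖ * nrm μ W * ∑ x, g x := by rw [← Finset.sum_mul]; ring
    _ ≤ _ := by gcongr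

end LiebRobinson

/-! ### Counting the sites of a light cone. -/

section Counting

theorem summable_exp_neg_abs {lam : ℝ} (hl : 0 < lam) :
    Summable fun m : ℤ => Real.exp (-lam * |(m : ℝ)|) := by
  have h : Summable fun n : ℕ => Real.exp (-lam * |(n : ℝ)|) := by
    have := summable_geometric_of_lt_one (Real.exp_pos (-lam)).le
      (Real.exp_lt_one_iff.2 (by linarith))
    refine this.congr fun n => ?_
    rw [← Real.exp_nat_mul, abs_of_nonneg (Nat.cast_nonneg n), mul_comm]
  refine Summable.of_nat_of_neg ?_ ?_
  · simpa using h
  · simpa using h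

/-- Dominate the flat-topped profile by exponentials centred at the integers of `[-R, R]`, `R =
⌈b/lam⌉`: the one centred at `k` if `k` is inside, the one at the nearest end otherwise. Summing
over `k` then costs only `2R + 1` copies of one series. -/
theorem min_one_exp_le_sum {lam b : ℝ} (hl : 0 < lam) (k : ℤ) :
    min 1 (Real.exp (b - lam * |(k : ℝ)|)) ≤
      ∑ j ∈ Finset.Icc (-(⌈b / lam⌉₊ : ℤ)) ⌈b / lam⌉₊, Real.exp (-lam * |((k - j : ℤ) : ℝ)|) := by
  set R := ⌈b / lam⌉₊ with hR
  have hRb : b ≤ lam * R := by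
    have := Nat.le_ceil (b / lam)
    rw [div_le_iff₀ hl] at this
    linarith
  have key : ∀ j ∈ Finset.Icc (-(R : ℤ)) R,
      min 1 (Real.exp (b - lam * |(k : ℝ)|)) ≤ Real.exp (-lam * |((k - j : ℤ) : ℝ)|) →
      min 1 (Real.exp (b - lam * |(k : ℝ)|)) ≤
        ∑ j ∈ Finset.Icc (-(R : ℤ)) R, Real.exp (-lam * |((k - j : ℤ) : ℝ)|) :=
    fun j hj h => h.trans (Finset.single_le_sum
      (f := fun j : ℤ => Real.exp (-lam * |((k - j : ℤ) : ℝ)|)) (fun _ _ => (Real.exp_pos _).le) hj)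
  rcases lt_or_ge (R : ℤ) k with h1 | h1
  · refine key R (Finset.mem_Icc.2 ⟨by omega, le_rfl⟩) ((min_le_right _ _).trans ?_)
    have h1' : (R : ℝ) < k := by exact_mod_cast h1
    have hR0 : (0 : ℝ) ≤ R := Nat.cast_nonneg R
    rw [Real.exp_le_exp]
    push_cast
    rw [abs_of_pos (by linarith), abs_of_pos (by linarith)]
    linarith
  rcases lt_or_ge k (-(R : ℤ)) with h2 | h2
  · refine key (-R) (Finset.mem_Icc.2 ⟨le_rfl, by omega⟩) ((min_le_right _ _).trans ?_)
    have h2' : (k : ℝ) < -R := by exact_mod_cast h2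
    have hR0 : (0 : ℝ) ≤ R := Nat.cast_nonneg R
    rw [Real.exp_le_exp]
    push_cast
    rw [abs_of_neg (by linarith), abs_of_neg (by linarith)]
    linarith
  · exact key k (Finset.mem_Icc.2 ⟨h2, h1⟩) ((min_le_left _ _).trans (by simp))

theorem sum_min_one_exp_le {lam b : ℝ} (hl : 0 < lam) (hb : 0 ≤ b) (s : Finset ℤ) (y : ℤ) :
    ∑ m ∈ s, min 1 (Real.exp (b - lam * |((m - y : ℤ) : ℝ)|)) ≤
      (2 * (b / lam) + 3) * ∑' m : ℤ, Real.exp (-lam * |(m : ℝ)|) := by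
  set K := ∑' m : ℤ, Real.exp (-lam * |(m : ℝ)|) with hK
  have hK0 : 0 ≤ K := tsum_nonneg fun _ => (Real.exp_pos _).le
  calc _ ≤ ∑ m ∈ s, ∑ j ∈ Finset.Icc (-(⌈b / lam⌉₊ : ℤ)) ⌈b / lam⌉₊,
        Real.exp (-lam * |((m - y - j : ℤ) : ℝ)|) :=
        Finset.sum_le_sum fun m _ => min_one_exp_le_sum hl (m - y)
    _ ≤ ∑ j ∈ Finset.Icc (-(⌈b / lam⌉₊ : ℤ)) ⌈b / lam⌉₊, K := by
        rw [Finset.sum_comm]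
        refine Finset.sum_le_sum fun j _ => ?_
        have hsm := (Equiv.subRight (y + j)).summable_iff.2 (summable_exp_neg_abs hl)
        have heq := (Equiv.subRight (y + j)).tsum_eq fun m : ℤ => Real.exp (-lam * |(m : ℝ)|)
        rw [hK, ← heq]
        refine le_trans (le_of_eq ?_) (hsm.sum_le_tsum s fun _ _ => (Real.exp_pos _).le)
        refine Finset.sum_congr rfl fun m _ => ?_
        simp only [Equiv.subRight_apply, sub_sub]
    _ ≤ _ := by
        rw [Finset.sum_const, nsmul_eq_mul, Int.card_Icc]
        gcongr
        have h1 : (((⌈b / lam⌉₊ : ℤ) + 1 - -(⌈b / lam⌉₊ : ℤ)).toNat : ℤ) =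
            2 * (⌈b / lam⌉₊ : ℤ) + 1 := by
          rw [Int.toNat_of_nonneg (by omega)]
          ring
        have h2 : ((((⌈b / lam⌉₊ : ℤ) + 1 - -(⌈b / lam⌉₊ : ℤ)).toNat : ℕ) : ℝ) =
            2 * (⌈b / lam⌉₊ : ℝ) + 1 := by exact_mod_cast h1
        rw [h2]
        have := (Nat.ceil_lt_add_one (div_nonneg hb hl.le)).le
        linarith

/-- The number of sites within distance `a` of a site, with exponentially small corrections. -/
theorem exists_sum_site_le (d : ℕ) {μ : ℝ} (hμ : 0 < μ) :
    ∃ K : ℝ, 0 ≤ K ∧ ∀ (L : ℕ) (y : Site d L) (a : ℝ), 0 ≤ a →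
      ∑ x, min 1 (Real.exp (a - μ * dist x y)) ≤ K * (1 + a) ^ d := by
  set Q : ℝ := ∑' m : ℤ, Real.exp (-(μ / d) * |(m : ℝ)|) with hQ
  have hQ0 : 0 ≤ Q := tsum_nonneg fun _ => (Real.exp_pos _).le
  refine ⟨((2 / μ + 3) * Q) ^ d, by positivity, fun L y a ha => ?_⟩
  rcases Nat.eq_zero_or_pos d with rfl | hd
  · simp
  have hd' : (0 : ℝ) < d := by exact_mod_cast hd
  -- The exponent is shared equally among the `d` coordinates, each coordinate distance being at
  -- most the sup distance; the sum over sites then factorises.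
  have hprod : ∀ x : Site d L, min 1 (Real.exp (a - μ * dist x y)) ≤
      ∏ i, min 1 (Real.exp (a / d - μ / d * dist (x i) (y i))) := by
    intro x
    have h1 : ∏ _i : Fin d, min 1 (Real.exp (a / d - μ / d * dist x y)) ≤
        ∏ i, min 1 (Real.exp (a / d - μ / d * dist (x i) (y i))) := by
      refine Finset.prod_le_prod (fun i _ => le_min zero_le_one (Real.exp_pos _).le) fun i _ => ?_
      refine min_le_min le_rfl (Real.exp_le_exp.2 ?_)
      have := dist_le_pi_dist x y i
      gcongr
    refine le_trans ?_ h1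
    rw [Finset.prod_const, Finset.card_univ, Fintype.card_fin]
    have he : Real.exp (a - μ * dist x y) = Real.exp (a / d - μ / d * dist x y) ^ d := by
      rw [← Real.exp_nat_mul]
      congr 1
      field_simp
    rw [he]
    rcases le_total 1 (Real.exp (a / d - μ / d * dist x y)) with h | h
    · rw [min_eq_left h, one_pow]; exact min_le_left _ _
    · rw [min_eq_right h]; exact min_le_right _ _
  have hone : ∀ i, ∑ m : Set.Icc (-(L : ℤ)) (L : ℤ),
      min 1 (Real.exp (a / d - μ / d * dist m (y i))) ≤ (2 / μ + 3) * Q * (1 + a) := by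
    intro i
    have h1 := sum_min_one_exp_le (lam := μ / d) (b := a / d) (by positivity) (by positivity)
      (Finset.Icc (-(L : ℤ)) L) (y i)
    have h2 : ∑ m : Set.Icc (-(L : ℤ)) (L : ℤ), min 1 (Real.exp (a / d - μ / d * dist m (y i))) =
        ∑ m ∈ Finset.Icc (-(L : ℤ)) L,
          min 1 (Real.exp (a / d - μ / d * |((m - (y i : ℤ) : ℤ) : ℝ)|)) := by
      rw [Finset.sum_subtype (Finset.Icc (-(L : ℤ)) L) (p := (· ∈ Set.Icc (-(L : ℤ)) (L : ℤ)))
        (fun z => by simp)]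
      refine Finset.sum_congr rfl fun m _ => ?_
      rw [Subtype.dist_eq, Int.dist_eq]
      simp
    rw [h2]
    refine h1.trans ?_
    rw [← hQ, show a / d / (μ / d) = a / μ by field_simp]
    have h3 : 2 * (a / μ) + 3 ≤ (2 / μ + 3) * (1 + a) := by
      have : 0 ≤ 2 / μ := by positivity
      have e : 2 * (a / μ) = 2 / μ * a := by ring
      rw [e]
      nlinarith
    calc _ ≤ (2 / μ + 3) * (1 + a) * Q := by gcongr
      _ = _ := by ring
  calc _ ≤ ∑ x : Site d L, ∏ i, min 1 (Real.exp (a / d - μ / d * dist (x i) (y i))) :=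
        Finset.sum_le_sum fun x _ => hprod x
    _ = ∏ i, ∑ m : Set.Icc (-(L : ℤ)) (L : ℤ),
          min 1 (Real.exp (a / d - μ / d * dist m (y i))) := by
        rw [Finset.prod_univ_sum, Fintype.piFinset_univ]
    _ ≤ ∏ _i : Fin d, ((2 / μ + 3) * Q * (1 + a)) :=
        Finset.prod_le_prod (fun i _ => Finset.sum_nonneg fun m _ =>
          le_min zero_le_one (Real.exp_pos _).le) fun i _ => hone i
    _ = _ := by
        rw [Finset.prod_const, Finset.card_univ, Fintype.card_fin, mul_pow]

end Counting

/-! ### Comparison of local dynamics with polynomial growth in time. -/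

section Dynamics

open LocFam

/-- Two dynamics of local observables whose generators differ by a small extensive local operator
stay close to each other, up to a factor that grows polynomially in time. -/
theorem exists_norm_heis_sub_heis_le (d : ℕ) {κ : ℝ} (hκ : 0 < κ) :
    ∃ K : ℝ, 0 ≤ K ∧ ∀ (L q : ℕ) (h W : LocFam d L q), h.SelfAdj → W.SelfAdj → ∀ b : ℝ, 1 ≤ b →
      nrm κ h ≤ b → ∀ (S : Finset (Site d L)) (O : Op d L q), S.Nonempty → SupportedOn S O →
      ∀ t : ℝ, ‖heis (op h) t O - heis (op h - op W) t O‖ ≤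
        K * S.card * b ^ d * nrm (κ / 2) W * ‖O‖ * (|t| * (1 + |t|) ^ d) := by
  obtain ⟨K, hK0, hK⟩ := exists_sum_site_le d (μ := κ / 2) (by positivity)
  refine ⟨4 * (K * (1 + 4 / κ) ^ d), by positivity, ?_⟩
  have main : ∀ (L q : ℕ) (h W : LocFam d L q), h.SelfAdj → W.SelfAdj → ∀ b : ℝ, 1 ≤ b →
      nrm κ h ≤ b → ∀ (S : Finset (Site d L)) (O : Op d L q), S.Nonempty → SupportedOn S O →
      ∀ t : ℝ, 0 ≤ t → ‖heis (op h) t O - heis (op h - op W) t O‖ ≤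
        4 * (K * (1 + 4 / κ) ^ d) * S.card * b ^ d * nrm (κ / 2) W * ‖O‖ * (t * (1 + t) ^ d) := by
    intro L q h W hh hW b hb hnb S O hS hO t ht
    have hWn := nrm_nonneg (κ / 2) W
    have hcomm : ∀ s, 0 ≤ s → s ≤ t →
        ‖op W * heis (op h) s O - heis (op h) s O * op W‖ ≤
          4 * ‖O‖ * nrm (κ / 2) W * (S.card * (K * ((1 + 4 / κ) * b * (1 + t)) ^ d)) := by
      intro s hs hst
      refine (norm_commutator_heis_le hκ (by positivity : 0 ≤ κ / 2) hh hnb hO hS hs).trans ?_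
      gcongr
      rw [← nsmul_eq_mul, ← Finset.sum_const]
      refine Finset.sum_le_sum fun y _ => ?_
      refine (hK L y (4 * b / κ * s) (by positivity)).trans ?_
      gcongr
      have h4 : 0 ≤ 4 / κ := by positivity
      calc 1 + 4 * b / κ * s ≤ 1 + 4 * b / κ * t := by gcongr
        _ = 1 * 1 * 1 + (4 / κ) * (b * t) := by ring
        _ ≤ (1 + 4 / κ) * b * (1 + t) := by
            have hbt : 0 ≤ b * t := by positivity
            have : 0 ≤ 4 / κ * b := by positivity
            nlinarith
    refine (norm_heis_sub_heis_le hh.op hW.op ht O hcomm).trans_eq ?_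
    rw [mul_pow, mul_pow]
    ring
  intro L q h W hh hW b hb hnb S O hS hO t
  rcases le_total 0 t with ht | ht
  · rw [abs_of_nonneg ht]
    exact main L q h W hh hW b hb hnb S O hS hO t ht
  -- Negative times follow by reversing the signs of both generators.
  · have := main L q (-h) (-W) hh.neg hW.neg b hb (by rwa [nrm_neg]) S O hS hO (-t) (by linarith)
    rw [abs_of_nonpos ht]
    rw [nrm_neg, map_neg, map_neg, ← neg_sub', heis_neg, heis_neg, neg_neg] at this
    exact this

end Dynamics

/-! ### Rounding the spectrum of a self-adjoint operator to integers. -/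

section Rounding

open Complex

variable {𝔸 : Type*} [CStarAlgebra 𝔸]

/-- The path `e^{isH} e^{-isN}` has speed at most `‖H - N‖`, and its second factor is 1 at `s = 2π`.
-/
theorem norm_exp_two_pi_sub_one_le {H N : 𝔸} (hH : IsSelfAdjoint H) (hN : IsSelfAdjoint N)
    (h1 : NormedSpace.exp ((I * (2 * Real.pi : ℝ)) • N) = 1) :
    ‖NormedSpace.exp ((I * (2 * Real.pi : ℝ)) • H) - 1‖ ≤ 2 * Real.pi * ‖H - N‖ := by
  have hd : ∀ s : ℝ, HasDerivAt
      (fun s : ℝ => NormedSpace.exp ((I * s) • H) * NormedSpace.exp (-(I * s) • N))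
      (NormedSpace.exp ((I * s) • H) * (I • (H - N)) * NormedSpace.exp (-(I * s) • N)) s := by
    intro s
    refine ((hasDerivAt_exp_I_smul H s).mul (hasDerivAt_exp_neg_I_smul N s)).congr_deriv ?_
    simp only [smul_sub, mul_sub, sub_mul, mul_assoc, smul_mul_assoc, mul_smul_comm, mul_neg]
    abel
  have h := Convex.norm_image_sub_le_of_norm_hasDerivWithin_le (𝕜 := ℝ) (s := Set.univ)
    (x := 0) (y := 2 * Real.pi) (C := ‖H - N‖)
    (fun s _ => (hd s).hasDerivWithinAt)
    (fun s _ => by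
      rw [CStarRing.norm_mul_mem_unitary _ (exp_neg_mem_unitary hN s),
        CStarRing.norm_mem_unitary_mul _ (exp_mem_unitary hH s), norm_smul]
      simp) convex_univ trivial trivial
  have h2 := exp_mul_exp_neg N (2 * Real.pi)
  rw [h1, one_mul] at h2
  rw [h2, mul_one] at h
  simp only [ofReal_zero, mul_zero, zero_smul, neg_zero, NormedSpace.exp_zero, mul_one,
    sub_zero] at h
  rw [Real.norm_of_nonneg (by positivity)] at h
  linarith

/-- With `y = x - round x`, the right side is `2|sin πy|`; Jordan's inequality applies because `|y|
≤ 1/2`. -/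
theorem four_mul_abs_sub_round_le (x : ℝ) :
    4 * |x - round x| ≤ ‖Complex.exp (I * (2 * Real.pi : ℝ) * x) - 1‖ := by
  set y := x - round x with hy
  have hy2 : |y| ≤ 1 / 2 := abs_sub_round x
  have e : Complex.exp (I * (2 * Real.pi : ℝ) * x) = Complex.exp (I * (2 * Real.pi * y : ℝ)) := by
    have : I * (2 * Real.pi : ℝ) * x = I * (2 * Real.pi * y : ℝ) +
        (round x : ℤ) * (2 * Real.pi * I) := by
      rw [hy]; push_cast; ring
    rw [this, Complex.exp_add, Complex.exp_int_mul_two_pi_mul_I, mul_one]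
  rw [e, Complex.norm_exp_I_mul_ofReal_sub_one, Real.norm_eq_abs, abs_mul, abs_two,
    show 2 * Real.pi * y / 2 = Real.pi * y by ring]
  have hs : |Real.sin (Real.pi * y)| = Real.sin (Real.pi * |y|) := by
    rcases le_total 0 y with h | h
    · rw [abs_of_nonneg h] at hy2 ⊢
      exact abs_of_nonneg (Real.sin_nonneg_of_nonneg_of_le_pi (by positivity)
        (by nlinarith [Real.pi_pos]))
    · rw [abs_of_nonpos h] at hy2 ⊢
      rw [mul_neg, Real.sin_neg]
      refine abs_of_nonpos (Real.sin_nonpos_of_nonpos_of_neg_pi_le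
        (mul_nonpos_of_nonneg_of_nonpos Real.pi_pos.le h) (by nlinarith [Real.pi_pos]))
  rw [hs]
  have hm := Real.mul_le_sin (x := Real.pi * |y|) (by positivity) (by nlinarith [Real.pi_pos])
  have hc : 2 / Real.pi * (Real.pi * |y|) = 2 * |y| := by field_simp
  linarith

/-- A self-adjoint operator close to one with integer spectrum is close to the operator obtained by
rounding its spectrum. -/
theorem exists_round {H N : 𝔸} (hH : IsSelfAdjoint H) (hN : IsSelfAdjoint N)
    (h1 : NormedSpace.exp ((I * (2 * Real.pi : ℝ)) • N) = 1) (hfin : (spectrum ℂ H).Finite) :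
    ∃ M : 𝔸, IsSelfAdjoint M ∧ (∀ z ∈ spectrum ℂ M, ∃ n : ℤ, z = n) ∧ Commute H M ∧
      ‖H - M‖ ≤ Real.pi / 2 * ‖H - N‖ := by
  have hn : IsStarNormal H := hH.isStarNormal
  have hn' : IsStarNormal ((I * (2 * Real.pi : ℝ)) • H) := inferInstance
  -- Finiteness of the spectrum makes the discontinuous rounding function admissible in the
  -- continuous functional calculus.
  have hcont : ∀ f : ℂ → ℂ, ContinuousOn f (spectrum ℂ H) := fun f => hfin.continuousOn f
  set f : ℂ → ℂ := fun z => ((round z.re : ℤ) : ℂ) with hf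
  refine ⟨cfc f H, ?_, ?_, ?_, ?_⟩
  · rw [isSelfAdjoint_iff, ← cfc_star]
    congr 1
    ext z
    simp [hf]
  · intro z hz
    rw [cfc_map_spectrum f H hn (hcont f)] at hz
    obtain ⟨w, -, rfl⟩ := hz
    exact ⟨round w.re, rfl⟩
  · have := cfc_commute_cfc (fun z : ℂ => z) f H
    rwa [cfc_id' ℂ H] at this
  · have hexp : NormedSpace.exp ((I * (2 * Real.pi : ℝ)) • H) - 1 =
        cfc (fun z : ℂ => Complex.exp ((I * (2 * Real.pi : ℝ)) • z) - 1) H := by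
      rw [cfc_sub _ _ H (hcont _) (hcont _), cfc_const_one ℂ H, cfc_comp_smul _ _ H,
        CFC.complex_exp_eq_normedSpace_exp (p := IsStarNormal)]
    have hD : H - cfc f H = cfc (fun z : ℂ => z - f z) H := by
      rw [cfc_sub _ _ H (hcont _) (hcont _), cfc_id' ℂ H]
    have hE := norm_exp_two_pi_sub_one_le hH hN h1
    rw [hD]
    refine norm_cfc_le (by positivity) fun z hz => ?_
    have hre := hH.mem_spectrum_eq_re hz
    have h2 := norm_apply_le_norm_cfc
      (fun z : ℂ => Complex.exp ((I * (2 * Real.pi : ℝ)) • z) - 1) H hz (hcont _) hn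
    rw [← hexp] at h2
    have h3 := four_mul_abs_sub_round_le z.re
    rw [← hre] at h3
    have h4 : ‖z - f z‖ = |z.re - round z.re| := by
      rw [← Real.norm_eq_abs, ← Complex.norm_real]
      congr 1
      push_cast
      rw [← hre]
    rw [h4]
    rw [smul_eq_mul] at h2
    linarith

end Rounding

/-! ### Operators as a single term, and on-site terms too small to be nontrivial. -/

section WholeBox

variable {d L q : ℕ}

namespace LocFam

/-- An operator, as a family whose only term is that of the whole box. -/
def wholeBox (A : Op d L q) : LocFam d L q :=
  mk (fun S => if S = Finset.univ then A else 0) fun S => by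
    split_ifs with h
    · subst h
      exact ⟨supportedOn_univ A, fun h => absurd isConn_univ h⟩
    · exact ⟨supportedOn_zero S, fun _ => rfl⟩

theorem op_wholeBox (A : Op d L q) : op (wholeBox A) = A := by
  change ∑ S, (if S = Finset.univ then A else 0) = A
  simp

theorem selfAdj_wholeBox {A : Op d L q} (hA : IsSelfAdjoint A) : (wholeBox A).SelfAdj := by
  intro S
  change IsSelfAdjoint (if S = Finset.univ then A else 0)
  split_ifs
  · exact hA
  · exact IsSelfAdjoint.zero _

/-- Only the term at `x` contributes to the commutator with an operator at `x`. -/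
theorem OnSite.commutator_eq {N : LocFam d L q} (hN : N.OnSite) {x : Site d L} {X : Op d L q}
    (hX : SupportedOn {x} X) : op N * X - X * op N = N.term {x} * X - X * N.term {x} := by
  rw [op_apply, Finset.sum_mul, Finset.mul_sum, ← Finset.sum_sub_distrib,
    Finset.sum_eq_single {x}]
  · intro T _ hT
    by_cases hc : T.card = 1
    · obtain ⟨y, rfl⟩ := Finset.card_eq_one.1 hc
      have hne : y ≠ x := fun h => hT (by rw [h])
      rw [((N.supported {y}).commute hX (by simpa using hne)).eq, sub_self]
    · rw [hN T hc]; simp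
  · simp

/-- If the on-site terms are small, integrality of the spectrum forces `N` to be central. -/
theorem OnSite.commute_of_small {N : LocFam d L q} (hN : N.OnSite) (hsa : N.SelfAdj)
    (hper : ∀ A, heis (op N) (2 * Real.pi) A = A)
    (hsmall : ∀ x, 2 * Real.pi * ‖N.term {x}‖ < 1) (B : Op d L q) : Commute (op N) B := by
  have hsite : ∀ x, ∀ A : Op d L q, SupportedOn {x} A → Commute (op N) A := by
    intro x A hA
    have hav : SupportedOn {x} (avg (op N) A) := supportedOn_iff.2 fun _ hy i j =>
      commute_avg_of_commute fun s => (hN.supportedOn_heis hA s).commute_siteUnit hy i j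
    have hcom : Commute (op N) (avg (op N) A) := sub_eq_zero.1 (commute_avg (hper A))
    set D := A - avg (op N) A with hD
    have hDs : SupportedOn {x} D := hA.sub hav
    have hDavg : avg (op N) D = 0 := by
      have e : ∀ s, heis (op N) s D = heis (op N) s A - avg (op N) A := fun s => by
        rw [hD, heis_sub, heis_of_commute hcom]
      rw [avg]
      simp only [e]
      rw [intervalIntegral.integral_sub ((continuous_heis _ _).intervalIntegrable _ _)
        (continuous_const.intervalIntegrable _ _), intervalIntegral.integral_const, smul_sub]
      have e2 : ((2 * Real.pi : ℝ) : ℂ)⁻¹ • ((2 * Real.pi - 0 : ℝ) • avg (op N) A) =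
          avg (op N) A := by
        rw [sub_zero, ← Complex.coe_smul, smul_smul, inv_mul_cancel₀ two_pi_ne_zero', one_smul]
      rw [e2]
      exact sub_self _
    have hG : SupportedOn {x} (gen (op N) D) := supportedOn_iff.2 fun _ hy i j =>
      commute_gen_of_commute fun s => (hN.supportedOn_heis hDs s).commute_siteUnit hy i j
    have h1 := I_smul_commutator_gen (hper D)
    rw [hDavg, sub_zero, hN.commutator_eq hG] at h1
    -- The fluctuating part satisfies `D = i[N_x, G]` with `‖G‖ ≤ π‖D‖`; the smallness of `N_x` then
    -- forces `D = 0`.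
    have h2 : ‖D‖ ≤ 2 * Real.pi * ‖N.term {x}‖ * ‖D‖ := by
      calc ‖D‖ = ‖N.term {x} * gen (op N) D - gen (op N) D * N.term {x}‖ := by
            rw [← h1, norm_smul, Complex.norm_I, one_mul, h1]
        _ ≤ 2 * (‖N.term {x}‖ * (Real.pi * ‖D‖)) := by
            refine (norm_commutator_le _ _).trans ?_
            gcongr
            exact norm_gen_le hsa.op D
        _ = _ := by ring
    have h3 : ‖D‖ = 0 := by
      have := hsmall x
      have := norm_nonneg D
      nlinarith
    have h4 : A = avg (op N) A := sub_eq_zero.1 (norm_eq_zero.1 h3)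
    rw [h4]
    exact hcom
  -- Commuting with all one-site operators, `N` has empty support, hence commutes with everything.
  have h0 : SupportedOn ∅ (op N) := supportedOn_iff.2 fun x _ i j => hsite x _ <|
    supportedOn_iff.2 fun y hy i' j' => by
      have hxy : x ≠ y := fun h => hy (by simp [h])
      exact SupportedOn.commute (S := {x}) (T := {y})
        (supportedOn_siteUnit x i j) (supportedOn_siteUnit y i' j') (by simpa using hxy)
  exact h0.commute (supportedOn_univ B) (by simp)

theorem norm_term_singleton_le (κ : ℝ) (N : LocFam d L q) (x : Site d L) :
    ‖N.term {x}‖ * Real.exp κ ≤ nrm κ N := by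
  refine le_trans ?_ (siteNorm_le_nrm κ N x)
  have := Finset.single_le_sum (s := Finset.univ.filter fun S : Finset (Site d L) => x ∈ S)
    (f := fun S => ‖N.term S‖ * Real.exp (κ * S.card)) (fun _ _ => by positivity)
    (Finset.mem_filter.2 ⟨Finset.mem_univ {x}, Finset.mem_singleton_self x⟩)
  simpa [siteNorm] using this

end LocFam

end WholeBox

/-! ### Choice of parameters and the two splittings of the Hamiltonian. -/

section Main

open LocFam

variable {d L q : ℕ}

theorem spectrum_unitary_conj {U : Op d L q} (hU : U ∈ unitary (Op d L q)) (A : Op d L q) :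
    spectrum ℂ (star U * A * U) = spectrum ℂ A := by
  have h1 : star U * U = 1 := Unitary.star_mul_self_of_mem hU
  have h2 : U * star U = 1 := Unitary.mul_star_self_of_mem hU
  exact spectrum.units_conjugate (u := ⟨star U, U, h1, h2⟩)

theorem commutator_unitary_conj {U : Op d L q} (hU : U ∈ unitary (Op d L q)) (A B : Op d L q) :
    (star U * A * U) * (star U * B * U) - (star U * B * U) * (star U * A * U) =
      star U * (A * B - B * A) * U := by
  have h2 : U * star U = 1 := Unitary.mul_star_self_of_mem hU
  have key : ∀ X Y : Op d L q, (star U * X * U) * (star U * Y * U) = star U * (X * Y) * U := by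
    intro X Y
    calc _ = star U * X * (U * star U) * Y * U := by simp only [mul_assoc]
      _ = _ := by rw [h2]; simp only [mul_assoc, mul_one]
  rw [key, key, mul_sub, sub_mul]

/-- After `⌊x⌋` steps that gain a factor `1 / 8` each, the remainder is below `e^{-x}`. -/
theorem pow_floor_le_exp {x : ℝ} (hx : 1 ≤ x) : (1 / 8 : ℝ) ^ ⌊x⌋₊ ≤ Real.exp (-x) := by
  have h1 : (1 : ℝ) ≤ ⌊x⌋₊ := by exact_mod_cast Nat.one_le_floor_iff x |>.2 hx
  have h2 : x < ⌊x⌋₊ + 1 := Nat.lt_floor_add_one x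
  -- Since `e² < 8`, each step gains `e^{-2}`; then `2⌊x⌋ ≥ ⌊x⌋ + 1 > x` makes up for the floor.
  have h8 : (1 / 8 : ℝ) ≤ Real.exp (-2) := by
    have he := Real.exp_one_lt_d9
    have h0 := Real.exp_pos 1
    rw [Real.exp_neg, one_div]
    apply inv_anti₀ (Real.exp_pos 2)
    rw [show (2 : ℝ) = 1 + 1 by norm_num, Real.exp_add]
    nlinarith
  calc (1 / 8 : ℝ) ^ ⌊x⌋₊ ≤ Real.exp (-2) ^ ⌊x⌋₊ := by gcongr
    _ = Real.exp (⌊x⌋₊ * (-2)) := (Real.exp_nat_mul _ _).symm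
    _ ≤ _ := Real.exp_le_exp.2 (by linarith)

/-- With `δ = κ/(4n)` the ratio is `16π nεP/κ`, and `nε ≤ ε₀` reduces it to the condition on `ε₀`.
-/
theorem step_size_small {κ ε ε₀ P : ℝ} {n : ℕ} (hκ : 0 < κ) (hP : 0 ≤ P) (hn : 0 < n)
    (hnε : n * ε ≤ ε₀)
    (h : ε₀ * (64 * Real.pi * (3 * (Real.exp 1 - 1) + Real.exp 1 ^ 2) * P) ≤
      (Real.exp 1 - 1) * κ) :
    4 * Real.pi * (ε * P) / (κ / (4 * n)) ≤ 1 / 25 := by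
  have hn' : (0 : ℝ) < n := by exact_mod_cast hn
  have he : 0 < Real.exp 1 - 1 := by
    have := Real.add_one_le_exp (1 : ℝ)
    linarith
  have hpi := Real.pi_pos
  have hX : n * ε * P ≤ ε₀ * P := mul_le_mul_of_nonneg_right hnε hP
  -- Equivalent to `4e² - 13e + 13 ≥ 0`, a quadratic without real roots whose minimum is at `13/8`.
  have he2 : 25 * (Real.exp 1 - 1) ≤ 4 * (3 * (Real.exp 1 - 1) + Real.exp 1 ^ 2) := by
    nlinarith [sq_nonneg (Real.exp 1 - 13 / 8)]
  rcases le_or_gt (ε₀ * P) 0 with h0 | h0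
  · have : 4 * Real.pi * (ε * P) / (κ / (4 * n)) = 16 * Real.pi / κ * (n * ε * P) := by
      field_simp
      ring
    rw [this]
    have : 16 * Real.pi / κ * (n * ε * P) ≤ 0 :=
      mul_nonpos_of_nonneg_of_nonpos (by positivity) (hX.trans h0)
    linarith
  · have h1 : 16 * Real.pi * (ε₀ * P) * (25 * (Real.exp 1 - 1)) ≤ (Real.exp 1 - 1) * κ := by
      calc _ ≤ 16 * Real.pi * (ε₀ * P) * (4 * (3 * (Real.exp 1 - 1) + Real.exp 1 ^ 2)) := by
            gcongr
        _ ≤ _ := by linarith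
    have h2 : 25 * (16 * Real.pi * (ε₀ * P)) ≤ κ := by
      by_contra hc
      push Not at hc
      nlinarith
    rw [div_le_iff₀ (by positivity)]
    have h3 : 1 / 25 * (κ / (4 * n)) = κ / 25 / (4 * n) := by ring
    rw [h3, le_div_iff₀ (by positivity)]
    have h4 : 16 * Real.pi * (n * ε * P) ≤ 16 * Real.pi * (ε₀ * P) := by gcongr
    linarith

/-- The local regime: approximately conserved, uniformly local quantities. -/
theorem exists_local_splitting {N P : LocFam d L q} (hN : N.OnSite) (hNsa : N.SelfAdj)
    (hPsa : P.SelfAdj) (hint : ∀ z ∈ spectrum ℂ (op N), ∃ n : ℤ, z = n) {κ ε ε₀ : ℝ}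
    (hκ : 0 < κ) (hε : 0 < ε) (hε₀ : ε < ε₀)
    (hsmall : ε₀ * (64 * Real.pi * (3 * (Real.exp 1 - 1) + Real.exp 1 ^ 2) * nrm κ P) ≤
      (Real.exp 1 - 1) * κ) :
    ∃ 𝒩 𝒵 W : LocFam d L q, 𝒩.SelfAdj ∧ 𝒵.SelfAdj ∧ W.SelfAdj ∧
      op 𝒩 + op 𝒵 + op W = op N + (ε : ℂ) • op P ∧
      nrm (κ / 2) 𝒩 ≤ 2 * nrm κ N ∧
      nrm (κ / 2) 𝒵 ≤ 4 * (ε * nrm κ P) ∧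
      nrm (κ / 2) W ≤ 2 * (ε * nrm κ P * Real.exp (-ε₀ / ε)) ∧
      (∀ z ∈ spectrum ℂ (op 𝒩), ∃ n : ℤ, z = n) ∧
      ‖op 𝒩 - op N‖ ≤ Fintype.card (Site d L) *
        (8 * Real.pi * Real.exp (-(3 * κ / 4)) * Real.exp (-κ) * (ε * nrm κ P) * nrm κ N) ∧
      ‖(op N + (ε : ℂ) • op P) * op 𝒩 - op 𝒩 * (op N + (ε : ℂ) • op P)‖ ≤
        Fintype.card (Site d L) * (2 * Real.exp (-(3 * κ / 4)) *
          (ε * nrm κ P * Real.exp (-ε₀ / ε)) * nrm (3 * κ / 4) N) ∧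
      ‖(op N + (ε : ℂ) • op P) * op 𝒵 - op 𝒵 * (op N + (ε : ℂ) • op P)‖ ≤
        Fintype.card (Site d L) * (4 * Real.exp (-(3 * κ / 4)) *
          (ε * nrm κ P * Real.exp (-ε₀ / ε)) * (ε * nrm κ P)) ∧
      op 𝒩 * op 𝒵 - op 𝒵 * op 𝒩 = 0 := by
  have hper := heis_two_pi hNsa.op hint
  have hPn := nrm_nonneg κ P
  have hNn := nrm_nonneg κ N
  set p := ε * nrm κ P with hp
  have hp0 : 0 ≤ p := by positivity
  have hx : 1 < ε₀ / ε := (one_lt_div hε).2 hε₀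
  set n := ⌊ε₀ / ε⌋₊ with hn
  have hn1 : 0 < n := (Nat.one_le_floor_iff _).2 hx.le
  have hn' : (0 : ℝ) < n := by exact_mod_cast hn1
  have hnε : n * ε ≤ ε₀ := by
    have := Nat.floor_le (a := ε₀ / ε) (by linarith)
    rwa [le_div_iff₀ hε] at this
  -- The `n` steps spend a quarter of `κ`, and pulling back to the original frame another quarter;
  -- this leaves `κ/2`.
  set δ := κ / (4 * n) with hδ
  have hδ0 : 0 < δ := by positivity
  have hnδ : n * δ = κ / 4 := by rw [hδ]; field_simp
  have hθ := step_size_small hκ hPn hn1 hnε hsmall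
  have hPε : nrm κ ((ε : ℂ) • P) ≤ p := by
    refine (nrm_smul_le _ _ _).trans_eq ?_
    rw [Complex.norm_real, Real.norm_of_nonneg hε.le]
  have hform := NormalForm.exists hN hNsa (hPsa.ofReal_smul ε) hper hκ hδ0 hPε hθ n hnδ.le
  rw [map_smul] at hform
  obtain ⟨F⟩ := hform
  have h34 : κ - n * δ = 3 * κ / 4 := by rw [hnδ]; ring
  set E := Real.exp (-ε₀ / ε) with hE
  have hpow : (1 / 8 : ℝ) ^ n ≤ E := by
    have := pow_floor_le_exp hx.le
    rwa [← hn, ← neg_div] at this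
  have hpow0 : (0 : ℝ) < (1 / 8) ^ n := by positivity
  have hV : nrm (3 * κ / 4) F.V ≤ p * E := by
    rw [← h34]
    exact F.nrm_V.trans (by gcongr)
  have hZ : nrm (3 * κ / 4) F.Z ≤ 2 * p := by
    rw [← h34]
    refine F.nrm_Z.trans ?_
    nlinarith
  have hback : ∀ B, nrm (κ / 2) (F.back B) ≤ 2 * nrm (3 * κ / 4) B := by
    intro B
    have h := F.nrm_back (3 * κ / 4) (by linarith) le_rfl B
    rw [hnδ, show 3 * κ / 4 - κ / 4 = κ / 2 by ring] at h
    refine h.trans ?_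
    have := nrm_nonneg (3 * κ / 4) B
    gcongr
    have : (0 : ℝ) < (1 / 2) ^ n := by positivity
    linarith
  have hU := F.unitary_U
  have hHeq : op N + (ε : ℂ) • op P = star F.U * (op N + op F.Z + op F.V) * F.U := by
    have h := F.op_back_add
    rw [F.op_back, map_add, map_add] at h
    exact h.symm
  have hcomm : ∀ X B, X = star F.U * (op N + op F.Z + op F.V) * F.U →
      ‖X * op (F.back B) - op (F.back B) * X‖ =
        ‖(op N + op F.Z + op F.V) * op B - op B * (op N + op F.Z + op F.V)‖ := by
    rintro X B rfl
    rw [F.op_back, commutator_unitary_conj hU, conj_unitary_norm hU]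
  -- In the rotated frame `N` and `Z` commute, so only the exponentially small `V` contributes to
  -- the drift.
  have hcN : (op N + op F.Z + op F.V) * op N - op N * (op N + op F.Z + op F.V) =
      op F.V * op N - op N * op F.V := by
    have := F.commute_Z
    rw [sub_eq_zero] at this
    simp only [add_mul, mul_add, this]
    abel
  have hcZ : (op N + op F.Z + op F.V) * op F.Z - op F.Z * (op N + op F.Z + op F.V) =
      op F.V * op F.Z - op F.Z * op F.V := by
    have := F.commute_Z
    rw [sub_eq_zero] at this
    simp only [add_mul, mul_add, this]
    abel
  have hexp1 : Real.exp (-(3 * κ / 4)) ≤ 1 := Real.exp_le_one_iff.2 (by linarith)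
  have hexp0 := Real.exp_pos (-(3 * κ / 4))
  have hE0 : 0 < E := Real.exp_pos _
  have hcard : (0 : ℝ) ≤ Fintype.card (Site d L) := Nat.cast_nonneg _
  refine ⟨F.back N, F.back F.Z, F.back F.V, F.selfAdj_back _ hNsa, F.selfAdj_back _ F.selfAdj_Z,
    F.selfAdj_back _ F.selfAdj_V, ?_, ?_, ?_, ?_, ?_, ?_, ?_, ?_, ?_⟩
  · have h := F.op_back_add
    rw [F.op_back, map_add, map_add, mul_add, mul_add, add_mul, add_mul, ← F.op_back, ← F.op_back,
      ← F.op_back] at h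
    exact h
  · refine (hback N).trans ?_
    have := nrm_mono (show 3 * κ / 4 ≤ κ by linarith) N
    linarith
  · exact (hback F.Z).trans (by linarith)
  · exact (hback F.V).trans (by linarith)
  · rw [F.op_back, spectrum_unitary_conj hU]
    exact hint
  · refine F.norm_back_sub.trans (mul_le_mul_of_nonneg_left ?_ hcard)
    set m := Real.pi * p * (Real.exp (-(3 * κ / 4)) * (Real.exp (-κ) * nrm κ N)) with hm
    have hm0 : 0 ≤ m := by positivity
    have e1 : 8 / 7 * (2 * (Real.exp (-(3 * κ / 4)) * (Real.pi * p)) *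
        (Real.exp (-κ) * nrm κ N)) * (1 - (1 / 8) ^ n) = 16 / 7 * m * (1 - (1 / 8) ^ n) := by
      rw [hm]; ring
    have e2 : 8 * Real.pi * Real.exp (-(3 * κ / 4)) * Real.exp (-κ) * p * nrm κ N = 8 * m := by
      rw [hm]; ring
    rw [e1, e2]
    nlinarith
  · rw [hcomm _ _ hHeq, hcN]
    refine (norm_op_commutator_le (μ := 3 * κ / 4) (ν := 3 * κ / 4) (by positivity)
      (by positivity) F.V N).trans (mul_le_mul_of_nonneg_left ?_ hcard)
    have hN3 := nrm_nonneg (3 * κ / 4) N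
    calc _ ≤ 2 * (Real.exp (-(3 * κ / 4)) * (p * E)) * (1 * nrm (3 * κ / 4) N) := by gcongr
      _ = _ := by ring
  · rw [hcomm _ _ hHeq, hcZ]
    refine (norm_op_commutator_le (μ := 3 * κ / 4) (ν := 3 * κ / 4) (by positivity)
      (by positivity) F.V F.Z).trans (mul_le_mul_of_nonneg_left ?_ hcard)
    have hZ0 := nrm_nonneg (3 * κ / 4) F.Z
    calc _ ≤ 2 * (Real.exp (-(3 * κ / 4)) * (p * E)) * (1 * (2 * p)) := by gcongr
      _ = _ := by ring
  · rw [F.op_back, F.op_back, commutator_unitary_conj hU, F.commute_Z]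
    simp

/-- Without any locality requirement the Hamiltonian splits exactly, into a part with integer
spectrum close to `N` and a part that commutes with it. -/
theorem exists_spectral_splitting {N P : LocFam d L q} (hN : N.OnSite) (hNsa : N.SelfAdj)
    (hPsa : P.SelfAdj) (hint : ∀ z ∈ spectrum ℂ (op N), ∃ n : ℤ, z = n) {κ ε : ℝ}
    (hκ : 0 < κ) (hε : 0 < ε) :
    ∃ M : Op d L q, IsSelfAdjoint M ∧ (∀ z ∈ spectrum ℂ M, ∃ n : ℤ, z = n) ∧
      Commute (op N + (ε : ℂ) • op P) M ∧
      ‖M - op N‖ ≤ Fintype.card (Site d L) *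
        (8 * Real.pi * Real.exp (-(2 * κ)) * (ε * nrm κ P) * nrm κ N) := by
  have hper := heis_two_pi hNsa.op hint
  have hPn := nrm_nonneg κ P
  have hNn := nrm_nonneg κ N
  have hcard : (0 : ℝ) ≤ Fintype.card (Site d L) := Nat.cast_nonneg _
  -- Rounding alone bounds the distance by `ε‖P‖`, without the required factor `‖N‖_κ`. If all
  -- on-site terms are small, `N` is central and serves itself; otherwise `1 ≤ 2π e^{-κ}‖N‖_κ`
  -- inserts the factor.
  by_cases hs : ∀ x, 2 * Real.pi * ‖N.term {x}‖ < 1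
  · refine ⟨op N, hNsa.op, hint, (hN.commute_of_small hNsa hper hs _).symm, ?_⟩
    rw [sub_self, norm_zero]
    exact mul_nonneg hcard (by positivity)
  · push Not at hs
    obtain ⟨x, hx⟩ := hs
    have hpi := Real.pi_pos
    have hN1 : 1 ≤ 2 * Real.pi * (Real.exp (-κ) * nrm κ N) := by
      have h1 := norm_term_singleton_le κ N x
      have h2 : ‖N.term {x}‖ ≤ Real.exp (-κ) * nrm κ N := by
        rw [Real.exp_neg, inv_mul_eq_div, le_div_iff₀ (Real.exp_pos κ)]
        exact h1
      nlinarith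
    have hεP : ‖(ε : ℂ) • op P‖ ≤ Fintype.card (Site d L) * (Real.exp (-κ) * (ε * nrm κ P)) := by
      rw [norm_smul, Complex.norm_real, Real.norm_of_nonneg hε.le]
      have := mul_le_mul_of_nonneg_left (norm_op_le hκ.le P) hε.le
      linarith
    have hHsa : IsSelfAdjoint (op N + (ε : ℂ) • op P) := by
      have := (hNsa.add (hPsa.ofReal_smul ε)).op
      rwa [map_add, map_smul] at this
    obtain ⟨M, hM, hMint, hcom, hdist⟩ := exists_round hHsa hNsa.op
      (exp_two_pi_smul_eq_one hNsa.op hint) (Matrix.finite_spectrum _)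
    refine ⟨M, hM, hMint, hcom, ?_⟩
    rw [add_sub_cancel_left] at hdist
    set y := Fintype.card (Site d L) * (Real.exp (-κ) * (ε * nrm κ P)) with hy
    have hy0 : 0 ≤ y := mul_nonneg hcard (by positivity)
    have h1 : ‖M - op N‖ ≤ 4 * y := by
      have e : M - op N = (ε : ℂ) • op P - (op N + (ε : ℂ) • op P - M) := by abel
      have h2 : ‖M - op N‖ ≤ ‖(ε : ℂ) • op P‖ + ‖op N + (ε : ℂ) • op P - M‖ := by
        rw [e]; exact norm_sub_le _ _
      have hpi4 := Real.pi_le_four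
      nlinarith [norm_nonneg ((ε : ℂ) • op P)]
    have e2 : Real.exp (-(2 * κ)) = Real.exp (-κ) * Real.exp (-κ) := by
      rw [← Real.exp_add]; ring_nf
    calc ‖M - op N‖ ≤ 4 * y * 1 := by linarith
      _ ≤ 4 * y * (2 * Real.pi * (Real.exp (-κ) * nrm κ N)) := by gcongr
      _ = _ := by rw [e2, hy]; ring

/-- With `T = e^{x/(d+1)} ≥ 1`, the growth is at most `2^d T^{d+1}`; the division by `d + 1` in the
time scale comes from this power. -/
theorem time_growth_le {d : ℕ} {t x : ℝ} (hx : 0 ≤ x) (ht : |t| ≤ Real.exp (x / (d + 1))) :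
    |t| * (1 + |t|) ^ d ≤ 2 ^ d * Real.exp x := by
  have h1 : 1 ≤ Real.exp (x / (d + 1)) := Real.one_le_exp (by positivity)
  have h2 : Real.exp x = Real.exp (x / (d + 1)) ^ (d + 1) := by
    rw [← Real.exp_nat_mul]
    congr 1
    push_cast
    field_simp
  rw [h2]
  calc |t| * (1 + |t|) ^ d ≤ Real.exp (x / (d + 1)) * (2 * Real.exp (x / (d + 1))) ^ d := by
        gcongr
        linarith
    _ = _ := by rw [mul_pow, pow_succ]; ring

theorem mul_exp_neg_le_one (x : ℝ) : x * Real.exp (-x) ≤ 1 := by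
  rw [Real.exp_neg, mul_inv_le_iff₀ (Real.exp_pos x)]
  linarith [Real.add_one_le_exp x]

theorem one_le_exp_one_div : 1 ≤ Real.exp 1 / (Real.exp 1 - 1) := by
  have := Real.add_one_le_exp (1 : ℝ)
  rw [le_div_iff₀ (by linarith)]
  linarith

theorem exp_neg_le_div {κ : ℝ} (hκ : 0 < κ) :
    Real.exp (-(3 * κ / 4)) ≤ 4 / (3 * κ) := by
  have := mul_exp_neg_le_one (3 * κ / 4)
  rw [le_div_iff₀ (by positivity)]
  linarith

/-- The constant that controls the distance to `N` is dominated by the one in the theorem. -/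
theorem distance_constant_le {κ x : ℝ} (hκ : 0 < κ) (hx : 5 * κ / 4 ≤ x) :
    8 * Real.pi * Real.exp (-x) ≤
      256 * Real.pi * (Real.exp 1 / (Real.exp 1 - 1)) * (Real.exp (-κ / 4) / κ) := by
  have h1 : Real.exp (-x) ≤ Real.exp (-κ / 4) / κ := by
    rw [le_div_iff₀ hκ]
    calc Real.exp (-x) * κ ≤ Real.exp (-κ / 4 + -κ) * κ := by
          gcongr
          linarith
      _ = Real.exp (-κ / 4) * (κ * Real.exp (-κ)) := by rw [Real.exp_add]; ring
      _ ≤ Real.exp (-κ / 4) * 1 := by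
          gcongr
          exact mul_exp_neg_le_one κ
      _ = _ := mul_one _
  have h2 := one_le_exp_one_div
  have hpi := Real.pi_pos
  have h3 : 0 < Real.exp (-κ / 4) / κ := by positivity
  calc 8 * Real.pi * Real.exp (-x) ≤ 256 * Real.pi * 1 * (Real.exp (-κ / 4) / κ) := by
        rw [mul_one]
        gcongr
        norm_num
    _ ≤ _ := by gcongr

theorem one_le_bracket (x : ℝ) : 1 ≤ bracket x :=
  Real.one_le_sqrt.2 (by nlinarith [sq_nonneg x])

theorem le_bracket (x : ℝ) : x ≤ bracket x :=
  Real.le_sqrt_of_sq_le (by linarith)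

end Main

end Lattice

end

/-! ### Assembly of the theorem. -/

open Lattice Real in
theorem theorem1 (d : ℕ) (κ : ℝ) (hκ : 0 < κ) :
    ∃ C_LR : ℕ → ℝ, (∀ s, 0 < C_LR s) ∧
    ∀ (L q : ℕ) (N P : ExtOp d L q) (ε ε₀ : ℝ),
      N.SelfAdj → P.SelfAdj → N.OnSite → IntSpectrum N.op →
      0 < ε → ε < ε₀ →
      ε₀ * (64 * π * (3 * (exp 1 - 1) + exp 1 ^ 2) * P.norm κ) ≤ exp 1 - 1 →
      ∃ 𝒩 𝒵 : ExtOp d L q,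
        𝒩.SelfAdj ∧ 𝒵.SelfAdj ∧
        -- locality of the two operators, uniformly in the size of the lattice
        (ε₀ * (64 * π * (3 * (exp 1 - 1) + exp 1 ^ 2) * P.norm κ) ≤ (exp 1 - 1) * κ →
          𝒩.norm (κ / 2) ≤ 4 * N.norm κ ∧
          𝒵.norm (κ / 2) ≤ 4 * (exp 1 / (exp 1 - 1)) * ε * P.norm κ) ∧
        -- (i)
        IntSpectrum 𝒩.op ∧
        -- (ii)
        ‖𝒩.op - N.op‖ / Fintype.card (Site d L) ≤
          (256 * π * (exp 1 / (exp 1 - 1)) * (exp (-κ / 4) / κ) * P.norm κ) * ε * N.norm κ ∧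
        -- (iii)
        (∀ t : ℝ,
          ‖evol (N.op + (ε : ℂ) • P.op) t 𝒩.op - 𝒩.op‖ / Fintype.card (Site d L) ≤
            (16 / (3 * κ) * P.norm κ) * N.norm (3 * κ / 4) * |t| * ε * exp (-ε₀ / ε)) ∧
        (∀ t : ℝ,
          ‖evol (N.op + (ε : ℂ) • P.op) t 𝒵.op - 𝒵.op‖ / Fintype.card (Site d L) ≤
            (16 / (3 * κ) * (exp 1 / (exp 1 - 1)) * P.norm κ ^ 2) * |t| * ε ^ 2 *
              exp (-ε₀ / ε)) ∧
        -- (iv)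
        𝒩.op * 𝒵.op - 𝒵.op * 𝒩.op = 0 ∧
        -- (v)
        (∀ (S : Finset (Site d L)) (O : Op d L q) (t : ℝ),
          IsConn S → SupportedOn S O → |t| ≤ exp (ε₀ / ((d + 1) * ε)) →
          ‖evol (N.op + (ε : ℂ) • P.op) t O - evol (𝒩.op + 𝒵.op) t O‖ ≤
            (8 * π * (exp 1 / (exp 1 - 1)) * P.norm κ * S.card +
              2 ^ (d + 1) * C_LR S.card *
                bracket (N.norm κ + ε * (exp 1 / (exp 1 - 1)) * P.norm κ) ^ d *
                exp 1 * P.norm κ) * ε * ‖O‖) := by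
  obtain ⟨K, hK0, hK⟩ := exists_norm_heis_sub_heis_le d hκ
  -- The added 1 only ensures positivity.
  refine ⟨fun s => K * s + 1, fun s => by positivity, ?_⟩
  intro L q N P ε ε₀ hN hP hNon hint hε hεε₀ _
  have hPn : 0 ≤ P.norm κ := ExtOp.nrm_toLocFam κ P ▸ LocFam.nrm_nonneg κ P.toLocFam
  have hNn : 0 ≤ N.norm κ := ExtOp.nrm_toLocFam κ N ▸ LocFam.nrm_nonneg κ N.toLocFam
  have hNn' : 0 ≤ N.norm (3 * κ / 4) :=
    ExtOp.nrm_toLocFam (3 * κ / 4) N ▸ LocFam.nrm_nonneg _ N.toLocFam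
  have hpi := Real.pi_pos
  have hg := one_le_exp_one_div
  have hcard : (0 : ℝ) < Fintype.card (Site d L) := by
    exact_mod_cast Fintype.card_pos
  have hHsa : IsSelfAdjoint (N.op + (ε : ℂ) • P.op) := by
    have := (LocFam.SelfAdj.add (A := N.toLocFam) hN
      (LocFam.SelfAdj.ofReal_smul (A := P.toLocFam) hP ε)).op
    rwa [map_add, map_smul] at this
  generalize hC : (Fintype.card (Site d L) : ℝ) = c at hcard ⊢
  generalize hp : P.norm κ = p at hPn ⊢
  generalize hn : N.norm κ = n at hNn ⊢
  generalize hn' : N.norm (3 * κ / 4) = n' at hNn' ⊢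
  have hb := one_le_bracket (n + ε * (exp 1 / (exp 1 - 1)) * p)
  by_cases hs : ε₀ * (64 * π * (3 * (exp 1 - 1) + exp 1 ^ 2) * p) ≤ (exp 1 - 1) * κ
  -- the local regime: finitely many steps of the normal form iteration
  · obtain ⟨𝒩, 𝒵, W, h𝒩, h𝒵, hW, hsum, hn𝒩, hn𝒵, hnW, hint', hdist, hcN, hcZ, hcom⟩ :=
      exists_local_splitting (N := N.toLocFam) (P := P.toLocFam) hNon hN hP hint hκ hε hεε₀
        (by rwa [ExtOp.nrm_toLocFam, hp])
    simp only [ExtOp.nrm_toLocFam, hp, hn, hn', hC] at hn𝒩 hn𝒵 hnW hdist hcN hcZ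
    have hexp := exp_neg_le_div hκ
    have hE := exp_pos (-ε₀ / ε)
    refine ⟨𝒩.toExtOp, 𝒵.toExtOp, h𝒩, h𝒵, fun _ => ⟨?_, ?_⟩, hint', ?_, ?_, ?_, hcom, ?_⟩
    · rw [LocFam.norm_toExtOp]
      linarith
    · rw [LocFam.norm_toExtOp]
      refine hn𝒵.trans ?_
      have : 1 * (ε * p) ≤ exp 1 / (exp 1 - 1) * (ε * p) := by gcongr
      linarith
    · rw [div_le_iff₀' hcard]
      refine hdist.trans (mul_le_mul_of_nonneg_left ?_ hcard.le)
      have h1 := distance_constant_le hκ (x := 3 * κ / 4 + κ) (by linarith)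
      rw [neg_add, exp_add] at h1
      calc _ = 8 * π * (exp (-(3 * κ / 4)) * exp (-κ)) * ((ε * p) * n) := by ring
        _ ≤ _ := mul_le_mul_of_nonneg_right h1 (by positivity)
        _ = _ := by ring
    · intro t
      rw [div_le_iff₀' hcard]
      refine (norm_heis_sub_le hHsa t _).trans
        ((mul_le_mul_of_nonneg_left hcN (abs_nonneg t)).trans ?_)
      have h0 : 0 ≤ c * (|t| * (ε * p * exp (-ε₀ / ε)) * n') := by
        positivity
      calc _ = 2 * exp (-(3 * κ / 4)) *
            (c * (|t| * (ε * p * exp (-ε₀ / ε)) * n')) := by ring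
        _ ≤ 4 * (4 / (3 * κ)) *
            (c * (|t| * (ε * p * exp (-ε₀ / ε)) * n')) := by
            gcongr
            norm_num
        _ = _ := by ring
    · intro t
      rw [div_le_iff₀' hcard]
      refine (norm_heis_sub_le hHsa t _).trans
        ((mul_le_mul_of_nonneg_left hcZ (abs_nonneg t)).trans ?_)
      have h0 : 0 ≤ c * (|t| * (ε * p * exp (-ε₀ / ε)) * (ε * p)) := by
        positivity
      calc _ = 4 * exp (-(3 * κ / 4)) * 1 *
            (c * (|t| * (ε * p * exp (-ε₀ / ε)) * (ε * p))) := by ring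
        _ ≤ 4 * (4 / (3 * κ)) * (exp 1 / (exp 1 - 1)) *
            (c * (|t| * (ε * p * exp (-ε₀ / ε)) * (ε * p))) := by
            gcongr
        _ = _ := by ring
    · intro S O t hS hO ht
      set b := bracket (n + ε * (exp 1 / (exp 1 - 1)) * p) with hbdef
      have hh : LocFam.nrm κ (N.toLocFam + (ε : ℂ) • P.toLocFam) ≤ b := by
        refine (LocFam.nrm_add_le _ _ _).trans ?_
        have h1 := LocFam.nrm_smul_le κ (ε : ℂ) P.toLocFam
        rw [Complex.norm_real, Real.norm_of_nonneg hε.le] at h1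
        rw [ExtOp.nrm_toLocFam, hp] at h1
        rw [ExtOp.nrm_toLocFam, hn]
        have h2 : ε * 1 * p ≤ ε * (exp 1 / (exp 1 - 1)) * p := by gcongr
        have h3 := le_bracket (n + ε * (exp 1 / (exp 1 - 1)) * p)
        linarith
      -- The comparison takes place in the original frame, where `𝒩 + 𝒵 = H - W`. The factor
      -- `e^{-ε₀/ε}` in `W` cancels the growth over the allowed times, leaving one `ε`.
      have key := hK L q _ W (LocFam.SelfAdj.add (A := N.toLocFam) hN
        (LocFam.SelfAdj.ofReal_smul (A := P.toLocFam) hP ε)) hW b hb hh S O hS.nonempty hO t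
      rw [map_add, map_smul, show LocFam.op N.toLocFam + (ε : ℂ) • LocFam.op P.toLocFam -
        LocFam.op W = LocFam.op 𝒩 + LocFam.op 𝒵 by rw [← hsum]; abel] at key
      have hx : 0 ≤ ε₀ / ε := by have := hε.trans hεε₀; positivity
      have htg := time_growth_le (d := d) (t := t) hx
        (by rwa [show ε₀ / ((d + 1) * ε) = ε₀ / ε / (d + 1) by field_simp] at ht)
      have hEE : exp (-ε₀ / ε) * exp (ε₀ / ε) = 1 := by
        rw [← exp_add, neg_div, neg_add_cancel, exp_zero]
      have he : 1 ≤ exp 1 := one_le_exp zero_le_one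
      have hs0 : (0 : ℝ) ≤ S.card := Nat.cast_nonneg _
      have hT : 0 ≤ |t| * (1 + |t|) ^ d := by positivity
      refine key.trans ?_
      have hW0 := LocFam.nrm_nonneg (κ / 2) W
      calc _ ≤ K * S.card * b ^ d * (2 * (ε * p * exp (-ε₀ / ε))) * ‖O‖ *
              (2 ^ d * exp (ε₀ / ε)) := by gcongr
        _ = 2 ^ (d + 1) * (K * S.card) * b ^ d * 1 * p * ε * ‖O‖ *
              (exp (-ε₀ / ε) * exp (ε₀ / ε)) := by ring
        _ = (0 + 2 ^ (d + 1) * (K * S.card) * b ^ d * 1 * p) * ε * ‖O‖ := by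
            rw [hEE]; ring
        _ ≤ _ := by
            gcongr
            · positivity
            · linarith
  -- locality is not claimed here, and the exact spectral splitting has all the other properties
  · obtain ⟨M, hM, hMint, hcom, hdist⟩ := exists_spectral_splitting (N := N.toLocFam)
      (P := P.toLocFam) hNon hN hP hint hκ hε
    simp only [ExtOp.nrm_toLocFam, hp, hn, hC] at hdist
    have hcom' : Commute (N.op + (ε : ℂ) • P.op) M := hcom
    have e1 : (LocFam.wholeBox M).toExtOp.op = M := LocFam.op_wholeBox M
    have e2 : (LocFam.wholeBox (N.op + (ε : ℂ) • P.op - M)).toExtOp.op = N.op + (ε : ℂ) • P.op - M :=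
      LocFam.op_wholeBox _
    refine ⟨(LocFam.wholeBox M).toExtOp, (LocFam.wholeBox (N.op + (ε : ℂ) • P.op - M)).toExtOp,
      LocFam.selfAdj_wholeBox hM, LocFam.selfAdj_wholeBox (hHsa.sub hM), fun h => absurd h hs, ?_, ?_, ?_, ?_,
      ?_, ?_⟩
    · rwa [e1]
    · rw [e1, div_le_iff₀' hcard]
      refine hdist.trans (mul_le_mul_of_nonneg_left ?_ hcard.le)
      have h1 := distance_constant_le hκ (x := 2 * κ) (by linarith)
      calc _ = 8 * π * exp (-(2 * κ)) * ((ε * p) * n) := by ring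
        _ ≤ _ := mul_le_mul_of_nonneg_right h1 (by positivity)
        _ = _ := by ring
    · intro t
      rw [e1, evol_eq_heis, heis_of_commute hcom', sub_self, norm_zero, zero_div]
      positivity
    · intro t
      rw [e2, evol_eq_heis, heis_of_commute ((Commute.refl _).sub_right hcom'), sub_self,
        norm_zero, zero_div]
      positivity
    · rw [e1, e2, sub_eq_zero]
      exact (hcom'.symm.sub_right (Commute.refl M)).eq
    -- Here `𝒩 + 𝒵 = H`, so the two dynamics coincide.
    · intro S O t _ _ _
      rw [e1, e2, add_sub_cancel, sub_self, norm_zero]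
      positivity
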